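/- Consider the following online problem, the $(1+\varepsilon)$-overprovisioned $\Delta$-recoloring problem. There are $n$ vertices, $\Delta$ colors (with $\Delta\mid n$), and an initial coloring $c_0$ in which every color is assigned to exactly $n/\Delta$ vertices. A finite sequence $\sigma$ of edges on the vertices is revealed one edge at a time (edges may repeat); the graph formed by all edges of $\sigma$ has maximum degree at most $(1-\varepsilon)\Delta$. After each request the algorithm must hold a $\Delta$-coloring that is proper for all edges revealed so far and in which every color is assigned to at most $(1+\varepsilon)\frac{n}{\Delta}$ vertices. Changing the color of a vertex costs $1$. Let $OPT(c_0,\sigma)$ be the minimum total cost of an offline solution, which knows $\sigma$ in advance, starts from $c_0$, uses the same $\Delta$ colors, and holds after each request a coloring that is proper for all edges revealed so far, with no capacity constraint. For every $\varepsilon>0$ and every $K$ there is a constant $C$, depending only on $\varepsilon$ and $K$, such that for all integers $n\ge 2$ and $\Delta\ge 1$ with $\Delta\le K\sqrt{n/\log n}$ there is a randomized online algorithm for this problem (always holding a proper coloring within capacity) that is $C$-competitive against an oblivious adversary: for every such $c_0$ and every such sequence $\sigma$, both fixed in advance, its expected total cost on $\sigma$ is at most $C\cdot OPT(c_0,\sigma)$.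 -/

import Mathlib

open MeasureTheory
open scoped ENNReal NNReal

namespace OnlineRecoloring

/-- The simple graph induced by a list of edge requests. -/
def requestGraph {V : Type*} (σ : List (V × V)) : SimpleGraph V :=
  SimpleGraph.fromRel fun u v => (u, v) ∈ σ

/-- A coloring is proper for the requests seen so far if it separates both ends of each of them. -/
def IsProper {V : Type*} {k : ℕ} (c : V → Fin k) (σ : List (V × V)) : Prop :=
  ∀ e ∈ σ, c e.1 ≠ c e.2

/-- The number of vertices of color `i`. -/
def load {V : Type*} [Fintype V] {k : ℕ} (c : V → Fin k) (i : Fin k) : ℕ :=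
  (Finset.univ.filter fun v => c v = i).card

/-- Every color has exactly `|V| / k` vertices. -/
def IsBalanced {V : Type*} [Fintype V] {k : ℕ} (c : V → Fin k) : Prop :=
  ∀ i, (load c i : ℝ) = (Fintype.card V : ℝ) / k

/-- Every color has at most `(1 + ε) |V| / k` vertices. -/
def WithinCapacity {V : Type*} [Fintype V] {k : ℕ} (ε : ℝ) (c : V → Fin k) : Prop :=
  ∀ i, (load c i : ℝ) ≤ (1 + ε) * ((Fintype.card V : ℝ) / k)

/-- The request sequences of the `(1 + ε)`-overprovisioned `k`-recoloring problem: finite lists of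
edges (repetitions allowed) that induce a graph of maximum degree at most `(1 - ε) k`. -/
def IsAdmissible {V : Type*} (ε : ℝ) (k : ℕ) (σ : List (V × V)) : Prop :=
  (∀ e ∈ σ, e.1 ≠ e.2) ∧
    ∀ v, (((requestGraph σ).neighborSet v).ncard : ℝ) ≤ (1 - ε) * k

/-- The number of single-vertex recolorings in the first `T` steps of a sequence of colorings;
`hammingDist` counts the vertices whose color differs. -/
def recoloringCost {V : Type*} [Fintype V] {k : ℕ} (s : ℕ → V → Fin k) (T : ℕ) : ℕ :=
  ∑ t ∈ Finset.range T, hammingDist (s t) (s (t + 1))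

/-- An offline solution for `σ` starting from `c₀`, without capacity constraints:
`s t` is the coloring held after the first `t` requests. -/
def IsOfflineSolution {V : Type*} {k : ℕ} (c₀ : V → Fin k) (σ : List (V × V))
    (s : ℕ → V → Fin k) : Prop :=
  s 0 = c₀ ∧ ∀ t ≤ σ.length, IsProper (s t) (σ.take t)

/-- The optimal offline cost with `k` colors of unbounded capacity. -/
noncomputable def offlineOpt {V : Type*} [Fintype V] {k : ℕ} (c₀ : V → Fin k)
    (σ : List (V × V)) : ℝ≥0∞ :=
  ⨅ (s : ℕ → V → Fin k) (_ : IsOfflineSolution c₀ σ s), (recoloringCost s σ.length : ℝ≥0∞)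

/-- A randomized online recoloring algorithm: a random deterministic online algorithm.
`color ω c₀ σ` is the coloring held after the requests `σ` (in order of arrival) have been served,
when the initial coloring is `c₀` and the random seed is `ω`. It is a function of the requests that
have arrived so far, so the algorithm does not see the future. -/
structure RandomizedAlgorithm (V : Type) (k : ℕ) where
  /-- the random seeds -/
  Ω : Type
  [measurableSpace : MeasurableSpace Ω]
  /-- the law of the seed -/
  law : Measure Ω
  [isProbability : IsProbabilityMeasure law]
  color : Ω → (V → Fin k) → List (V × V) → V → Fin k
  color_nil : ∀ ω c₀, color ω c₀ [] = c₀
  measurable_color : ∀ c₀ σ, Measurable fun ω => color ω c₀ σ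

namespace RandomizedAlgorithm

attribute [instance] measurableSpace isProbability

variable {V : Type} {k : ℕ}

/-- The colorings held by the algorithm while it serves `σ`. -/
def colorings (A : RandomizedAlgorithm V k) (c₀ : V → Fin k) (σ : List (V × V)) (ω : A.Ω) :
    ℕ → V → Fin k :=
  fun t => A.color ω c₀ (σ.take t)

/-- The expected cost of the algorithm on the fixed request sequence `σ`. -/
noncomputable def expectedCost [Fintype V] (A : RandomizedAlgorithm V k) (c₀ : V → Fin k)
    (σ : List (V × V)) : ℝ≥0∞ :=
  ∫⁻ ω, (recoloringCost (A.colorings c₀ σ ω) σ.length : ℝ≥0∞) ∂A.law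

/-- The algorithm solves the `(1 + ε)`-overprovisioned problem: from every balanced initial coloring,
on every admissible request sequence and for every outcome of its coin flips, it holds at all times a
coloring that is proper for the requests so far and within capacity. -/
def IsFeasible [Fintype V] (A : RandomizedAlgorithm V k) (ε : ℝ) : Prop :=
  ∀ c₀ : V → Fin k, IsBalanced c₀ → ∀ σ, IsAdmissible ε k σ → ∀ ω, ∀ t ≤ σ.length,
    IsProper (A.colorings c₀ σ ω t) (σ.take t) ∧ WithinCapacity ε (A.colorings c₀ σ ω t)

/-- The algorithm is `C`-competitive against an oblivious adversary, who fixes the initial coloring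
and the whole request sequence in advance. -/
def IsCompetitive [Fintype V] (A : RandomizedAlgorithm V k) (ε : ℝ) (C : ℝ≥0) : Prop :=
  ∀ c₀ : V → Fin k, IsBalanced c₀ → ∀ σ, IsAdmissible ε k σ →
    A.expectedCost c₀ σ ≤ C * offlineOpt c₀ σ

end RandomizedAlgorithm

end OnlineRecoloring

/-! The algorithm works in epochs. Inside an epoch a conflict is resolved by giving a vertex a
uniformly random color among those its known neighbors do not have: both ends are recolored if
neither was recolored in this epoch, otherwise only the end recolored last. Write k for Δ. A vertex
with d known neighbors has at least k - d available colors, and at most (1 - ε)k - d neighbors are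
still to come, so the picked color collides with the present color of a future neighbor with
probability at most 1 - ε. Each recoloring therefore starts a chain of expected length at most 1/ε
(`expect_opsPot_recolor`, `expect_costPot_conflict`).

The first epoch starts from the given coloring. Let D be the set of vertices whose color an offline
solution has changed at the end. It meets every request that is monochromatic in the initial
coloring, so the expected number of recolorings is at most 2|D|/ε, and |D| is at most the offline
cost.

An epoch fails after more than about ε²n/16 recolorings, or more than about εn/(2k) picks of one
color. Until then the capacity is respected: vertices not yet recolored form classes that only
shrink, and the others are counted by the picks. In the first epoch the first kind of failure has
probability O(|D|/n) by Markov. The second is exponentially unlikely in n/k, hence O(1/n); of the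
hypothesis on Δ only Δ² = O(n) is needed. It remains to see that everything after a failure costs
O(n) in expectation, for then it contributes O(|D|).

There are at most nk distinct requests, so epochs of length δnk number O(1/δ), and each attempt to
start one costs O(n). It suffices that an epoch fails with probability at most 1/2
(`futureCost_le_restartBound`). This is where the adversary must be oblivious. The colors are split
into palettes of B to 2B colors, B a constant, and each vertex gets a random palette. All but O(n/B)
vertices have fewer neighbors in their palette than the palette has colors, so the Hajnal–Szemerédi
theorem colors the rest properly and evenly inside each palette, and the bad vertices are recolored
at random. A request of the epoch is monochromatic only if both ends share a palette, which has
probability at most 2B/k, so at most about 2Bδn conflicts are expected, well within the budget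
(`exists_start`, `exists_start_of_large`). If k < B, any balanced proper coloring serves. After a
failure a deterministic equitable coloring is held until a restart at a later new request succeeds.

The Hajnal–Szemerédi theorem is proved by the argument of Kierstead and Kostochka. -/

namespace EquitableColoring

/-! ### Hajnal–Szemerédi: moving vertices along paths of colors -/

open Finset
open scoped Classical

variable {V κ : Type*}

/-- The color `f` is proper on the vertices of `X`. -/
def ProperOn (G : SimpleGraph V) (X : Finset V) (f : V → κ) : Prop :=
  ∀ u ∈ X, ∀ v ∈ X, G.Adj u v → f u ≠ f v

/-- The vertices of `X` with color `c`. -/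
noncomputable def cls (X : Finset V) (f : V → κ) (c : κ) : Finset V := X.filter fun v => f v = c

/-- Some vertex of color `p` can be moved to color `q`. -/
def Movable (G : SimpleGraph V) (X : Finset V) (f : V → κ) (p q : κ) : Prop :=
  ∃ x ∈ X, f x = p ∧ ∀ y ∈ X, f y = q → ¬ G.Adj x y

/-- The color `t` can be reached from a color along a simple path of moves inside `Z`. -/
inductive Reach (G : SimpleGraph V) (X : Finset V) (f : V → κ) (t : κ) : Finset κ → κ → Prop
  | refl {Z} : t ∈ Z → Reach G X f t Z t
  | step {Z p q} : p ∈ Z → Movable G X f p q → Reach G X f t (Z.erase p) q → Reach G X f t Z p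

variable {G : SimpleGraph V} {X : Finset V} {f : V → κ} {t : κ}

@[simp] lemma mem_cls {c : κ} {v : V} : v ∈ cls X f c ↔ v ∈ X ∧ f v = c := by
  simp [cls]

lemma Reach.mem {Z : Finset κ} {p : κ} (h : Reach G X f t Z p) : p ∈ Z := by
  cases h <;> assumption

lemma Reach.target_mem {Z : Finset κ} {p : κ} (h : Reach G X f t Z p) : t ∈ Z := by
  induction h with
  | refl h => exact h
  | step _ _ _ ih => exact (mem_erase.1 ih).2

lemma Reach.mono {Z Z' : Finset κ} {p : κ} (h : Reach G X f t Z p) (hZ : Z ⊆ Z') :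
    Reach G X f t Z' p := by
  induction h generalizing Z' with
  | refl h => exact .refl (hZ h)
  | step hp hm _ ih => exact .step (hZ hp) hm (ih (erase_subset_erase _ hZ))

/-- Either the path misses `p`, or its tail from `p` on is a path from `p`. -/
lemma Reach.avoid_or {Z : Finset κ} {q : κ} (h : Reach G X f t Z q) (p : κ) :
    Reach G X f t (Z.erase p) q ∨ Reach G X f t Z p := by
  induction h with
  | @refl Z h =>
    by_cases hp : t = p
    · subst hp; exact .inr (.refl h)
    · exact .inl (.refl (mem_erase.2 ⟨hp, h⟩))
  | @step Z a b ha hm hr ih =>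
    by_cases hp : a = p
    · subst hp; exact .inr (.step ha hm hr)
    · rcases ih with ih | ih
      · left
        refine .step (mem_erase.2 ⟨hp, ha⟩) hm ?_
        rwa [erase_right_comm]
      · exact .inr (ih.mono (erase_subset _ _))

lemma Reach.cons {Z : Finset κ} {p q : κ} (hp : p ∈ Z) (hm : Movable G X f p q)
    (h : Reach G X f t Z q) : Reach G X f t Z p := by
  rcases h.avoid_or p with h | h
  · exact .step hp hm h
  · exact h

/-- Every color on a path to `t` is accessible itself, by the tail of the path. -/
lemma Reach.filter {Z P : Finset κ} {p : κ} (h : Reach G X f t Z p) (hZ : Z ⊆ P) :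
    Reach G X f t (Z.filter fun c => Reach G X f t P c) p := by
  induction h with
  | refl h => exact .refl (mem_filter.2 ⟨h, .refl (hZ h)⟩)
  | @step Z a b ha hm hr ih =>
    refine .step (mem_filter.2 ⟨ha, (Reach.step ha hm hr).mono hZ⟩) hm ?_
    rw [← filter_erase]
    exact ih ((erase_subset _ _).trans hZ)

lemma Reach.congr {Z : Finset κ} {p : κ} {g : V → κ} (h : Reach G X f t Z p)
    (hfg : ∀ v ∈ X, ∀ c ∈ Z, (g v = c ↔ f v = c)) : Reach G X g t Z p := by
  induction h with
  | refl h => exact .refl h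
  | @step Z a b ha hm hr ih =>
    refine .step ha ?_ (ih fun v hv c hc => hfg v hv c (mem_of_mem_erase hc))
    obtain ⟨x, hx, hxa, hxb⟩ := hm
    exact ⟨x, hx, (hfg x hx a ha).2 hxa, fun y hy hyb =>
      hxb y hy ((hfg y hy b (mem_of_mem_erase hr.mem)).1 hyb)⟩

/-- Adding a vertex to the first color of a path keeps the path. -/
lemma Reach.update {Z : Finset κ} {q : κ} {x : V} (h : Reach G X f t Z q) (hx : f x ∉ Z) :
    Reach G X (Function.update f x q) t Z q := by
  have key : ∀ v, ∀ c ∈ Z.erase q, (Function.update f x q v = c ↔ f v = c) := by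
    intro v c hc
    obtain ⟨hcq, hcZ⟩ := mem_erase.1 hc
    by_cases hv : v = x
    · subst hv
      simp only [Function.update_self]
      exact ⟨fun h => absurd h.symm hcq, fun h => absurd (h ▸ hcZ) hx⟩
    · simp [hv]
  cases h with
  | refl h => exact .refl h
  | @step _ _ b hq hm hr =>
    refine .step hq ?_ (hr.congr fun v _ => key v)
    obtain ⟨y, hy, hyq, hyb⟩ := hm
    have hyx : y ≠ x := by
      rintro rfl
      exact hx (hyq ▸ hq)
    exact ⟨y, hy, by simp [hyx, hyq], fun z hz hzb => hyb z hz ((key z b hr.mem).1 hzb)⟩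

lemma ProperOn.update {x : V} {q : κ} (hf : ProperOn G X f)
    (hx : ∀ y ∈ X, f y = q → ¬ G.Adj x y) : ProperOn G X (Function.update f x q) := by
  intro u hu v hv huv
  by_cases h1 : u = x
  · subst h1
    have h2 : v ≠ u := huv.ne'
    simp only [Function.update_self, ne_eq, h2, not_false_eq_true, Function.update_of_ne]
    exact fun h => hx v hv h.symm huv
  · by_cases h2 : v = x
    · subst h2
      simp only [Function.update_self, ne_eq, h1, not_false_eq_true, Function.update_of_ne]
      exact fun h => hx u hu h huv.symm
    · simpa [h1, h2] using hf u hu v hv huv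

lemma card_cls_update {x : V} (hx : x ∈ X) (q c : κ) :
    #(cls X (Function.update f x q) c) + (if c = f x then 1 else 0) =
      #(cls X f c) + (if c = q then 1 else 0) := by
  have h1 : ∀ g : V → κ, #(cls X g c) = #((X.erase x).filter fun v => g v = c) +
      (if c = g x then 1 else 0) := by
    intro g
    rw [cls, ← insert_erase hx, filter_insert, erase_insert_eq_erase]
    by_cases h : g x = c
    · rw [if_pos h, card_insert_of_notMem (by simp), if_pos h.symm]
      simp
    · rw [if_neg h, if_neg (Ne.symm h)]
      simp
  rw [h1 f, h1 (Function.update f x q)]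
  have h2 : ((X.erase x).filter fun v => Function.update f x q v = c) =
      (X.erase x).filter fun v => f v = c := by
    refine filter_congr fun v hv => ?_
    simp [(mem_erase.1 hv).1]
  rw [h2]
  simp only [Function.update_self]
  omega

/-- Shifting one vertex along each edge of a path of moves. -/
lemma exists_shift (n : ℕ) : ∀ (Z : Finset κ) (f : V → κ) (p : κ), #Z = n → ProperOn G X f →
    Reach G X f t Z p → ∃ g : V → κ, ProperOn G X g ∧ (∀ v, f v ∉ Z → g v = f v) ∧
      (∀ v, f v ∈ Z → g v ∈ Z) ∧
      ∀ c, #(cls X g c) + (if c = p then 1 else 0) = #(cls X f c) + (if c = t then 1 else 0) := by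
  induction n with
  | zero =>
    intro Z f p hZ _ h
    rw [card_eq_zero] at hZ
    subst hZ
    exact absurd h.mem (by simp)
  | succ n ih =>
    intro Z f p hZ hf h
    cases h with
    | refl h => exact ⟨f, hf, fun _ _ => rfl, fun _ h => h, fun c => rfl⟩
    | @step _ _ q hp hm hr =>
      obtain ⟨x, hx, hxp, hxq⟩ := hm
      -- `x` moves first. The rest of the path avoids `p`, and its first color `q` has only gained a
      -- vertex, so it is still a path for the updated coloring.
      obtain ⟨g, hg, h1, h2, h3⟩ := ih (Z.erase p) (Function.update f x q) q
        (by rw [card_erase_of_mem hp, hZ]; rfl) (hf.update hxq)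
        (hr.update (by rw [hxp]; simp))
      refine ⟨g, hg, fun v hv => ?_, fun v hv => ?_, fun c => ?_⟩
      · have hvx : v ≠ x := by rintro rfl; exact hv (hxp ▸ hp)
        rw [h1 v (by simp [hvx, hv]), Function.update_of_ne hvx]
      · by_cases hvx : v = x
        · exact mem_of_mem_erase (h2 v (by subst hvx; simpa using hr.mem))
        · by_cases hvp : f v = p
          · rw [h1 v (by simp [hvx, hvp]), Function.update_of_ne hvx]; exact hv
          · exact mem_of_mem_erase (h2 v (by simp [hvx, hvp, hv]))
      · have := h3 c
        have := card_cls_update (f := f) hx q c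
        rw [hxp] at this
        omega

end EquitableColoring

/-! ### Nearly equitable colorings and accessible colors -/

namespace EquitableColoring

open Finset
open scoped Classical

variable {V κ : Type*} {G : SimpleGraph V} {X : Finset V} {P : Finset κ} {s : ℕ} {f : V → κ}
  {t pp : κ}

/-- There is a proper coloring of `X` by `P` with all color classes of size `s`. -/
def HasEquitable (G : SimpleGraph V) (X : Finset V) (P : Finset κ) (s : ℕ) : Prop :=
  ∃ f : V → κ, (∀ v ∈ X, f v ∈ P) ∧ ProperOn G X f ∧ ∀ c ∈ P, #(cls X f c) = s

/-- A proper coloring all of whose classes have size `s`, except that `t` misses one vertex and `pp`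
has one too many. -/
structure NearlyEquitable (G : SimpleGraph V) (X : Finset V) (P : Finset κ) (s : ℕ) (f : V → κ)
    (t pp : κ) : Prop where
  maps : ∀ v ∈ X, f v ∈ P
  proper : ProperOn G X f
  t_mem : t ∈ P
  pp_mem : pp ∈ P
  card : ∀ c ∈ P, #(cls X f c) + (if c = t then 1 else 0) = s + (if c = pp then 1 else 0)

/-- The accessible colors. -/
noncomputable def acc (G : SimpleGraph V) (X : Finset V) (P : Finset κ) (f : V → κ) (t : κ) :
    Finset κ := P.filter fun c => Reach G X f t P c

/-- The vertices of inaccessible color. -/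
noncomputable def inacc (G : SimpleGraph V) (X : Finset V) (P : Finset κ) (f : V → κ) (t : κ) :
    Finset V := X.filter fun v => f v ∉ acc G X P f t

lemma mem_acc {c : κ} : c ∈ acc G X P f t ↔ Reach G X f t P c := by
  rw [acc, mem_filter]
  exact ⟨fun h => h.2, fun h => ⟨h.mem, h⟩⟩

lemma mem_inacc {v : V} : v ∈ inacc G X P f t ↔ v ∈ X ∧ f v ∉ acc G X P f t := by
  rw [inacc, mem_filter]

lemma acc_subset : acc G X P f t ⊆ P := filter_subset _ _

lemma inacc_subset : inacc G X P f t ⊆ X := filter_subset _ _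

/-- One neighbor in each class of `C` lies outside `Y` and can be deducted from the degree. This
turns "`v` cannot move to any color of `C`" into a bound on its degree into `Y`. -/
lemma deg_add_card_le {v : V} {C : Finset κ} {Y : Finset V} (hY : Y ⊆ X)
    (hYC : ∀ y ∈ Y, f y ∉ C) (h : ∀ c ∈ C, ∃ z ∈ X, f z = c ∧ G.Adj v z) :
    #(Y.filter (G.Adj v)) + #C ≤ #(X.filter (G.Adj v)) := by
  have h1 : #C ≤ #((X.filter (G.Adj v)).filter fun z => f z ∈ C) := by
    refine le_trans (card_le_card ?_) (card_image_le (f := f))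
    intro c hc
    obtain ⟨z, hz, hzc, hv⟩ := h c hc
    exact mem_image.2 ⟨z, by simp [hz, hv, hzc, hc], hzc⟩
  have h2 : #(Y.filter (G.Adj v)) ≤ #((X.filter (G.Adj v)).filter fun z => f z ∉ C) := by
    refine card_le_card fun z hz => ?_
    rw [mem_filter] at hz
    simp [hY hz.1, hz.2, hYC z hz.1]
  have := card_filter_add_card_filter_not (s := X.filter (G.Adj v)) (fun z => f z ∈ C)
  omega

/-- The final assembly: outside `BX` only colors of `A` occur, with a gap at `W`; `y` fills the gap,
and the rest of `BX` is colored by the complementary colors, so the two sides cannot clash. -/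
lemma hasEquitable_combine {A : Finset κ} (hA : A ⊆ P) {BX : Finset V} (hBX : BX ⊆ X) {y : V}
    (hy : y ∈ BX) {W : κ} (hW : W ∈ A) {f₂ : V → κ} (hf₂ : ∀ v ∈ X \ BX, f₂ v ∈ A)
    (hproper : ProperOn G (X \ BX) f₂) (hyW : ∀ v ∈ X \ BX, G.Adj y v → f₂ v ≠ W)
    (hcard : ∀ c ∈ A, #(cls (X \ BX) f₂ c) + (if c = W then 1 else 0) = s)
    (hg : HasEquitable G (BX.erase y) (P \ A) s) : HasEquitable G X P s := by
  obtain ⟨g, hgm, hgp, hgc⟩ := hg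
  let h : V → κ := fun v => if v = y then W else if v ∈ BX then g v else f₂ v
  have hh1 : h y = W := by simp [h]
  have hh2 : ∀ v ∈ BX.erase y, h v = g v := by
    intro v hv
    simp [h, (mem_erase.1 hv).1, (mem_erase.1 hv).2]
  have hh3 : ∀ v ∈ X \ BX, h v = f₂ v := by
    intro v hv
    have h1 := (mem_sdiff.1 hv).2
    have h2 : v ≠ y := by rintro rfl; exact h1 hy
    simp [h, h1, h2]
  have split : ∀ v ∈ X, v = y ∨ v ∈ BX.erase y ∨ v ∈ X \ BX := by
    intro v hv
    by_cases h1 : v = y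
    · exact .inl h1
    · by_cases h2 : v ∈ BX
      · exact .inr (.inl (mem_erase.2 ⟨h1, h2⟩))
      · exact .inr (.inr (mem_sdiff.2 ⟨hv, h2⟩))
  have half : ∀ u v, G.Adj u v → (u = y ∧ v ∈ BX.erase y ∨ u = y ∧ v ∈ X \ BX ∨
      u ∈ BX.erase y ∧ v ∈ X \ BX) → h u ≠ h v := by
    rintro u v huv (⟨rfl, hv⟩ | ⟨rfl, hv⟩ | ⟨hu, hv⟩) e
    · rw [hh1, hh2 v hv] at e
      exact (mem_sdiff.1 (hgm v hv)).2 (e ▸ hW)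
    · rw [hh1, hh3 v hv] at e
      exact hyW v hv huv e.symm
    · rw [hh2 u hu, hh3 v hv] at e
      exact (mem_sdiff.1 (hgm u hu)).2 (e ▸ hf₂ v hv)
  refine ⟨h, fun v hv => ?_, fun u hu v hv huv => ?_, fun c hc => ?_⟩
  · rcases split v hv with rfl | h1 | h1
    · rw [hh1]; exact hA hW
    · rw [hh2 v h1]; exact (mem_sdiff.1 (hgm v h1)).1
    · rw [hh3 v h1]; exact hA (hf₂ v h1)
  · rcases split u hu with h1 | h1 | h1 <;> rcases split v hv with h2 | h2 | h2
    · exact absurd (h1.trans h2.symm) huv.ne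
    · exact half u v huv (.inl ⟨h1, h2⟩)
    · exact half u v huv (.inr (.inl ⟨h1, h2⟩))
    · exact (half v u huv.symm (.inl ⟨h2, h1⟩)).symm
    · rw [hh2 u h1, hh2 v h2]; exact hgp u h1 v h2 huv
    · exact half u v huv (.inr (.inr ⟨h1, h2⟩))
    · exact (half v u huv.symm (.inr (.inl ⟨h2, h1⟩))).symm
    · exact (half v u huv.symm (.inr (.inr ⟨h2, h1⟩))).symm
    · rw [hh3 u h1, hh3 v h2]; exact hproper u h1 v h2 huv
  · by_cases hcA : c ∈ A
    · rw [← hcard c hcA]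
      by_cases hcW : c = W
      · subst hcW
        have : cls X h c = insert y (cls (X \ BX) f₂ c) := by
          ext v
          simp only [mem_cls, mem_insert]
          constructor
          · rintro ⟨hv, hvc⟩
            rcases split v hv with h1 | h1 | h1
            · exact .inl h1
            · rw [hh2 v h1] at hvc
              exact absurd hcA (hvc ▸ (mem_sdiff.1 (hgm v h1)).2)
            · rw [hh3 v h1] at hvc
              exact .inr ⟨h1, hvc⟩
          · rintro (rfl | ⟨h1, hvc⟩)
            · exact ⟨hBX hy, hh1⟩
            · exact ⟨(mem_sdiff.1 h1).1, by rw [hh3 v h1, hvc]⟩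
        rw [this, card_insert_of_notMem, if_pos rfl]
        simp [hy]
      · have : cls X h c = cls (X \ BX) f₂ c := by
          ext v
          simp only [mem_cls]
          constructor
          · rintro ⟨hv, hvc⟩
            rcases split v hv with h1 | h1 | h1
            · rw [h1, hh1] at hvc
              exact absurd hvc.symm hcW
            · rw [hh2 v h1] at hvc
              exact absurd hcA (hvc ▸ (mem_sdiff.1 (hgm v h1)).2)
            · rw [hh3 v h1] at hvc
              exact ⟨h1, hvc⟩
          · rintro ⟨h1, hvc⟩
            exact ⟨(mem_sdiff.1 h1).1, by rw [hh3 v h1, hvc]⟩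
        rw [this, if_neg hcW]; rfl
    · rw [← hgc c (mem_sdiff.2 ⟨hc, hcA⟩)]
      congr 1
      ext v
      simp only [mem_cls]
      constructor
      · rintro ⟨hv, hvc⟩
        rcases split v hv with h1 | h1 | h1
        · rw [h1, hh1] at hvc
          exact absurd (hvc ▸ hW) hcA
        · rw [hh2 v h1] at hvc
          exact ⟨h1, hvc⟩
        · rw [hh3 v h1] at hvc
          exact absurd (hvc ▸ hf₂ v h1) hcA
      · rintro ⟨h1, hvc⟩
        exact ⟨hBX (mem_erase.1 h1).2, by rw [hh2 v h1, hvc]⟩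

namespace NearlyEquitable

variable (hN : NearlyEquitable G X P s f t pp)
include hN

/-- Shifting along the path carries the surplus of `pp` to the gap at `t`. -/
lemma hasEquitable_of_reach (h : Reach G X f t P pp) : HasEquitable G X P s := by
  obtain ⟨g, hg, -, h2, h3⟩ := exists_shift (#P) P f pp rfl hN.proper h
  refine ⟨g, fun v hv => h2 v (hN.maps v hv), hg, fun c hc => ?_⟩
  have := h3 c
  have := hN.card c hc
  omega

lemma t_mem_acc : t ∈ acc G X P f t := mem_acc.2 (.refl hN.t_mem)

/-- Otherwise `y` could move to `c`, and its own color would be accessible. -/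
lemma exists_adj {y : V} (hy : y ∈ inacc G X P f t) {c : κ} (hc : c ∈ acc G X P f t) :
    ∃ z ∈ X, f z = c ∧ G.Adj y z := by
  by_contra hcon
  push Not at hcon
  rw [mem_inacc] at hy
  exact hy.2 (mem_acc.2 (.cons (hN.maps y hy.1) ⟨y, hy.1, rfl, hcon⟩ (mem_acc.1 hc)))

/-- `y` spends a neighbor on each accessible color, so the inaccessible part inherits the degree
hypothesis for its own smaller set of colors. -/
lemma deg_inacc {y : V} (hy : y ∈ inacc G X P f t) (hdeg : ∀ v ∈ X, #(X.filter (G.Adj v)) < #P) :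
    #((inacc G X P f t).filter (G.Adj y)) < #(P \ acc G X P f t) := by
  have h1 := deg_add_card_le (G := G) (f := f) (v := y) (C := acc G X P f t) inacc_subset
    (fun z hz => (mem_inacc.1 hz).2) (fun c hc => hN.exists_adj hy hc)
  have h2 := hdeg y (mem_inacc.1 hy).1
  have h3 := card_sdiff_add_card_eq_card (acc_subset (G := G) (X := X) (P := P) (f := f) (t := t))
  omega

lemma card_inacc (hpp : pp ∉ acc G X P f t) :
    #(inacc G X P f t) = s * #(P \ acc G X P f t) + 1 := by
  have h1 : #(inacc G X P f t) = ∑ c ∈ P \ acc G X P f t, #(cls X f c) := by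
    rw [card_eq_sum_card_fiberwise (f := f) (t := P \ acc G X P f t)]
    · refine sum_congr rfl fun c hc => ?_
      congr 1
      ext v
      simp only [mem_filter, mem_inacc, mem_cls]
      have := (mem_sdiff.1 hc).2
      constructor
      · rintro ⟨⟨h1, h2⟩, h3⟩; exact ⟨h1, h3⟩
      · rintro ⟨h1, h2⟩; exact ⟨⟨h1, h2 ▸ this⟩, h2⟩
    · intro v hv
      have := mem_inacc.1 hv
      exact mem_coe.2 (mem_sdiff.2 ⟨hN.maps v this.1, this.2⟩)
  have h2 : ∑ c ∈ P \ acc G X P f t, #(cls X f c) =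
      ∑ c ∈ P \ acc G X P f t, (s + if c = pp then 1 else 0) := by
    refine sum_congr rfl fun c hc => ?_
    rw [← hN.card c (mem_sdiff.1 hc).1, if_neg, add_zero]
    rintro rfl
    exact (mem_sdiff.1 hc).2 hN.t_mem_acc
  rw [h1, h2, sum_add_distrib, sum_const, smul_eq_mul, mul_comm, sum_ite_eq',
    if_pos (mem_sdiff.2 ⟨hN.pp_mem, hpp⟩)]

end NearlyEquitable

end EquitableColoring

/-! ### Terminal colors and movable solo vertices -/

namespace EquitableColoring

open Finset
open scoped Classical

variable {V κ : Type*} {G : SimpleGraph V} {X : Finset V} {P : Finset κ} {s : ℕ} {f : V → κ}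
  {t pp : κ}

/-- The accessible colors that are cut off from the target by removing `U`. -/
noncomputable def cutOff (G : SimpleGraph V) (X : Finset V) (P : Finset κ) (f : V → κ) (t U : κ) :
    Finset κ := ((acc G X P f t).erase U).filter fun c => ¬ Reach G X f t (P.erase U) c

lemma mem_cutOff {U c : κ} : c ∈ cutOff G X P f t U ↔
    c ≠ U ∧ c ∈ acc G X P f t ∧ ¬ Reach G X f t (P.erase U) c := by
  simp [cutOff, and_assoc]

lemma target_notMem_cutOff {U : κ} (ht : t ∈ P) : t ∉ cutOff G X P f t U := by
  intro h
  obtain ⟨h1, h2, h3⟩ := mem_cutOff.1 h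
  exact h3 (.refl (mem_erase.2 ⟨h1, ht⟩))

/-- A minimal nonempty set of cut-off colors consists of terminal colors. -/
lemma exists_terminal (ht : t ∈ P) (hA : ∃ c ∈ acc G X P f t, c ≠ t) :
    ∃ U ∈ acc G X P f t, (cutOff G X P f t U).Nonempty ∧
      ∀ W ∈ cutOff G X P f t U, ∀ c ∈ acc G X P f t, c ≠ W → Reach G X f t (P.erase W) c := by
  obtain ⟨c₀, hc₀, hc₀t⟩ := hA
  have hne : ((acc G X P f t).filter fun U => (cutOff G X P f t U).Nonempty).Nonempty := by
    refine ⟨t, mem_filter.2 ⟨mem_acc.2 (.refl ht), c₀, mem_cutOff.2 ⟨hc₀t, hc₀, fun h => ?_⟩⟩⟩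
    exact absurd h.target_mem (by simp)
  obtain ⟨U, hU, hmin⟩ := exists_min_image _ (fun U => #(cutOff G X P f t U)) hne
  obtain ⟨hUA, hUne⟩ := mem_filter.1 hU
  refine ⟨U, hUA, hUne, fun W hW c hc hcW => ?_⟩
  by_contra hcon
  obtain ⟨hWU, hWA, hWr⟩ := mem_cutOff.1 hW
  have hWP : W ∈ P := acc_subset hWA
  have hle := hmin W (mem_filter.2 ⟨hWA, c, mem_cutOff.2 ⟨hcW, hc, hcon⟩⟩)
  -- Anything cut off by `W` is cut off by `U`: a path to `t` that avoids `U` cannot meet `W`, since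
  -- `W` itself has no such path. The inclusion is strict because of `W`, against the minimality of
  -- `U`.
  have hss : cutOff G X P f t W ⊂ cutOff G X P f t U := by
    refine (ssubset_iff_of_subset fun d hd => ?_).2 ⟨W, hW, fun h => (mem_cutOff.1 h).1 rfl⟩
    obtain ⟨hdW, hdA, hdr⟩ := mem_cutOff.1 hd
    have avoid : ∀ d, Reach G X f t (P.erase U) d →
        Reach G X f t ((P.erase W).erase U) d := by
      intro d hd
      rcases hd.avoid_or W with h | h
      · rwa [erase_right_comm] at h
      · exact absurd h hWr
    refine mem_cutOff.2 ⟨?_, hdA, fun h => hdr ((avoid d h).mono (erase_subset _ _))⟩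
    rintro rfl
    cases mem_acc.1 hUA with
    | refl h => exact hdr (.refl (mem_erase.2 ⟨hdW, h⟩))
    | step hp hm hr => exact hdr (.step (mem_erase.2 ⟨hdW, hp⟩) hm (avoid _ hr))
  exact absurd (card_lt_card hss) (by omega)

/-- The vertex `z` is the only neighbor of `y` with its color. -/
def Solo (G : SimpleGraph V) (X : Finset V) (f : V → κ) (z y : V) : Prop :=
  z ∈ X ∧ G.Adj y z ∧ ∀ z' ∈ X, f z' = f z → G.Adj y z' → z' = z

namespace NearlyEquitable

variable (hN : NearlyEquitable G X P s f t pp)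
include hN

/-- Count the edges between class `t` and the inaccessible vertices, with q inaccessible colors. If
`t` were the only accessible color, each of the sq + 1 inaccessible vertices would send one, while
fewer than s vertices of color `t` receive at most q each. -/
lemma exists_acc_ne (hpp : pp ∉ acc G X P f t) (hdeg : ∀ v ∈ X, #(X.filter (G.Adj v)) < #P) :
    ∃ c ∈ acc G X P f t, c ≠ t := by
  by_contra hcon
  push Not at hcon
  have hacc : acc G X P f t = {t} :=
    eq_singleton_iff_unique_mem.2 ⟨hN.t_mem_acc, hcon⟩
  have h1 := hN.card_inacc hpp
  have h2 : #(P \ acc G X P f t) + 1 = #P := by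
    rw [hacc, ← card_sdiff_add_card_eq_card (singleton_subset_iff.2 hN.t_mem), card_singleton]
  have h3 := sum_card_bipartiteAbove_eq_sum_card_bipartiteBelow (s := inacc G X P f t)
    (t := cls X f t) (fun y z => G.Adj y z)
  have h4 : #(inacc G X P f t) ≤ ∑ y ∈ inacc G X P f t,
      #(bipartiteAbove (fun y z => G.Adj y z) (cls X f t) y) := by
    rw [card_eq_sum_ones]
    refine sum_le_sum fun y hy => ?_
    obtain ⟨z, hz, hzt, hyz⟩ := hN.exists_adj hy hN.t_mem_acc
    exact card_pos.2 ⟨z, by simp [hz, hzt, hyz]⟩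
  have h5 : ∑ z ∈ cls X f t, #(bipartiteBelow (fun y z => G.Adj y z) (inacc G X P f t) z) ≤
      #(cls X f t) * #(P \ acc G X P f t) := by
    rw [← smul_eq_mul]
    refine sum_le_card_nsmul _ _ _ fun z hz => ?_
    have h6 := hdeg z (mem_cls.1 hz).1
    have h7 : #(bipartiteBelow (fun y z => G.Adj y z) (inacc G X P f t) z) ≤
        #(X.filter (G.Adj z)) := by
      refine card_le_card fun y hy => ?_
      rw [mem_bipartiteBelow] at hy
      exact mem_filter.2 ⟨inacc_subset hy.1, hy.2.symm⟩
    omega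
  have h6 := hN.card t hN.t_mem
  rw [if_pos rfl, if_neg (by rintro rfl; exact hpp hN.t_mem_acc)] at h6
  have h7 : #(cls X f t) * #(P \ acc G X P f t) ≤ s * #(P \ acc G X P f t) :=
    Nat.mul_le_mul_right _ (by omega)
  omega

lemma hasEquitable_inacc_erase (hpp : pp ∉ acc G X P f t)
    (hdeg : ∀ v ∈ X, #(X.filter (G.Adj v)) < #P)
    (IH : ∀ Q ⊆ P, Q ≠ P → ∀ Y ⊆ X, #Y = s * #Q →
      (∀ v ∈ Y, #(Y.filter (G.Adj v)) < #Q) → HasEquitable G Y Q s)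
    {y : V} (hy : y ∈ inacc G X P f t) :
    HasEquitable G ((inacc G X P f t).erase y) (P \ acc G X P f t) s := by
  refine IH _ sdiff_subset ?_ _ ((erase_subset _ _).trans inacc_subset) ?_ ?_
  · intro h
    have := h ▸ hN.t_mem
    exact (mem_sdiff.1 this).2 hN.t_mem_acc
  · rw [card_erase_of_mem hy, hN.card_inacc hpp]; rfl
  · intro v hv
    refine lt_of_le_of_lt (card_le_card (filter_subset_filter _ (erase_subset _ _)))
      (hN.deg_inacc (mem_erase.1 hv).2 hdeg)

/-- Move `w` to `c` and shift from `c` to `t` along a path that avoids the old color of `w`, which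
exists because that color is terminal. As `w` was the only neighbor of `y` there, `y` takes its
place, and induction colors the other inaccessible vertices. -/
lemma hasEquitable_of_solo_movable (hpp : pp ∉ acc G X P f t)
    (hdeg : ∀ v ∈ X, #(X.filter (G.Adj v)) < #P)
    (IH : ∀ Q ⊆ P, Q ≠ P → ∀ Y ⊆ X, #Y = s * #Q →
      (∀ v ∈ Y, #(Y.filter (G.Adj v)) < #Q) → HasEquitable G Y Q s)
    {w y : V} (hW : f w ∈ acc G X P f t)
    (hterm : ∀ c ∈ acc G X P f t, c ≠ f w → Reach G X f t (P.erase (f w)) c)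
    (hy : y ∈ inacc G X P f t) (hsolo : Solo G X f w y) {c : κ} (hc : c ∈ acc G X P f t)
    (hcw : c ≠ f w) (hmove : ∀ x ∈ X, f x = c → ¬ G.Adj w x) : HasEquitable G X P s := by
  set A := acc G X P f t with hAdef
  have hr : Reach G X f t (A.erase (f w)) c := by
    refine ((hterm c hc hcw).filter (erase_subset _ P)).mono fun d hd => ?_
    obtain ⟨h1, h2⟩ := mem_filter.1 hd
    exact mem_erase.2 ⟨(mem_erase.1 h1).1, mem_acc.2 h2⟩
  obtain ⟨f₂, h1, h2, h3, h4⟩ := exists_shift _ (A.erase (f w)) (Function.update f w c) c rfl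
    (hN.proper.update hmove) (hr.update (by simp))
  have hwX : w ∈ X := hsolo.1
  have hout : ∀ v, v ≠ w → f v ∉ A.erase (f w) → f₂ v = f v := by
    intro v hv hvA
    rw [h2 v (by rwa [Function.update_of_ne hv]), Function.update_of_ne hv]
  have hin : ∀ v, v = w ∨ f v ∈ A.erase (f w) → f₂ v ∈ A.erase (f w) := by
    intro v hv
    refine h3 v ?_
    by_cases hvw : v = w
    · subst hvw; simpa using hr.mem
    · rw [Function.update_of_ne hvw]; exact hv.resolve_left hvw
  have hinacc : ∀ v ∈ inacc G X P f t, f₂ v = f v := by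
    intro v hv
    have := (mem_inacc.1 hv).2
    refine hout v ?_ fun h => this (mem_of_mem_erase h)
    rintro rfl
    exact this hW
  refine hasEquitable_combine acc_subset inacc_subset hy hW (f₂ := f₂) ?_ ?_ ?_ ?_
    (hN.hasEquitable_inacc_erase hpp hdeg IH hy)
  · intro v hv
    have hvA : f v ∈ A := by
      by_contra hcon
      exact (mem_sdiff.1 hv).2 (mem_inacc.2 ⟨(mem_sdiff.1 hv).1, hcon⟩)
    by_cases h : v = w ∨ f v ∈ A.erase (f w)
    · exact mem_of_mem_erase (hin v h)
    · push Not at h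
      rw [hout v h.1 h.2]; exact hvA
  · exact fun u hu v hv => h1 u (mem_sdiff.1 hu).1 v (mem_sdiff.1 hv).1
  · intro v hv hyv hvW
    by_cases h : v = w ∨ f v ∈ A.erase (f w)
    · exact (mem_erase.1 (hin v h)).1 hvW
    · push Not at h
      rw [hout v h.1 h.2] at hvW
      exact h.1 (hsolo.2.2 v (mem_sdiff.1 hv).1 hvW hyv)
  · intro d hd
    have e1 : cls (X \ inacc G X P f t) f₂ d = cls X f₂ d := by
      ext v
      simp only [mem_cls, mem_sdiff]
      refine ⟨fun h => ⟨h.1.1, h.2⟩, fun h => ⟨⟨h.1, fun h' => ?_⟩, h.2⟩⟩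
      rw [hinacc v h'] at h
      exact (mem_inacc.1 h').2 (h.2 ▸ hd)
    have e2 := h4 d
    have e3 := card_cls_update (f := f) hwX c d
    have e4 := hN.card d (acc_subset hd)
    have e5 : d ≠ pp := by rintro rfl; exact hpp hd
    rw [if_neg e5] at e4
    rw [e1]
    omega

end NearlyEquitable

end EquitableColoring

/-! ### Counting solo vertices -/

namespace EquitableColoring

open Finset
open scoped Classical

variable {V κ : Type*} {G : SimpleGraph V} {X : Finset V} {P : Finset κ} {s : ℕ} {f : V → κ}
  {t pp : κ}

namespace NearlyEquitable

variable (hN : NearlyEquitable G X P s f t pp)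
include hN

/-- If no solo vertex of a cut-off color is movable inside the accessible part, there are more
cut-off colors than inaccessible ones. -/
lemma card_lt_card_cutOff (hpp : pp ∉ acc G X P f t)
    (hdeg : ∀ v ∈ X, #(X.filter (G.Adj v)) < #P) {U W : κ} (hU : U ∈ acc G X P f t)
    (hW : W ∈ cutOff G X P f t U)
    (hNM : ∀ w y, f w = W → y ∈ inacc G X P f t → Solo G X f w y →
      ∀ c ∈ acc G X P f t, c ≠ f w → ∃ x ∈ X, f x = c ∧ G.Adj w x) :
    #(P \ acc G X P f t) < #(cutOff G X P f t U) := by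
  set A := acc G X P f t with hA
  set B := inacc G X P f t with hB
  set T := cutOff G X P f t U with hT
  set q := #(P \ A) with hq
  obtain ⟨hWU, hWA, hWr⟩ := mem_cutOff.1 hW
  replace hWA : W ∈ A := hWA
  have hPA : q + #A = #P := card_sdiff_add_card_eq_card acc_subset
  have hTA : T ⊆ A := fun c hc => (mem_cutOff.1 hc).2.1
  have hUT : U ∉ T := fun h => (mem_cutOff.1 h).1 rfl
  let S : V → Prop := fun w => ∃ y ∈ B, Solo G X f w y
  -- A solo vertex cannot move, so it has a neighbor in each of the other accessible classes.
  have hS : ∀ w ∈ cls X f W, S w → #(B.filter (G.Adj w)) ≤ q := by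
    rintro w hw ⟨y, hy, hsolo⟩
    obtain ⟨hwX, hwW⟩ := mem_cls.1 hw
    have h1 := deg_add_card_le (G := G) (f := f) (v := w) (C := A.erase W) (Y := B) inacc_subset
      (fun z hz h => (mem_inacc.1 hz).2 (mem_of_mem_erase h))
      (fun c hc => hNM w y hwW hy hsolo c (mem_erase.1 hc).2 (by rw [hwW]; exact (mem_erase.1 hc).1))
    have h2 := hdeg w hwX
    rw [card_erase_of_mem hWA] at h1
    have : 0 < #A := card_pos.2 ⟨W, hWA⟩
    omega
  -- No vertex of a cut-off class can move to an accessible color outside `T` and `U`, since this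
  -- would give a path avoiding `U`.
  have hD : ∀ w ∈ cls X f W, #(B.filter (G.Adj w)) ≤ #T + q := by
    intro w hw
    obtain ⟨hwX, hwW⟩ := mem_cls.1 hw
    have h1 := deg_add_card_le (G := G) (f := f) (v := w) (C := A \ insert U T) (Y := B)
      inacc_subset (fun z hz h => (mem_inacc.1 hz).2 (mem_sdiff.1 h).1) (by
        intro c hc
        obtain ⟨hcA, hcT⟩ := mem_sdiff.1 hc
        rw [mem_insert, not_or] at hcT
        by_contra hcon
        push Not at hcon
        have hcr : Reach G X f t (P.erase U) c := by
          by_contra hcr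
          exact hcT.2 (mem_cutOff.2 ⟨hcT.1, hcA, hcr⟩)
        exact hWr (.cons (mem_erase.2 ⟨hWU, acc_subset hWA⟩) ⟨w, hwX, hwW, hcon⟩ hcr))
    have h2 := hdeg w hwX
    have h3 := card_sdiff_add_card_eq_card (insert_subset hU hTA)
    rw [card_insert_of_notMem hUT] at h3
    omega
  have hsum := sum_card_bipartiteAbove_eq_sum_card_bipartiteBelow (s := B)
    (t := cls X f W) (fun y z => G.Adj y z)
  -- Solo vertices count twice. Then each vertex of `B` sees weight at least 2 in class `W`: one
  -- solo neighbor or two neighbors. If `#T ≤ q`, a vertex of the class gives at most 2q in total,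
  -- hence 2sq altogether, less than 2(sq + 1).
  let wt : V → ℕ := fun w => if S w then 2 else 1
  have h1 : 2 * #B ≤ ∑ y ∈ B, ∑ z ∈ (cls X f W).filter (G.Adj y), wt z := by
    rw [mul_comm, ← smul_eq_mul]
    refine card_nsmul_le_sum _ _ _ fun y hy => ?_
    obtain ⟨z, hz, hzW, hyz⟩ := hN.exists_adj hy hWA
    by_cases hsolo : Solo G X f z y
    · calc 2 = wt z := by simp only [wt]; rw [if_pos ⟨y, hy, hsolo⟩]
        _ ≤ _ := single_le_sum (fun _ _ => Nat.zero_le _) (by simp [hz, hzW, hyz])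
    · have : ∃ z' ∈ X, f z' = f z ∧ G.Adj y z' ∧ z' ≠ z := by
        by_contra hcon
        push Not at hcon
        exact hsolo ⟨hz, hyz, hcon⟩
      obtain ⟨z', hz', hz'W, hyz', hne⟩ := this
      calc 2 ≤ #((cls X f W).filter (G.Adj y)) := by
            rw [← card_pair hne]
            refine card_le_card fun x hx => ?_
            rw [mem_insert, mem_singleton] at hx
            rcases hx with rfl | rfl
            · simp [hz', hz'W, hzW, hyz']
            · simp [hz, hzW, hyz]
        _ ≤ _ := by
            rw [card_eq_sum_ones]
            refine sum_le_sum fun x _ => ?_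
            simp only [wt]; split_ifs <;> omega
  have h2 : ∑ y ∈ B, ∑ z ∈ (cls X f W).filter (G.Adj y), wt z =
      ∑ z ∈ cls X f W, wt z * #(B.filter (G.Adj z)) := by
    simp only [sum_filter]
    rw [sum_comm]
    refine sum_congr rfl fun z _ => ?_
    rw [← sum_filter, sum_const, smul_eq_mul, mul_comm]
    congr 2
    exact filter_congr fun y _ => G.adj_comm _ _
  have h3 : ∑ z ∈ cls X f W, wt z * #(B.filter (G.Adj z)) ≤
      ∑ z ∈ cls X f W, (if S z then 2 * q else #T + q) := by
    refine sum_le_sum fun z hz => ?_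
    simp only [wt]
    split_ifs with h
    · exact Nat.mul_le_mul_left _ (hS z hz h)
    · simpa using hD z hz
  rw [sum_ite, sum_const, sum_const, smul_eq_mul, smul_eq_mul] at h3
  have h4 := card_filter_add_card_filter_not (s := cls X f W) S
  have h5 : #(cls X f W) = s := by
    have := hN.card W (acc_subset hWA)
    rw [if_neg (by rintro rfl; exact target_notMem_cutOff hN.t_mem hW),
      if_neg (by rintro rfl; exact hpp hWA)] at this
    simpa using this
  have h6 := hN.card_inacc hpp
  rw [← hB, ← hA, ← hq] at h6
  by_contra hcon
  push Not at hcon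
  have h7 : #(filter (fun x => ¬S x) (cls X f W)) * (#T + q) ≤
      #(filter (fun x => ¬S x) (cls X f W)) * (2 * q) := Nat.mul_le_mul_left _ (by omega)
  have h8 : (#(filter (fun x => S x) (cls X f W)) + #(filter (fun x => ¬S x) (cls X f W)))
      * (2 * q) = s * (2 * q) := by rw [h4, h5]
  have h9 : s * (2 * q) = 2 * (s * q) := by ring
  rw [add_mul] at h8
  omega

/-- Every vertex of inaccessible color has many solo neighbors of cut-off color. -/
lemma card_solo (hdeg : ∀ v ∈ X, #(X.filter (G.Adj v)) < #P) (U : κ) {y : V}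
    (hy : y ∈ inacc G X P f t) :
    #(cutOff G X P f t U) + 1 + #((inacc G X P f t).filter (G.Adj y)) ≤
      #(X.filter fun z => f z ∈ cutOff G X P f t U ∧ Solo G X f z y) +
        #(P \ acc G X P f t) := by
  set A := acc G X P f t with hA
  set B := inacc G X P f t with hB
  set T := cutOff G X P f t U with hT
  have hPA : #(P \ A) + #A = #P := card_sdiff_add_card_eq_card acc_subset
  have hTA : T ⊆ A := fun c hc => (mem_cutOff.1 hc).2.1
  set N := X.filter (G.Adj y) with hNdef
  set Sy := X.filter fun z => f z ∈ T ∧ Solo G X f z y with hSy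
  have h1 : #(N.filter fun z => f z ∈ A) = ∑ c ∈ A, #(N.filter fun z => f z = c) := by
    rw [card_eq_sum_card_fiberwise (f := f) (t := A) (fun z hz => mem_coe.2 (mem_filter.1 hz).2)]
    refine sum_congr rfl fun c hc => ?_
    rw [filter_filter]
    congr 1
    refine filter_congr fun z _ => ⟨fun h => h.2, fun h => ⟨h ▸ hc, h⟩⟩
  -- A cut-off color contributes either a solo neighbor or a second neighbor; any other accessible
  -- color contributes one neighbor.
  have h2 : ∑ c ∈ A, (1 + if c ∈ T then 1 else 0) ≤
      ∑ c ∈ A, (#(N.filter fun z => f z = c) + #(Sy.filter fun z => f z = c)) := by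
    refine sum_le_sum fun c hc => ?_
    obtain ⟨z, hz, hzc, hyz⟩ := hN.exists_adj hy hc
    have hzN : z ∈ N.filter fun z => f z = c := by simp [hNdef, hz, hyz, hzc]
    have hpos : 0 < #(N.filter fun z => f z = c) := card_pos.2 ⟨z, hzN⟩
    split_ifs with hcT
    · by_cases hsolo : Solo G X f z y
      · have : 0 < #(Sy.filter fun z => f z = c) :=
          card_pos.2 ⟨z, by simp [hSy, hz, hzc, hcT, hsolo]⟩
        omega
      · have : ∃ z' ∈ X, f z' = f z ∧ G.Adj y z' ∧ z' ≠ z := by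
          by_contra hcon
          push Not at hcon
          exact hsolo ⟨hz, hyz, hcon⟩
        obtain ⟨z', hz', hz'W, hyz', hne⟩ := this
        have : 1 < #(N.filter fun z => f z = c) :=
          one_lt_card.2 ⟨z', by simp [hNdef, hz', hyz', hz'W, hzc], z, hzN, hne⟩
        omega
    · omega
  rw [sum_add_distrib, sum_add_distrib, ← h1, sum_const, smul_eq_mul, mul_one, ← sum_filter,
    filter_mem_eq_inter, inter_eq_right.2 hTA, ← card_eq_sum_ones] at h2
  have h3 : ∑ c ∈ A, #(Sy.filter fun z => f z = c) ≤ #Sy := by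
    rw [card_eq_sum_card_fiberwise (s := Sy) (f := f) (t := A)
      (fun z hz => mem_coe.2 (hTA (mem_filter.1 hz).2.1))]
  have h4 := card_filter_add_card_filter_not (s := N) (fun z => f z ∈ A)
  have h5 : #(B.filter (G.Adj y)) ≤ #(N.filter fun z => f z ∉ A) := by
    refine card_le_card fun z hz => ?_
    obtain ⟨h5, h6⟩ := mem_filter.1 hz
    have h7 : f z ∉ A := (mem_inacc.1 h5).2
    simp [hNdef, inacc_subset h5, h6, h7]
  have h6 : #N < #P := hdeg y (inacc_subset hy)
  omega

/-- Two nonadjacent vertices of inaccessible color share a solo neighbor. -/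
lemma exists_common_solo (hpp : pp ∉ acc G X P f t)
    (hdeg : ∀ v ∈ X, #(X.filter (G.Adj v)) < #P) {U : κ}
    (hT : #(P \ acc G X P f t) < #(cutOff G X P f t U)) :
    ∃ z y₁ y₂, f z ∈ cutOff G X P f t U ∧ y₁ ∈ inacc G X P f t ∧ y₂ ∈ inacc G X P f t ∧
      y₁ ≠ y₂ ∧ ¬ G.Adj y₁ y₂ ∧ Solo G X f z y₁ ∧ Solo G X f z y₂ := by
  have hB := hN.card_inacc hpp
  set B := inacc G X P f t with hBdef
  set T := cutOff G X P f t U with hTdef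
  set q := #(P \ acc G X P f t) with hq
  have hTA : T ⊆ acc G X P f t := fun c hc => (mem_cutOff.1 hc).2.1
  let indep : Finset V → Prop := fun I => ∀ u ∈ I, ∀ v ∈ I, ¬ G.Adj u v
  -- A maximum independent set dominates `B`. Each of its vertices covers at most q vertices of `B`,
  -- which has sq + 1, so it has more than s vertices.
  obtain ⟨I, hI, hmax⟩ := exists_max_image (B.powerset.filter indep) Finset.card
    ⟨∅, by simp [indep]⟩
  obtain ⟨hIB, hIi⟩ := mem_filter.1 hI
  rw [mem_powerset] at hIB
  have hcover : B ⊆ I.biUnion fun y => insert y (B.filter (G.Adj y)) := by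
    intro v hv
    rw [mem_biUnion]
    by_cases hvI : v ∈ I
    · exact ⟨v, hvI, mem_insert_self _ _⟩
    by_contra hcon
    push Not at hcon
    have hno : ∀ y ∈ I, ¬ G.Adj y v := fun y hy h =>
      hcon y hy (mem_insert_of_mem (mem_filter.2 ⟨hv, h⟩))
    have := hmax (insert v I) (mem_filter.2 ⟨mem_powerset.2 (insert_subset hv hIB), by
      intro a ha b hb
      rw [mem_insert] at ha hb
      rcases ha with rfl | ha <;> rcases hb with rfl | hb
      · exact G.irrefl
      · exact fun h => hno b hb h.symm
      · exact hno a ha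
      · exact hIi a ha b hb⟩)
    rw [card_insert_of_notMem hvI] at this
    omega
  have hc1 : #B ≤ ∑ y ∈ I, (1 + #(B.filter (G.Adj y))) := by
    refine (card_le_card hcover).trans (card_biUnion_le.trans (sum_le_sum fun y _ => ?_))
    rw [add_comm]
    exact card_insert_le _ _
  have hc2 : ∑ y ∈ I, (1 + #(B.filter (G.Adj y))) ≤ #I * q := by
    rw [← smul_eq_mul]
    refine sum_le_card_nsmul _ _ _ fun y hy => ?_
    have : #(B.filter (G.Adj y)) < q := hN.deg_inacc (hIB hy) hdeg
    omega
  have hIs : s < #I := by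
    by_contra hcon
    have := Nat.mul_le_mul_right q (not_lt.1 hcon)
    omega
  let Sy : V → Finset V := fun y => X.filter fun z => f z ∈ T ∧ Solo G X f z y
  have hc3 : ∑ y ∈ I, (#T + (1 + #(B.filter (G.Adj y)))) ≤ ∑ y ∈ I, (#(Sy y) + q) := by
    refine sum_le_sum fun y hy => ?_
    have : #T + 1 + #(B.filter (G.Adj y)) ≤ #(Sy y) + q := hN.card_solo hdeg U (hIB hy)
    omega
  rw [sum_add_distrib, sum_add_distrib (f := fun y => #(Sy y)), sum_const, sum_const, smul_eq_mul,
    smul_eq_mul] at hc3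
  have hXT : #(X.filter fun z => f z ∈ T) = #T * s := by
    rw [card_eq_sum_card_fiberwise (f := f) (t := T) (fun z hz => mem_coe.2 (mem_filter.1 hz).2),
      ← smul_eq_mul, ← sum_const]
    refine sum_congr rfl fun c hc => ?_
    have h1 := hN.card c (acc_subset (hTA hc))
    rw [if_neg (by rintro rfl; exact target_notMem_cutOff hN.t_mem hc),
      if_neg (by rintro rfl; exact hpp (hTA hc))] at h1
    rw [filter_filter]
    simp only [add_zero] at h1
    rw [← h1]
    congr 1
    exact filter_congr fun z _ => ⟨fun h => h.2, fun h => ⟨h ▸ hc, h⟩⟩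
  -- By `card_solo` the sum is at least |I|(|T| - q) + |B|, hence more than s(|T| - q) + sq = s|T|.
  -- Pigeonhole now gives a vertex that is solo for two members of `I`.
  have hlt : #(X.filter fun z => f z ∈ T) < ∑ y ∈ I, #(Sy y) := by
    rw [hXT]
    obtain ⟨d, hd⟩ := Nat.exists_eq_add_of_lt hT
    have e1 : #I * #T = #I * q + #I * (d + 1) := by rw [hd]; ring
    have e2 : #T * s = s * q + s * (d + 1) := by rw [hd]; ring
    have e3 : s * (d + 1) ≤ #I * (d + 1) := Nat.mul_le_mul_right _ hIs.le
    omega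
  rw [← card_sigma] at hlt
  obtain ⟨⟨y₁, z₁⟩, h1, ⟨y₂, z₂⟩, h2, hne, heq⟩ := exists_ne_map_eq_of_card_lt_of_maps_to hlt
    (f := fun x : (_ : V) × V => x.2) (by
      intro x hx
      have := (mem_sigma.1 (mem_coe.1 hx)).2
      simp only [Sy, mem_filter] at this
      exact mem_coe.2 (mem_filter.2 ⟨this.1, this.2.1⟩))
  simp only at heq
  subst heq
  rw [mem_sigma] at h1 h2
  simp only [Sy, mem_filter] at h1 h2
  refine ⟨z₁, y₁, y₂, h1.2.2.1, hIB h1.1, hIB h2.1, ?_, hIi _ h1.1 _ h2.1, h1.2.2.2, h2.2.2.2⟩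
  rintro rfl
  exact hne rfl

end NearlyEquitable

end EquitableColoring

/-! ### Enlarging the accessible part, and the Hajnal–Szemerédi theorem -/

namespace EquitableColoring

open Finset
open scoped Classical

variable {V κ : Type*} {G : SimpleGraph V} {X : Finset V} {P : Finset κ} {s : ℕ} {f : V → κ}
  {t pp : κ}

namespace NearlyEquitable

/-- If no solo vertex of cut-off color is movable, another nearly equitable coloring has more
accessible colors. -/
lemma exists_card_acc_lt (hN : NearlyEquitable G X P s f t pp) (hpp : pp ∉ acc G X P f t)
    (hdeg : ∀ v ∈ X, #(X.filter (G.Adj v)) < #P)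
    (IH : ∀ Q ⊆ P, Q ≠ P → ∀ Y ⊆ X, #Y = s * #Q →
      (∀ v ∈ Y, #(Y.filter (G.Adj v)) < #Q) → HasEquitable G Y Q s)
    {w y₁ y₂ : V} (hW : f w ∈ acc G X P f t)
    (hterm : ∀ c ∈ acc G X P f t, c ≠ f w → Reach G X f t (P.erase (f w)) c) (hWt : f w ≠ t)
    (hy₁ : y₁ ∈ inacc G X P f t) (hy₂ : y₂ ∈ inacc G X P f t) (hne : y₁ ≠ y₂)
    (hadj : ¬ G.Adj y₁ y₂) (hs₁ : Solo G X f w y₁) (hs₂ : Solo G X f w y₂)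
    (hNM : ∀ c ∈ acc G X P f t, c ≠ f w → ∃ x ∈ X, f x = c ∧ G.Adj w x) :
    ∃ h pp', NearlyEquitable G X P s h t pp' ∧ #(acc G X P f t) < #(acc G X P h t) := by
  obtain ⟨g, hgm, hgp, hgc⟩ := hN.hasEquitable_inacc_erase hpp hdeg IH hy₁
  set A := acc G X P f t with hA
  set B := inacc G X P f t with hB
  have hAP : A ⊆ P := acc_subset
  have hPA : #(P \ A) + #A = #P := card_sdiff_add_card_eq_card hAP
  have hwX : w ∈ X := hs₁.1
  have hwB : w ∉ B := fun h => (mem_inacc.1 h).2 hW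
  have hwy₁ : w ≠ y₁ := by rintro rfl; exact hwB hy₁
  have hwy₂ : w ≠ y₂ := by rintro rfl; exact hwB hy₂
  -- `w` has a neighbor in every other accessible class, so at most q neighbors in `B`. One of them
  -- is `y₁`, so some class of `g` contains no neighbor of `w`.
  obtain ⟨b, hb, hbw⟩ : ∃ b ∈ P \ A, ∀ z ∈ B.erase y₁, g z = b → ¬ G.Adj w z := by
    by_contra hcon
    push Not at hcon
    have h1 := deg_add_card_le (G := G) (f := f) (v := w) (C := A.erase (f w)) (Y := B)
      inacc_subset (fun z hz h => (mem_inacc.1 hz).2 (mem_of_mem_erase h))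
      (fun c hc => hNM c (mem_erase.1 hc).2 (mem_erase.1 hc).1)
    rw [card_erase_of_mem hW] at h1
    have h2 := hdeg w hwX
    have h3 : #(P \ A) ≤ #((B.erase y₁).filter (G.Adj w)) := by
      refine le_trans (card_le_card fun c hc => ?_) (card_image_le (f := g))
      obtain ⟨z, hz, hzc, hwz⟩ := hcon c hc
      exact mem_image.2 ⟨z, mem_filter.2 ⟨hz, hwz⟩, hzc⟩
    have h4 : y₁ ∈ B.filter (G.Adj w) := mem_filter.2 ⟨hy₁, hs₁.2.1.symm⟩
    rw [filter_erase, card_erase_of_mem h4] at h3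
    have h5 : 0 < #(B.filter (G.Adj w)) := card_pos.2 ⟨_, h4⟩
    have h6 : 0 < #A := card_pos.2 ⟨_, hW⟩
    omega
  obtain ⟨hbP, hbA⟩ := mem_sdiff.1 hb
  -- `y₁` replaces `w` in its class and `w` goes to `b`, which becomes the oversized color; the
  -- other inaccessible vertices are recolored by `g`.
  let h : V → κ := fun v => if v = y₁ then f w else if v = w then b else if v ∈ B then g v else f v
  have hh1 : h y₁ = f w := by simp [h]
  have hhw : h w = b := by simp [h, hwy₁]
  have hh2 : ∀ v ∈ B.erase y₁, h v = g v := by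
    intro v hv
    obtain ⟨h1, h2⟩ := mem_erase.1 hv
    have h3 : v ≠ w := by rintro rfl; exact hwB h2
    simp [h, h1, h2, h3]
  have hh3 : ∀ v, v ∉ B → v ≠ w → h v = f v := by
    intro v hv hvw
    have h2 : v ≠ y₁ := by rintro rfl; exact hv hy₁
    simp [h, hv, hvw, h2]
  have hfA : ∀ v ∈ X, v ∉ B → f v ∈ A := by
    intro v hv hvB
    by_contra hcon
    exact hvB (mem_inacc.2 ⟨hv, hcon⟩)
  have hgA : ∀ v ∈ B.erase y₁, g v ∈ P ∧ g v ∉ A := fun v hv => mem_sdiff.1 (hgm v hv)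
  have split : ∀ v ∈ X, v = y₁ ∨ v = w ∨ v ∈ B.erase y₁ ∨ (v ∉ B ∧ v ≠ w) := by
    intro v hv
    by_cases h1 : v = y₁
    · exact .inl h1
    by_cases h3 : v = w
    · exact .inr (.inl h3)
    by_cases h2 : v ∈ B
    · exact .inr (.inr (.inl (mem_erase.2 ⟨h1, h2⟩)))
    · exact .inr (.inr (.inr ⟨h2, h3⟩))
  have hcolA : ∀ v ∈ X, ∀ c ∈ A, c ≠ f w → (h v = c ↔ f v = c) := by
    intro v hv c hc hcw
    rcases split v hv with rfl | rfl | h1 | ⟨h1, h2⟩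
    · rw [hh1]
      exact ⟨fun e => absurd e.symm hcw, fun e => absurd (e ▸ hc) (mem_inacc.1 hy₁).2⟩
    · rw [hhw]
      exact ⟨fun e => absurd (e ▸ hc) hbA, fun e => absurd e.symm hcw⟩
    · rw [hh2 v h1]
      exact ⟨fun e => absurd (e ▸ hc) (hgA v h1).2,
        fun e => absurd (e ▸ hc) (mem_inacc.1 (mem_erase.1 h1).2).2⟩
    · rw [hh3 v h1 h2]
  have hcolW : ∀ v ∈ X, h v = f w ↔ v = y₁ ∨ (f v = f w ∧ v ≠ w) := by
    intro v hv
    rcases split v hv with rfl | rfl | h1 | ⟨h1, h2⟩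
    · simp [hh1]
    · rw [hhw]
      exact ⟨fun e => absurd (e ▸ hW) hbA, fun e => by simp [hwy₁] at e⟩
    · rw [hh2 v h1]
      refine ⟨fun e => absurd (e ▸ hW) (hgA v h1).2, ?_⟩
      rintro (rfl | e)
      · simp at h1
      · exact absurd (e.1 ▸ hW) (mem_inacc.1 (mem_erase.1 h1).2).2
    · rw [hh3 v h1 h2]
      refine ⟨fun e => .inr ⟨e, h2⟩, ?_⟩
      rintro (rfl | e)
      · exact absurd hy₁ h1
      · exact e.1
  have hcolB : ∀ v ∈ X, ∀ c, c ∉ A → (h v = c ↔ (v ∈ B.erase y₁ ∧ g v = c) ∨ (v = w ∧ c = b)) := by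
    intro v hv c hc
    rcases split v hv with rfl | rfl | h1 | ⟨h1, h2⟩
    · rw [hh1]
      simp [hwy₁.symm]
      rintro rfl; exact hc hW
    · rw [hhw]
      have : v ∉ B.erase y₁ := fun h => hwB (mem_erase.1 h).2
      simp [this, eq_comm]
    · rw [hh2 v h1]
      have : v ≠ w := by rintro rfl; exact hwB (mem_erase.1 h1).2
      simp [this, h1]
    · rw [hh3 v h1 h2]
      have h3 : v ∉ B.erase y₁ := fun h => h1 (mem_erase.1 h).2
      simp only [h3, h2, false_and, or_self, iff_false]
      exact fun e => hc (e ▸ hfA v hv h1)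
  have hproper : ProperOn G X h := by
    intro u hu v hv huv e
    by_cases huA : h u ∈ A
    · by_cases huw : h u = f w
      · have hu' := (hcolW u hu).1 huw
        have hv' := (hcolW v hv).1 (e ▸ huw)
        rcases hu' with rfl | ⟨h1, h2⟩ <;> rcases hv' with rfl | ⟨h3, h4⟩
        · exact G.irrefl huv
        · exact h4 (hs₁.2.2 v hv h3 huv)
        · exact h2 (hs₁.2.2 u hu h1 huv.symm)
        · exact hN.proper u hu v hv huv (h1.trans h3.symm)
      · have h1 := (hcolA u hu _ huA huw).1 rfl
        have h2 := (hcolA v hv _ huA huw).1 e.symm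
        exact hN.proper u hu v hv huv (h1.trans h2.symm)
    · rcases (hcolB u hu _ huA).1 rfl with ⟨h1, h2⟩ | ⟨h1, h2⟩ <;>
        rcases (hcolB v hv _ huA).1 e.symm with ⟨h3, h4⟩ | ⟨h3, h4⟩
      · exact hgp u h1 v h3 huv (h2.trans h4.symm)
      · subst h3
        exact hbw u h1 (h2.trans h4) huv.symm
      · subst h1
        exact hbw v h3 (h4.trans h2) huv
      · subst h1; subst h3
        exact G.irrefl huv
  have hNh : NearlyEquitable G X P s h t b := by
    refine ⟨fun v hv => ?_, hproper, hN.t_mem, hbP, fun c hc => ?_⟩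
    · rcases split v hv with rfl | rfl | h1 | ⟨h1, h2⟩
      · rw [hh1]; exact hAP hW
      · rw [hhw]; exact hbP
      · rw [hh2 v h1]; exact (hgA v h1).1
      · rw [hh3 v h1 h2]; exact hAP (hfA v hv h1)
    · by_cases hcA : c ∈ A
      · have hcb : c ≠ b := by rintro rfl; exact hbA hcA
        have h1 := hN.card c hc
        have hcpp : c ≠ pp := by rintro rfl; exact hpp hcA
        rw [if_neg hcpp] at h1
        rw [if_neg hcb, ← h1]
        congr 1
        by_cases hcw : c = f w
        · subst hcw
          have : cls X h (f w) = insert y₁ ((cls X f (f w)).erase w) := by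
            ext v
            simp only [mem_cls, mem_insert, mem_erase]
            constructor
            · rintro ⟨h2, h3⟩
              rcases (hcolW v h2).1 h3 with h4 | h4
              · exact .inl h4
              · exact .inr ⟨h4.2, h2, h4.1⟩
            · rintro (rfl | h2)
              · exact ⟨inacc_subset hy₁, hh1⟩
              · exact ⟨h2.2.1, (hcolW v h2.2.1).2 (.inr ⟨h2.2.2, h2.1⟩)⟩
          have h2 : y₁ ∉ (cls X f (f w)).erase w := by
            simp only [mem_erase, mem_cls, not_and]
            intro _ _ h3
            exact (mem_inacc.1 hy₁).2 (h3 ▸ hW)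
          have h3 : w ∈ cls X f (f w) := by simp [hwX]
          rw [this, card_insert_of_notMem h2, card_erase_add_one h3]
        · congr 1
          ext v
          simp only [mem_cls]
          exact and_congr_right fun hv => hcolA v hv c hcA hcw
      · have hct : c ≠ t := by rintro rfl; exact hcA hN.t_mem_acc
        rw [if_neg hct, ← hgc c (mem_sdiff.2 ⟨hc, hcA⟩), add_zero]
        by_cases hcb : c = b
        · have : cls X h c = insert w (cls (B.erase y₁) g c) := by
            ext v
            simp only [mem_cls, mem_insert]
            constructor
            · rintro ⟨h2, h3⟩
              rcases (hcolB v h2 c hcA).1 h3 with h4 | h4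
              · exact .inr h4
              · exact .inl h4.1
            · rintro (rfl | h2)
              · exact ⟨hwX, by rw [hhw, hcb]⟩
              · have hvX : v ∈ X := inacc_subset (mem_erase.1 h2.1).2
                exact ⟨hvX, (hcolB v hvX c hcA).2 (.inl h2)⟩
          rw [this, card_insert_of_notMem, if_pos hcb]
          simp [hwB]
        · rw [if_neg hcb, add_zero]
          congr 1
          ext v
          simp only [mem_cls]
          constructor
          · rintro ⟨h2, h3⟩
            rcases (hcolB v h2 c hcA).1 h3 with h4 | h4
            · exact h4
            · exact absurd h4.2 hcb
          · rintro h2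
            have hvX : v ∈ X := inacc_subset (mem_erase.1 h2.1).2
            exact ⟨hvX, (hcolB v hvX c hcA).2 (.inl h2)⟩
  have hreach : ∀ c ∈ A, c ≠ f w → Reach G X h t P c := by
    intro c hc hcw
    have h1 : Reach G X f t (A.erase (f w)) c := by
      refine ((hterm c hc hcw).filter (erase_subset _ P)).mono fun d hd => ?_
      obtain ⟨h1, h2⟩ := mem_filter.1 hd
      exact mem_erase.2 ⟨(mem_erase.1 h1).1, mem_acc.2 h2⟩
    exact (h1.congr fun v hv d hd =>
      hcolA v hv d (mem_erase.1 hd).2 (mem_erase.1 hd).1).mono ((erase_subset _ _).trans hAP)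
  -- The vertex that witnesses the first move out of the class of `w` is not `w`, which cannot move,
  -- so the move is still there.
  have hreachW : Reach G X h t P (f w) := by
    cases mem_acc.1 hW with
    | refl _ => exact absurd rfl hWt
    | @step _ _ d hp hm hr =>
      have hdw : d ≠ f w := (mem_erase.1 hr.mem).1
      have hdA : d ∈ A := mem_acc.2 (hr.mono (erase_subset _ _))
      obtain ⟨x, hx, hxw, hxd⟩ := hm
      refine .cons hp ⟨x, hx, (hcolW x hx).2 (.inr ⟨hxw, ?_⟩), fun y hy hyd => ?_⟩ (hreach d hdA hdw)
      · rintro rfl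
        obtain ⟨z, hz, hzd, hxz⟩ := hNM d hdA hdw
        exact hxd z hz hzd hxz
      · exact hxd y hy ((hcolA y hy d hdA hdw).1 hyd)
  have hy₂B : y₂ ∈ B.erase y₁ := mem_erase.2 ⟨hne.symm, hy₂⟩
  have hy₂X : y₂ ∈ X := inacc_subset hy₂
  -- Here the accessible set grows: `w`, the only neighbor of `y₂` in its class, has left, and its
  -- replacement `y₁` is not adjacent to `y₂`.
  have hreachy : Reach G X h t P (g y₂) := by
    refine .cons (hgA y₂ hy₂B).1 ⟨y₂, hy₂X, hh2 y₂ hy₂B, fun z hz hzw => ?_⟩ hreachW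
    rcases (hcolW z hz).1 hzw with rfl | ⟨h1, h2⟩
    · exact fun h => hadj h.symm
    · exact fun h => h2 (hs₂.2.2 z hz h1 h)
  refine ⟨h, b, hNh, card_lt_card ((ssubset_iff_of_subset fun c hc => mem_acc.2 ?_).2
    ⟨g y₂, mem_acc.2 hreachy, (hgA y₂ hy₂B).2⟩)⟩
  by_cases hcw : c = f w
  · rw [hcw]; exact hreachW
  · exact hreach c hc hcw

/-- The induction is on the number of inaccessible colors: either a movable solo vertex finishes the
proof, or the exchange makes more colors accessible. -/
lemma hasEquitable (hdeg : ∀ v ∈ X, #(X.filter (G.Adj v)) < #P)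
    (IH : ∀ Q ⊆ P, Q ≠ P → ∀ Y ⊆ X, #Y = s * #Q →
      (∀ v ∈ Y, #(Y.filter (G.Adj v)) < #Q) → HasEquitable G Y Q s) (n : ℕ) :
    ∀ f pp, NearlyEquitable G X P s f t pp → #P - #(acc G X P f t) = n → HasEquitable G X P s := by
  induction n using Nat.strong_induction_on with
  | _ n ihn =>
  intro f pp hN hn
  by_cases hpp : pp ∈ acc G X P f t
  · exact hN.hasEquitable_of_reach (mem_acc.1 hpp)
  obtain ⟨U, hU, ⟨W, hW⟩, hterm⟩ := exists_terminal hN.t_mem (hN.exists_acc_ne hpp hdeg)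
  have hTA : cutOff G X P f t U ⊆ acc G X P f t := fun c hc => (mem_cutOff.1 hc).2.1
  by_cases hmove : ∃ w y c, f w ∈ cutOff G X P f t U ∧ y ∈ inacc G X P f t ∧ Solo G X f w y ∧
      c ∈ acc G X P f t ∧ c ≠ f w ∧ ∀ x ∈ X, f x = c → ¬ G.Adj w x
  · obtain ⟨w, y, c, hw, hy, hsolo, hc, hcw, hm⟩ := hmove
    exact hN.hasEquitable_of_solo_movable hpp hdeg IH (hTA hw) (hterm _ hw) hy hsolo hc hcw hm
  · push Not at hmove
    have hT := hN.card_lt_card_cutOff hpp hdeg hU hW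
      fun w y hw hy hs c hc hcw => hmove w y c (hw ▸ hW) hy hs hc hcw
    obtain ⟨z, y₁, y₂, hz, hy₁, hy₂, hne, hadj, hs₁, hs₂⟩ := hN.exists_common_solo hpp hdeg hT
    obtain ⟨h, pp', hNh, hlt⟩ := hN.exists_card_acc_lt hpp hdeg IH (hTA hz) (hterm _ hz)
      (by intro e; exact target_notMem_cutOff hN.t_mem (e ▸ hz)) hy₁ hy₂ hne hadj hs₁ hs₂
      fun c hc hcw => hmove z y₁ c hz hy₁ hs₁ hc hcw
    have : #(acc G X P h t) ≤ #P := card_le_card acc_subset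
    exact ihn _ (by omega) h pp' hNh rfl

end NearlyEquitable

lemma hasEquitable_bot [Nonempty κ] (P : Finset κ) : ∀ X : Finset V, #X = s * #P →
    HasEquitable (⊥ : SimpleGraph V) X P s := by
  induction P using Finset.induction_on with
  | empty =>
    intro X hX
    have : X = ∅ := by simpa using hX
    subst this
    exact ⟨fun _ => Classical.arbitrary κ, by simp [ProperOn]⟩
  | insert p P hp ih =>
    intro X hX
    rw [card_insert_of_notMem hp, mul_add, mul_one] at hX
    obtain ⟨Y, hYX, hY⟩ := exists_subset_card_eq (show s ≤ #X by omega)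
    obtain ⟨f, hfm, -, hfc⟩ := ih (X \ Y) (by rw [card_sdiff_of_subset hYX]; omega)
    refine ⟨fun v => if v ∈ Y then p else f v, fun v hv => ?_, fun u _ v _ h => h.elim,
      fun c hc => ?_⟩
    · beta_reduce
      split_ifs with h
      · exact mem_insert_self _ _
      · exact mem_insert_of_mem (hfm v (mem_sdiff.2 ⟨hv, h⟩))
    · by_cases hcp : c = p
      · subst hcp
        rw [← hY]
        congr 1
        ext v
        rw [mem_cls]
        constructor
        · rintro ⟨hv, h⟩
          by_contra hvY
          rw [if_neg hvY] at h
          exact hp (h ▸ hfm v (mem_sdiff.2 ⟨hv, hvY⟩))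
        · exact fun hv => ⟨hYX hv, if_pos hv⟩
      · rw [← hfc c (mem_of_mem_insert_of_ne hc hcp)]
        congr 1
        ext v
        simp only [mem_cls, mem_sdiff]
        constructor
        · rintro ⟨hv, h⟩
          by_cases hvY : v ∈ Y
          · rw [if_pos hvY] at h
            exact absurd h.symm hcp
          · rw [if_neg hvY] at h
            exact ⟨⟨hv, hvY⟩, h⟩
        · rintro ⟨⟨hv, hvY⟩, h⟩
          exact ⟨hv, by rw [if_neg hvY, h]⟩

/-- The graph of the edges of `G` inside `T`. -/
def insideGraph (G : SimpleGraph V) (T : Finset V) : SimpleGraph V where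
  Adj u v := G.Adj u v ∧ u ∈ T ∧ v ∈ T
  symm := ⟨fun _ _ h => ⟨h.1.symm, h.2.2, h.2.1⟩⟩
  loopless := ⟨fun _ h => G.irrefl h.1⟩

/-- The Hajnal–Szemerédi theorem. -/
theorem hajnal_szemeredi [Nonempty κ] (P : Finset κ) : ∀ (G : SimpleGraph V) (X : Finset V),
    #X = s * #P → (∀ v ∈ X, #(X.filter (G.Adj v)) < #P) → HasEquitable G X P s := by
  induction P using Finset.strongInduction with
  | H P IH =>
  intro G X hX hdeg
  have hdegT : ∀ T : Finset V, ∀ v ∈ X, #(X.filter ((insideGraph G T).Adj v)) < #P := fun T v hv =>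
    lt_of_le_of_lt (card_le_card (monotone_filter_right _ fun _ _ h => h.1)) (hdeg v hv)
  have key : ∀ T : Finset V, HasEquitable (insideGraph G T) X P s := by
    intro T
    induction T using Finset.induction_on with
    | empty =>
      obtain ⟨f, h1, -, h3⟩ := hasEquitable_bot P X hX
      exact ⟨f, h1, fun u _ v _ h => absurd h.2.1 (by simp), h3⟩
    | insert u T _ ih =>
      obtain ⟨f, h1, h2, h3⟩ := ih
      have hold : ∀ v ∈ X, ∀ w ∈ X, v ≠ u → w ≠ u → (insideGraph G (insert u T)).Adj v w →
          f v ≠ f w := fun v hv w hw hvu hwu h =>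
        h2 v hv w hw ⟨h.1, mem_of_mem_insert_of_ne h.2.1 hvu, mem_of_mem_insert_of_ne h.2.2 hwu⟩
      by_cases huX : u ∈ X
      -- The edges appear vertex by vertex. When those at `u` appear, `u` moves to a color free of
      -- its neighbors, leaving a gap at `f u` and a surplus at `b`.
      · obtain ⟨b, hb, hbu⟩ : ∃ b ∈ P, ∀ y ∈ X, f y = b → ¬ (insideGraph G (insert u T)).Adj u y := by
          by_contra hcon
          push Not at hcon
          have : #P ≤ #(X.filter ((insideGraph G (insert u T)).Adj u)) := by
            refine le_trans (card_le_card fun c hc => ?_) (card_image_le (f := f))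
            obtain ⟨y, hy, hyc, huy⟩ := hcon c hc
            exact mem_image.2 ⟨y, mem_filter.2 ⟨hy, huy⟩, hyc⟩
          have := hdegT (insert u T) u huX
          omega
        refine NearlyEquitable.hasEquitable (t := f u) (hdegT _) (fun Q hQ hQP Y _ hYc hYd =>
          IH Q (hQ.ssubset_of_ne hQP) _ Y hYc hYd) _ (Function.update f u b) b
          ⟨fun v hv => ?_, fun v hv w hw hvw => ?_, h1 u huX, hb, fun c hc => ?_⟩ rfl
        · by_cases hvu : v = u
          · subst hvu; simpa using hb
          · simpa [hvu] using h1 v hv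
        · by_cases hvu : v = u
          · subst hvu
            rw [Function.update_self, Function.update_of_ne hvw.ne']
            exact fun h => hbu w hw h.symm hvw
          · by_cases hwu : w = u
            · subst hwu
              rw [Function.update_self, Function.update_of_ne hvu]
              exact fun h => hbu v hv h hvw.symm
            · rw [Function.update_of_ne hvu, Function.update_of_ne hwu]
              exact hold v hv w hw hvu hwu hvw
        · rw [card_cls_update huX, h3 c hc]
      · refine ⟨f, h1, fun v hv w hw hvw => hold v hv w hw ?_ ?_ hvw, h3⟩
        · rintro rfl; exact huX hv
        · rintro rfl; exact huX hw
  obtain ⟨f, h1, h2, h3⟩ := key X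
  exact ⟨f, h1, fun u hu v hv huv => h2 u hu v hv ⟨huv, hu, hv⟩, h3⟩

/-- A version of the Hajnal–Szemerédi theorem for vertex numbers that are not divisible by the
number of colors. -/
theorem exists_coloring_card_le {P : Finset κ} (hP : P.Nonempty) (G : SimpleGraph V) (X : Finset V)
    (hX : #X ≤ s * #P) (hdeg : ∀ v ∈ X, #(X.filter (G.Adj v)) < #P) :
    ∃ f : V → κ, (∀ v ∈ X, f v ∈ P) ∧ ProperOn G X f ∧ ∀ c ∈ P, #(cls X f c) ≤ s := by
  have : Nonempty κ := ⟨hP.choose⟩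
  -- Padding by isolated vertices makes the number of vertices divisible.
  let r := s * #P - #X
  obtain ⟨f, h1, h2, h3⟩ := hajnal_szemeredi (s := s) P (G ⊕g (⊥ : SimpleGraph (Fin r)))
    (X.disjSum univ) (by rw [card_disjSum, card_univ, Fintype.card_fin]; omega) (by
      intro v hv
      rcases mem_disjSum.1 hv with ⟨a, ha, rfl⟩ | ⟨a, ha, rfl⟩
      · refine lt_of_le_of_lt ?_ (hdeg a ha)
        refine le_trans (card_le_card fun w hw => ?_)
          (card_map (Function.Embedding.inl (β := Fin r))).le
        obtain ⟨hw, haw⟩ := mem_filter.1 hw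
        rcases mem_disjSum.1 hw with ⟨b, hb, rfl⟩ | ⟨b, hb, rfl⟩
        · simp at haw
          simp [hb, haw]
        · simp at haw
      · rw [filter_false_of_mem]
        · simpa using hP
        · intro w hw
          rcases mem_disjSum.1 hw with ⟨b, hb, rfl⟩ | ⟨b, hb, rfl⟩ <;> simp)
  refine ⟨fun v => f (.inl v), fun v hv => h1 _ (inl_mem_disjSum.2 hv), fun u hu v hv huv =>
    h2 _ (inl_mem_disjSum.2 hu) _ (inl_mem_disjSum.2 hv) (by simpa using huv), fun c hc => ?_⟩
  rw [← h3 c hc, ← card_map Function.Embedding.inl]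
  refine card_le_card fun w hw => ?_
  obtain ⟨v, hv, rfl⟩ := mem_map.1 hw
  rw [mem_cls] at hv ⊢
  exact ⟨inl_mem_disjSum.2 hv.1, hv.2⟩

end EquitableColoring

/-! ### The randomized algorithm and its expected cost as a recursion -/

open scoped BigOperators

namespace OnlineRecoloring

open Finset

section Expectation

/-- Resampling one coordinate preserves the uniform law: exchanging it with an independent fresh
sample is a bijection. -/
lemma expect_pi_update {ι : Type*} [Fintype ι] [DecidableEq ι] {α : ι → Type*}
    [∀ i, Fintype (α i)] [∀ i, Nonempty (α i)] (i : ι) (F : (∀ i, α i) → ℝ) :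
    𝔼 ω, F ω = 𝔼 ω, 𝔼 x : α i, F (Function.update ω i x) := by
  have h1 : 𝔼 ω, F ω = 𝔼 p : (∀ i, α i) × α i, F p.1 := by
    rw [← univ_product_univ, expect_product]
    exact expect_congr rfl fun ω _ => (Fintype.expect_const (F ω)).symm
  have h2 : 𝔼 p : (∀ i, α i) × α i, F p.1 =
      𝔼 p : (∀ i, α i) × α i, F (Function.update p.1 i p.2) := by
    refine expect_nbij' (fun p => (Function.update p.1 i p.2, p.1 i))
      (fun p => (Function.update p.1 i p.2, p.1 i)) ?_ ?_ ?_ ?_ ?_ <;> simp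
  rw [h1, h2, ← univ_product_univ, expect_product]

/-- The supermartingale principle. As the list has no repetitions, every step uses a coordinate of
`ω` that is independent of the state reached so far. -/
lemma expect_foldl_le {ι X S : Type*} [Fintype ι] [DecidableEq ι] [Fintype X] [Nonempty X]
    (step : ι → X → S → S) (Φ : List ι → S → ℝ) (Inv : List ι → S → Prop)
    (h : ∀ i l s, Inv (i :: l) s →
      (∀ x, Inv l (step i x s)) ∧ 𝔼 x, Φ l (step i x s) ≤ Φ (i :: l) s)
    (l : List ι) : ∀ s, l.Nodup → Inv l s →
      𝔼 ω : ι → X, Φ [] (l.foldl (fun s i => step i (ω i) s) s) ≤ Φ l s := by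
  induction l with
  | nil => intro s _ _; simp
  | cons i l ih =>
    intro s hl hs
    rw [List.nodup_cons] at hl
    obtain ⟨h1, h2⟩ := h i l s hs
    rw [expect_pi_update i, expect_comm]
    refine le_trans (expect_le_expect fun x _ => ?_) h2
    refine le_trans (le_of_eq (expect_congr rfl fun ω _ => ?_)) (ih _ hl.2 (h1 x))
    simp only [List.foldl_cons, Function.update_self]
    congr 1
    refine List.foldl_ext _ _ _ fun s j hj => ?_
    rw [Function.update_of_ne]
    rintro rfl
    exact hl.1 hj

end Expectation

variable {V : Type} [Fintype V] [DecidableEq V] {k : ℕ}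

/-- A choice of an element from every nonempty set of colors. -/
abbrev Chooser (k : ℕ) := ∀ S : {S : Finset (Fin k) // S.Nonempty}, {i // i ∈ S.1}

instance (S : {S : Finset (Fin k) // S.Nonempty}) : Nonempty {i // i ∈ S.1} :=
  ⟨⟨S.2.choose, S.2.choose_spec⟩⟩

instance : Nonempty (Chooser k) := ⟨fun S => ⟨S.2.choose, S.2.choose_spec⟩⟩

/-- The chosen element of `S`, or `i` if `S` is empty. -/
def pick (ch : Chooser k) (S : Finset (Fin k)) (i : Fin k) : Fin k :=
  if h : S.Nonempty then ch ⟨S, h⟩ else i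

lemma pick_mem (ch : Chooser k) {S : Finset (Fin k)} (hS : S.Nonempty) (i : Fin k) :
    pick ch S i ∈ S := by
  rw [pick, dif_pos hS]
  exact (ch ⟨S, hS⟩).2

lemma expect_pick {S : Finset (Fin k)} (hS : S.Nonempty) (j : Fin k) (f : Fin k → ℝ) :
    𝔼 ch : Chooser k, f (pick ch S j) = 𝔼 i ∈ S, f i := by
  rw [expect_pi_update ⟨S, hS⟩]
  have h1 : ∀ (ω : Chooser k) (x : {i // i ∈ S}),
      f (pick (Function.update ω ⟨S, hS⟩ x) S j) = f x := by
    intro ω x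
    rw [pick, dif_pos hS, Function.update_self]
  simp only [h1]
  rw [Fintype.expect_const, Fintype.expect_eq_sum_div_card, expect_eq_sum_div_card,
    Finset.sum_coe_sort S f, Fintype.card_coe]

/-- The vertices that share a request of `L` with `v`. -/
def nbrs (L : List (V × V)) (v : V) : Finset V := univ.filter fun w => (v, w) ∈ L ∨ (w, v) ∈ L

/-- The colors that no neighbor of `v` has. -/
def avail (H : List (V × V)) (c : V → Fin k) (v : V) : Finset (Fin k) :=
  univ \ (nbrs H v).image c

/-- The state of the algorithm between two restarts: the coloring, the index of the last recoloring
of each vertex (`0` if there was none), the colors picked so far, and the number of requests until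
the next restart. -/
structure EpochState (V : Type) (k : ℕ) where
  c : V → Fin k
  stamp : V → ℕ
  picks : List (Fin k)
  clock : ℕ

namespace EpochState

/-- Recolor `v` with color `i`. -/
def recolorTo (v : V) (i : Fin k) (s : EpochState V k) : EpochState V k where
  c := Function.update s.c v i
  stamp := Function.update s.stamp v (s.picks.length + 1)
  picks := i :: s.picks
  clock := s.clock

/-- Recolor `v` with a chosen available color. -/
def recolor (H : List (V × V)) (v : V) (ch : Chooser k) (s : EpochState V k) : EpochState V k :=
  s.recolorTo v (pick ch (avail H s.c v) (s.c v))

/-- Recolor the vertices of a list one after the other. -/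
def recolorAll (H : List (V × V)) (vs : List V) (ch : V → Chooser k) (s : EpochState V k) :
    EpochState V k :=
  vs.foldl (fun s v => s.recolor H v (ch v)) s

/-- The vertices to recolor when `e` is requested: both ends if none was recolored before, and
otherwise the one that was recolored last. -/
def conflict (e : V × V) (s : EpochState V k) : List V :=
  if s.c e.1 ≠ s.c e.2 then []
  else if s.stamp e.1 = 0 ∧ s.stamp e.2 = 0 then [e.1, e.2]
  else if s.stamp e.2 ≤ s.stamp e.1 then [e.1] else [e.2]

end EpochState

/-- The parameters of the algorithm: a random start coloring of each epoch, with a set of vertices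
to be recolored at once, a deterministic coloring that is used when an epoch has failed, bounds on
the number of recolorings and on the number of picks of one color in an epoch, the length of an
epoch, and the length of the first epoch. -/
structure Strategy (V : Type) (k : ℕ) where
  Λ : Type
  [fintype : Fintype Λ]
  [nonempty : Nonempty Λ]
  start : List (V × V) → Λ → Option ((V → Fin k) × Finset V)
  fallback : List (V × V) → V → Fin k
  maxOps : ℕ
  maxPicks : ℕ
  window : ℕ
  horizon : ℕ

namespace Strategy

attribute [instance] Strategy.fintype Strategy.nonempty

variable (S : Strategy V k)

/-- The random seed for one request. -/
abbrev Seed := S.Λ × (V → Chooser k)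

/-- An epoch fails if there are too many recolorings. -/
def check (s : EpochState V k) : Option (EpochState V k) :=
  if s.picks.length ≤ S.maxOps ∧ ∀ i, s.picks.count i ≤ S.maxPicks then some s else none

/-- Serve a request inside an epoch. -/
def serve (H : List (V × V)) (e : V × V) (ch : V → Chooser k) (s : EpochState V k) :
    Option (EpochState V k) :=
  S.check (s.recolorAll H (s.conflict e) ch)

/-- Start a new epoch. -/
noncomputable def restart (H : List (V × V)) (x : S.Seed) : Option (EpochState V k) :=
  (S.start H x.1).bind fun p =>
    S.check (EpochState.recolorAll H p.2.toList x.2 ⟨p.1, fun _ => 0, [], S.window⟩)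

/-- Serve a new request; the state `none` means that the epoch has failed. -/
noncomputable def step (H : List (V × V)) (e : V × V) (x : S.Seed) :
    Option (EpochState V k) → Option (EpochState V k)
  | none => S.restart H x
  | some s => if s.clock = 0 then S.restart H x else S.serve H e x.2 { s with clock := s.clock - 1 }

/-- The coloring held in a state. -/
def out (H : List (V × V)) : Option (EpochState V k) → V → Fin k
  | none => S.fallback H
  | some s => s.c

/-- Serve a request, given the past requests; repeated requests are ignored. -/
noncomputable def advance (ω : V × V → S.Seed) (p : List (V × V) × Option (EpochState V k))
    (e : V × V) : List (V × V) × Option (EpochState V k) :=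
  if e ∈ p.1 then p else (e :: p.1, S.step (e :: p.1) e (ω e) p.2)

/-- The initial state. -/
def init (c₀ : V → Fin k) : Option (EpochState V k) := some ⟨c₀, fun _ => 0, [], S.horizon⟩

/-- The state after the requests of `σ`. -/
noncomputable def run (ω : V × V → S.Seed) (c₀ : V → Fin k) (σ : List (V × V)) :
    List (V × V) × Option (EpochState V k) :=
  σ.foldl (S.advance ω) ([], S.init c₀)

/-- The algorithm as a random deterministic algorithm with independent uniform seeds for all
possible requests. -/
noncomputable def algorithm : RandomizedAlgorithm V k where
  Ω := V × V → S.Seed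
  measurableSpace := ⊤
  law := (Fintype.card (V × V → S.Seed) : ℝ≥0∞)⁻¹ • @Measure.count _ ⊤
  isProbability := by
    let : MeasurableSpace (V × V → S.Seed) := ⊤
    constructor
    rw [Measure.smul_apply, Measure.count_apply MeasurableSet.univ, smul_eq_mul]
    simp only [Set.encard_univ, ENat.card_eq_coe_fintype_card, ENat.toENNReal_coe]
    exact ENNReal.inv_mul_cancel (Nat.cast_ne_zero.2 Fintype.card_ne_zero) (ENNReal.natCast_ne_top _)
  color ω c₀ σ := S.out (S.run ω c₀ σ).1 (S.run ω c₀ σ).2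
  color_nil ω c₀ := rfl
  measurable_color c₀ σ := measurable_from_top

/-- The cost of serving `σ` from a given state. -/
noncomputable def pathCost (ω : V × V → S.Seed) :
    List (V × V) → List (V × V) × Option (EpochState V k) → ℕ
  | [], _ => 0
  | e :: σ, p => hammingDist (S.out p.1 p.2) (S.out (S.advance ω p e).1 (S.advance ω p e).2) +
      pathCost ω σ (S.advance ω p e)

/-- The expected cost of serving the distinct new requests `ρ` from a given state. -/
noncomputable def futureCost (H : List (V × V)) :
    List (V × V) → Option (EpochState V k) → ℝ
  | [], _ => 0
  | e :: ρ, st => 𝔼 x : S.Seed, ((hammingDist (S.out H st) (S.out (e :: H) (S.step (e :: H) e x st))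
      : ℝ) + futureCost (e :: H) ρ (S.step (e :: H) e x st))

lemma pathCost_eq_sum (ω : V × V → S.Seed) (σ : List (V × V)) :
    ∀ p, S.pathCost ω σ p = ∑ t ∈ range σ.length,
      hammingDist (S.out ((σ.take t).foldl (S.advance ω) p).1 ((σ.take t).foldl (S.advance ω) p).2)
        (S.out ((σ.take (t + 1)).foldl (S.advance ω) p).1
          ((σ.take (t + 1)).foldl (S.advance ω) p).2) := by
  induction σ with
  | nil => intro p; rfl
  | cons e σ ih =>
    intro p
    rw [pathCost, ih, List.length_cons, sum_range_succ', add_comm]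
    rfl

/-- Repeated requests can be dropped. -/
lemma exists_nodup_pathCost (σ : List (V × V)) : ∀ H : List (V × V), ∃ ρ : List (V × V),
    ρ.Nodup ∧ (∀ e ∈ ρ, e ∈ σ ∧ e ∉ H) ∧
      ∀ ω st, S.pathCost ω σ (H, st) = S.pathCost ω ρ (H, st) := by
  induction σ with
  | nil => exact fun H => ⟨[], by simp⟩
  | cons e σ ih =>
    intro H
    by_cases he : e ∈ H
    · obtain ⟨ρ, h1, h2, h3⟩ := ih H
      refine ⟨ρ, h1, fun a ha => ⟨List.mem_cons_of_mem _ (h2 a ha).1, (h2 a ha).2⟩, fun ω st => ?_⟩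
      rw [← h3, pathCost, advance, if_pos he, hammingDist_self, zero_add]
    · obtain ⟨ρ, h1, h2, h3⟩ := ih (e :: H)
      refine ⟨e :: ρ, List.nodup_cons.2 ⟨fun h => (h2 e h).2 List.mem_cons_self, h1⟩, ?_,
        fun ω st => ?_⟩
      · intro a ha
        rcases List.mem_cons.1 ha with rfl | ha
        · exact ⟨List.mem_cons_self, he⟩
        · exact ⟨List.mem_cons_of_mem _ (h2 a ha).1,
            fun h => (h2 a ha).2 (List.mem_cons_of_mem _ h)⟩
      · rw [pathCost, pathCost, advance, if_neg he, h3]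

lemma pathCost_update (ω : V × V → S.Seed) {a : V × V} (x : S.Seed) (ρ : List (V × V)) :
    ∀ p, a ∉ ρ → S.pathCost (Function.update ω a x) ρ p = S.pathCost ω ρ p := by
  induction ρ with
  | nil => intro p _; rfl
  | cons e ρ ih =>
    intro p ha
    rw [List.mem_cons, not_or] at ha
    have : S.advance (Function.update ω a x) p e = S.advance ω p e := by
      rw [advance, advance, Function.update_of_ne (Ne.symm ha.1)]
    rw [pathCost, pathCost, this, ih _ ha.2]

/-- Seeds are indexed by requests. Since `ρ` has no repetitions, the seed of its head does not occur
in the tail and can be averaged separately. -/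
lemma expect_pathCost (ρ : List (V × V)) : ∀ H st, ρ.Nodup → (∀ e ∈ ρ, e ∉ H) →
    𝔼 ω, (S.pathCost ω ρ (H, st) : ℝ) = S.futureCost H ρ st := by
  induction ρ with
  | nil => intro H st _ _; simp [pathCost, futureCost]
  | cons e ρ ih =>
    intro H st hρ hH
    rw [List.nodup_cons] at hρ
    have heH : e ∉ H := hH e List.mem_cons_self
    rw [expect_pi_update e, expect_comm, futureCost]
    refine expect_congr rfl fun x _ => ?_
    rw [← ih (e :: H) _ hρ.2 (fun a ha h => by
      rcases List.mem_cons.1 h with rfl | h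
      · exact hρ.1 ha
      · exact hH a (List.mem_cons_of_mem _ ha) h)]
    rw [← Fintype.expect_const (ι := V × V → S.Seed)
      (hammingDist (S.out H st) (S.out (e :: H) (S.step (e :: H) e x st)) : ℝ),
      ← expect_add_distrib]
    refine expect_congr rfl fun ω _ => ?_
    rw [pathCost, advance, if_neg heH, pathCost_update _ _ _ _ _ hρ.1]
    simp

/-- The expected cost of the algorithm, computed recursively. -/
lemma expectedCost_eq (c₀ : V → Fin k) (σ : List (V × V)) : ∃ ρ : List (V × V), ρ.Nodup ∧
    (∀ e ∈ ρ, e ∈ σ) ∧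
    S.algorithm.expectedCost c₀ σ = ENNReal.ofReal (S.futureCost [] ρ (S.init c₀)) := by
  obtain ⟨ρ, h1, h2, h3⟩ := S.exists_nodup_pathCost σ []
  refine ⟨ρ, h1, fun e he => (h2 e he).1, ?_⟩
  rw [← S.expect_pathCost ρ [] _ h1 (fun e he => (h2 e he).2)]
  let : MeasurableSpace (V × V → S.Seed) := ⊤
  have : MeasurableSingletonClass (V × V → S.Seed) := ⟨fun _ => trivial⟩
  have h4 : ∀ ω, recoloringCost (S.algorithm.colorings c₀ σ ω) σ.length =
      S.pathCost ω ρ ([], S.init c₀) := fun ω =>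
    (S.pathCost_eq_sum ω σ ([], S.init c₀)).symm.trans (h3 ω _)
  have h5 : S.algorithm.expectedCost c₀ σ = ∫⁻ ω, (S.pathCost ω ρ ([], S.init c₀) : ℝ≥0∞)
      ∂((Fintype.card (V × V → S.Seed) : ℝ≥0∞)⁻¹ • @Measure.count _ ⊤) := by
    unfold RandomizedAlgorithm.expectedCost
    simp only [h4]
    rfl
  rw [h5, lintegral_smul_measure, lintegral_count, tsum_fintype, Fintype.expect_eq_sum_div_card,
    ENNReal.ofReal_div_of_pos (by exact_mod_cast Fintype.card_pos), ENNReal.ofReal_natCast,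
    ENNReal.ofReal_sum_of_nonneg (fun _ _ => Nat.cast_nonneg _), ENNReal.div_eq_inv_mul, smul_eq_mul]
  simp only [ENNReal.ofReal_natCast]

end Strategy

end OnlineRecoloring

/-! ### Feasibility -/

namespace OnlineRecoloring

open Finset

variable {V : Type} [Fintype V] [DecidableEq V] {k : ℕ}

lemma mem_nbrs {L : List (V × V)} {v w : V} : w ∈ nbrs L v ↔ (v, w) ∈ L ∨ (w, v) ∈ L := by
  simp [nbrs]

lemma nbrs_mono {L L' : List (V × V)} (h : ∀ e ∈ L, e ∈ L') (v : V) : nbrs L v ⊆ nbrs L' v :=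
  fun _ hw => mem_nbrs.2 ((mem_nbrs.1 hw).imp (h _) (h _))

lemma IsAdmissible.card_nbrs_le {ε : ℝ} {σ : List (V × V)} (h : IsAdmissible ε k σ) (v : V) :
    (#(nbrs σ v) : ℝ) ≤ (1 - ε) * k := by
  have h1 : (requestGraph σ).neighborSet v = nbrs σ v := by
    ext w
    rw [SimpleGraph.mem_neighborSet, requestGraph, SimpleGraph.fromRel_adj, mem_coe, mem_nbrs]
    refine ⟨fun h => h.2, fun hw => ⟨?_, hw⟩⟩
    rintro rfl
    rcases hw with hw | hw <;> exact h.1 _ hw rfl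
  have := h.2 v
  rwa [h1, Set.ncard_coe_finset] at this

lemma isAdmissible_of_card_nbrs_le {ε : ℝ} {σ : List (V × V)} (h1 : ∀ e ∈ σ, e.1 ≠ e.2)
    (h2 : ∀ v, (#(nbrs σ v) : ℝ) ≤ (1 - ε) * k) : IsAdmissible ε k σ := by
  refine ⟨h1, fun v => le_trans ?_ (h2 v)⟩
  rw [← Set.ncard_coe_finset]
  refine Nat.cast_le.2 (Set.ncard_le_ncard (fun w hw => ?_) (Set.toFinite _))
  rw [SimpleGraph.mem_neighborSet, requestGraph, SimpleGraph.fromRel_adj] at hw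
  exact mem_nbrs.2 hw.2

lemma IsAdmissible.mono {ε : ℝ} {σ H : List (V × V)} (h : IsAdmissible ε k σ)
    (hH : ∀ e ∈ H, e ∈ σ) : IsAdmissible ε k H :=
  isAdmissible_of_card_nbrs_le (fun e he => h.1 e (hH e he)) fun v =>
    (Nat.cast_le.2 (card_le_card (nbrs_mono hH v))).trans (h.card_nbrs_le v)

lemma mem_avail {H : List (V × V)} {c : V → Fin k} {v : V} {i : Fin k} :
    i ∈ avail H c v ↔ ∀ w ∈ nbrs H v, c w ≠ i := by
  simp [avail]

lemma card_avail_ge (H : List (V × V)) (c : V → Fin k) (v : V) :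
    k ≤ #(avail H c v) + #(nbrs H v) := by
  have h1 := card_sdiff_add_card_eq_card (subset_univ ((nbrs H v).image c))
  rw [card_univ, Fintype.card_fin] at h1
  have h2 := card_image_le (s := nbrs H v) (f := c)
  rw [avail]
  omega

lemma avail_nonempty {H : List (V × V)} {v : V} (h : #(nbrs H v) < k) (c : V → Fin k) :
    (avail H c v).Nonempty := by
  have := card_avail_ge H c v
  exact card_pos.1 (by omega)

namespace EpochState

variable {H : List (V × V)} {s : EpochState V k}

@[simp] lemma recolorAll_nil (ch : V → Chooser k) : s.recolorAll H [] ch = s := rfl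

@[simp] lemma recolorAll_cons (v : V) (vs : List V) (ch : V → Chooser k) :
    s.recolorAll H (v :: vs) ch = (s.recolor H v (ch v)).recolorAll H vs ch := rfl

lemma recolorAll_of_notMem {vs : List V} {ch : V → Chooser k} {v : V} (hv : v ∉ vs) :
    (s.recolorAll H vs ch).c v = s.c v ∧ (s.recolorAll H vs ch).stamp v = s.stamp v := by
  induction vs generalizing s with
  | nil => exact ⟨rfl, rfl⟩
  | cons w vs ih =>
    rw [List.mem_cons, not_or] at hv
    obtain ⟨h1, h2⟩ := ih (s := s.recolor H w (ch w)) hv.2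
    rw [recolorAll_cons, h1, h2]
    simp [recolor, recolorTo, hv.1]

lemma recolorAll_stamp_ne {vs : List V} {ch : V → Chooser k} {v : V}
    (hv : v ∈ vs ∨ s.stamp v ≠ 0) : (s.recolorAll H vs ch).stamp v ≠ 0 := by
  induction vs generalizing s with
  | nil => simpa using hv
  | cons w vs ih =>
    rw [recolorAll_cons]
    apply ih
    by_cases hvw : v = w
    · subst hvw
      right
      simp [recolor, recolorTo]
    · simpa [recolor, recolorTo, hvw] using hv

lemma recolorAll_clock {vs : List V} {ch : V → Chooser k} :
    (s.recolorAll H vs ch).clock = s.clock := by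
  induction vs generalizing s with
  | nil => rfl
  | cons w vs ih => rw [recolorAll_cons, ih]; rfl

lemma recolorAll_length {vs : List V} {ch : V → Chooser k} :
    (s.recolorAll H vs ch).picks.length = s.picks.length + vs.length := by
  induction vs generalizing s with
  | nil => rfl
  | cons w vs ih => rw [recolorAll_cons, ih]; simp [recolor, recolorTo]; ring

/-- Every recolored vertex has a color that was picked for it. -/
def PicksInv (s : EpochState V k) : Prop :=
  ∀ i, #(univ.filter fun v => s.stamp v ≠ 0 ∧ s.c v = i) ≤ s.picks.count i

lemma PicksInv.recolorTo (hs : s.PicksInv) (v : V) (j : Fin k) : (s.recolorTo v j).PicksInv := by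
  intro i
  have h1 : (univ.filter fun w => (s.recolorTo v j).stamp w ≠ 0 ∧ (s.recolorTo v j).c w = i) ⊆
      (univ.filter fun w => s.stamp w ≠ 0 ∧ s.c w = i) ∪ if j = i then {v} else ∅ := by
    intro w hw
    replace hw := (mem_filter.1 hw).2
    simp only [EpochState.recolorTo] at hw
    by_cases hwv : w = v
    · subst hwv
      simp only [Function.update_self] at hw
      simp [hw.2]
    · simp only [Function.update_of_ne hwv] at hw
      simp [hw]
  refine (card_le_card h1).trans ((card_union_le _ _).trans ?_)
  have h2 : (s.recolorTo v j).picks.count i = s.picks.count i + if j = i then 1 else 0 := by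
    simp [EpochState.recolorTo, List.count_cons]
  rw [h2]
  refine Nat.add_le_add (hs i) ?_
  split_ifs <;> simp

lemma PicksInv.recolorAll (hs : s.PicksInv) (vs : List V) (ch : V → Chooser k) :
    (s.recolorAll H vs ch).PicksInv := by
  induction vs generalizing s with
  | nil => exact hs
  | cons w vs ih => exact ih (hs.recolorTo _ _)

/-- When a vertex is recolored, its new color differs from all its neighbors' colors, and later
recolorings respect it; so a monochromatic edge was never touched. -/
lemma recolorAll_proper (hH : ∀ v, #(nbrs H v) < k) (hloop : ∀ e ∈ H, e.1 ≠ e.2) {vs : List V}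
    {ch : V → Chooser k} {e : V × V} (he : e ∈ H)
    (h : (s.recolorAll H vs ch).c e.1 = (s.recolorAll H vs ch).c e.2) :
    e.1 ∉ vs ∧ e.2 ∉ vs := by
  induction vs generalizing s with
  | nil => simp
  | cons w vs ih =>
    rw [recolorAll_cons] at h
    obtain ⟨h1, h2⟩ := ih h
    rw [(recolorAll_of_notMem h1).1, (recolorAll_of_notMem h2).1] at h
    have h3 := mem_avail.1 (pick_mem (ch w) (avail_nonempty (hH w) s.c) (s.c w))
    simp only [recolor, recolorTo] at h
    simp only [List.mem_cons, not_or]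
    refine ⟨⟨?_, h1⟩, ⟨?_, h2⟩⟩
    · intro h4
      have h5 : e.2 ≠ w := fun h5 => hloop e he (h4.trans h5.symm)
      rw [h4, Function.update_self, Function.update_of_ne h5] at h
      exact h3 e.2 (mem_nbrs.2 (.inl (by rw [← h4]; exact he))) h.symm
    · intro h4
      have h5 : e.1 ≠ w := fun h5 => hloop e he (h5.trans h4.symm)
      rw [h4, Function.update_self, Function.update_of_ne h5] at h
      exact h3 e.1 (mem_nbrs.2 (.inr (by rw [← h4]; exact he))) h

end EpochState

namespace Strategy

open EpochState

/-- The conditions on the parameters that make the algorithm feasible. -/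
structure Valid (S : Strategy V k) (ε : ℝ) : Prop where
  start_proper : ∀ H, IsAdmissible ε k H → ∀ ℓ c U, S.start H ℓ = some (c, U) →
    ∀ e ∈ H, e.1 ∉ U → e.2 ∉ U → c e.1 ≠ c e.2
  start_load : ∀ H, IsAdmissible ε k H → ∀ ℓ c U, S.start H ℓ = some (c, U) →
    ∀ i, (#(univ.filter fun v => v ∉ U ∧ c v = i) : ℝ) + S.maxPicks ≤
      (1 + ε) * ((Fintype.card V : ℝ) / k)
  fallback_proper : ∀ H, IsAdmissible ε k H → IsProper (S.fallback H) H
  fallback_load : ∀ H, IsAdmissible ε k H → WithinCapacity ε (S.fallback H)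
  init_load : (Fintype.card V : ℝ) / k + S.maxPicks ≤ (1 + ε) * ((Fintype.card V : ℝ) / k)

/-- The invariants of a state inside an epoch. -/
structure LiveInv (S : Strategy V k) (ε : ℝ) (H : List (V × V)) (s : EpochState V k) : Prop where
  proper : IsProper s.c H
  base : ∀ i, (#(univ.filter fun v => s.stamp v = 0 ∧ s.c v = i) : ℝ) + S.maxPicks ≤
      (1 + ε) * ((Fintype.card V : ℝ) / k)
  picksInv : s.PicksInv
  count_le : ∀ i, s.picks.count i ≤ S.maxPicks

variable {S : Strategy V k} {ε : ℝ} {H : List (V × V)}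

omit [Fintype V] [DecidableEq V] in
lemma check_eq_some {s s' : EpochState V k} (h : S.check s = some s') :
    s' = s ∧ s.picks.length ≤ S.maxOps ∧ ∀ i, s.picks.count i ≤ S.maxPicks := by
  unfold check at h
  split_ifs at h with h1
  exact ⟨(Option.some.inj h).symm, h1⟩

omit [Fintype V] [DecidableEq V] in
lemma check_eq_none {s : EpochState V k} (h : S.check s = none) :
    S.maxOps < s.picks.length ∨ ∃ i, S.maxPicks < s.picks.count i := by
  unfold check at h
  split_ifs at h with h1
  by_contra hcon
  push Not at hcon
  exact h1 hcon

-- A class consists of vertices not recolored in this epoch, covered by `base`, and recolored ones,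
-- covered by the picks of that color. The former can only shrink.
omit [DecidableEq V] in
lemma LiveInv.withinCapacity {s : EpochState V k} (h : S.LiveInv ε H s) :
    WithinCapacity ε s.c := by
  intro i
  refine le_trans ?_ (h.base i)
  have h1 := card_filter_add_card_filter_not (s := univ.filter fun v => s.c v = i)
    (fun v => s.stamp v = 0)
  simp only [filter_filter] at h1
  have h2 := (h.picksInv i).trans (h.count_le i)
  have h3 : #(univ.filter fun v => s.c v = i ∧ s.stamp v = 0) =
      #(univ.filter fun v => s.stamp v = 0 ∧ s.c v = i) := by simp only [and_comm]
  have h4 : #(univ.filter fun v => s.c v = i ∧ ¬ s.stamp v = 0) =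
      #(univ.filter fun v => s.stamp v ≠ 0 ∧ s.c v = i) := by simp only [and_comm, ne_eq]
  rw [h3, h4] at h1
  unfold load
  rw [← h1]
  push_cast
  have : (#(univ.filter fun v => s.stamp v ≠ 0 ∧ s.c v = i) : ℝ) ≤ S.maxPicks := by
    exact_mod_cast h2
  linarith

omit [Fintype V] [DecidableEq V] in
lemma conflict_nonempty {e : V × V} {s : EpochState V k} (h : s.c e.1 = s.c e.2) :
    e.1 ∈ s.conflict e ∨ e.2 ∈ s.conflict e := by
  unfold EpochState.conflict
  rw [if_neg (not_not.2 h)]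
  split_ifs <;> simp

variable (hk : ∀ v, #(nbrs H v) < k) (hloop : ∀ e ∈ H, e.1 ≠ e.2)
include hk hloop

lemma LiveInv.serve {e : V × V} {H₀ : List (V × V)} (hH : H = e :: H₀) {s s' : EpochState V k}
    (h : S.LiveInv ε H₀ s) {ch : V → Chooser k} (hs : S.serve H e ch s = some s') :
    S.LiveInv ε H s' := by
  obtain ⟨rfl, -, h2⟩ := check_eq_some hs
  refine ⟨fun a ha hbad => ?_, fun i => le_trans ?_ (h.base i), h.picksInv.recolorAll _ _, h2⟩
  · obtain ⟨h3, h4⟩ := recolorAll_proper hk hloop ha hbad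
    rw [(recolorAll_of_notMem h3).1, (recolorAll_of_notMem h4).1] at hbad
    rw [hH, List.mem_cons] at ha
    rcases ha with rfl | ha
    · rcases conflict_nonempty hbad with h5 | h5
      · exact h3 h5
      · exact h4 h5
    · exact h.proper a ha hbad
  · gcongr 1
    refine Nat.cast_le.2 (card_le_card fun v hv => ?_)
    simp only [mem_filter, mem_univ, true_and] at hv ⊢
    have h3 : ¬ (v ∈ s.conflict e ∨ s.stamp v ≠ 0) := fun h3 => recolorAll_stamp_ne h3 hv.1
    push Not at h3
    rwa [(recolorAll_of_notMem h3.1).1, (recolorAll_of_notMem h3.1).2] at hv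

lemma Valid.restart (hS : S.Valid ε) (hadm : IsAdmissible ε k H) {x : S.Seed} {s' : EpochState V k}
    (hs : S.restart H x = some s') : S.LiveInv ε H s' := by
  unfold Strategy.restart at hs
  obtain ⟨⟨c, U⟩, h1, h2⟩ := Option.bind_eq_some_iff.1 hs
  obtain ⟨rfl, -, h3⟩ := check_eq_some h2
  refine ⟨fun a ha hbad => ?_, fun i => le_trans ?_ (hS.start_load H hadm _ _ _ h1 i), ?_, h3⟩
  · obtain ⟨h3, h4⟩ := recolorAll_proper hk hloop ha hbad
    rw [(recolorAll_of_notMem h3).1, (recolorAll_of_notMem h4).1] at hbad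
    rw [mem_toList] at h3 h4
    exact hS.start_proper H hadm _ _ _ h1 a ha h3 h4 hbad
  · gcongr 1
    refine Nat.cast_le.2 (card_le_card fun v hv => ?_)
    simp only [mem_filter, mem_univ, true_and] at hv ⊢
    have h3 : v ∉ U.toList := fun h3 => recolorAll_stamp_ne (.inl h3) hv.1
    rw [(recolorAll_of_notMem h3).1] at hv
    exact ⟨fun h => h3 (mem_toList.2 h), hv.2⟩
  · exact PicksInv.recolorAll (fun i => by simp) _ _

lemma Valid.step (hS : S.Valid ε) (hadm : IsAdmissible ε k H) {e : V × V} {H₀ : List (V × V)}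
    (hH : H = e :: H₀) {st : Option (EpochState V k)} (h : ∀ s ∈ st, S.LiveInv ε H₀ s) {x : S.Seed} :
    ∀ s ∈ S.step H e x st, S.LiveInv ε H s := by
  intro s' hs'
  rw [Option.mem_def] at hs'
  cases st with
  | none => exact hS.restart hk hloop hadm hs'
  | some s =>
    simp only [Strategy.step] at hs'
    split_ifs at hs' with h1
    · exact hS.restart hk hloop hadm hs'
    · have h2 := h s rfl
      exact LiveInv.serve hk hloop hH (s := { s with clock := s.clock - 1 }) ⟨h2.proper, h2.base, h2.picksInv, h2.count_le⟩ hs'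

omit hk hloop

lemma Valid.foldl (hS : S.Valid ε) (hε : 0 < ε) (hk : 0 < k) {σ : List (V × V)}
    (hσ : IsAdmissible ε k σ) (ω : V × V → S.Seed) (τ : List (V × V)) (hτ : ∀ e ∈ τ, e ∈ σ) :
    ∀ p : List (V × V) × Option (EpochState V k), (∀ e ∈ p.1, e ∈ σ) →
      (∀ s ∈ p.2, S.LiveInv ε p.1 s) →
      (∀ e ∈ (τ.foldl (S.advance ω) p).1, e ∈ σ) ∧
      (∀ s ∈ (τ.foldl (S.advance ω) p).2, S.LiveInv ε (τ.foldl (S.advance ω) p).1 s) ∧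
      ∀ e, e ∈ τ ∨ e ∈ p.1 → e ∈ (τ.foldl (S.advance ω) p).1 := by
  induction τ with
  | nil => exact fun p h1 h2 => ⟨h1, h2, fun e he => by simpa using he⟩
  | cons a τ ih =>
    intro p h1 h2
    have ha : a ∈ σ := hτ a List.mem_cons_self
    have h3 : (∀ e ∈ (S.advance ω p a).1, e ∈ σ) ∧
        (∀ s ∈ (S.advance ω p a).2, S.LiveInv ε (S.advance ω p a).1 s) ∧
        ∀ e, e = a ∨ e ∈ p.1 → e ∈ (S.advance ω p a).1 := by
      unfold advance
      split_ifs with h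
      · refine ⟨h1, h2, ?_⟩
        rintro e (rfl | he)
        · exact h
        · exact he
      · have h4 : ∀ e ∈ a :: p.1, e ∈ σ := by
          intro e he
          rcases List.mem_cons.1 he with rfl | he
          · exact ha
          · exact h1 e he
        have hadm := hσ.mono h4
        refine ⟨h4, hS.step (fun v => ?_) hadm.1 hadm rfl h2, fun e he => List.mem_cons.2 he⟩
        have h5 := hadm.card_nbrs_le v
        have h6 : (0 : ℝ) < k := by exact_mod_cast hk
        have : (#(nbrs (a :: p.1) v) : ℝ) < k := by nlinarith
        exact_mod_cast this
    obtain ⟨h4, h5, h6⟩ := ih (fun e he => hτ e (List.mem_cons_of_mem _ he)) _ h3.1 h3.2.1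
    refine ⟨h4, h5, fun e he => h6 e ?_⟩
    rcases he with he | he
    · rcases List.mem_cons.1 he with rfl | he
      · exact .inr (h3.2.2 e (.inl rfl))
      · exact .inl he
    · exact .inr (h3.2.2 e (.inr he))

lemma Valid.liveInv_init (hS : S.Valid ε) {c₀ : V → Fin k} (hc₀ : IsBalanced c₀) :
    ∀ s ∈ S.init c₀, S.LiveInv ε [] s := by
  rintro s hs
  obtain rfl := Option.some.inj hs
  refine ⟨fun e he => absurd he (by simp), fun i => ?_, fun i => by simp, fun i => by simp⟩
  have h1 := hc₀ i
  have h2 := hS.init_load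
  unfold load at h1
  simp only [true_and]
  rwa [h1]

theorem Valid.isFeasible (hS : S.Valid ε) (hε : 0 < ε) (hk : 0 < k) : S.algorithm.IsFeasible ε := by
  intro c₀ hc₀ σ hσ ω t ht
  obtain ⟨h1, h2, h3⟩ := hS.foldl hε hk hσ ω (σ.take t) (fun e he => List.mem_of_mem_take he)
    ([], S.init c₀) (by simp) (hS.liveInv_init hc₀)
  change IsProper (S.out (S.run ω c₀ (σ.take t)).1 (S.run ω c₀ (σ.take t)).2) _ ∧
    WithinCapacity ε (S.out (S.run ω c₀ (σ.take t)).1 (S.run ω c₀ (σ.take t)).2)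
  change (∀ e ∈ (S.run ω c₀ (σ.take t)).1, e ∈ σ) at h1
  change (∀ s ∈ (S.run ω c₀ (σ.take t)).2, S.LiveInv ε (S.run ω c₀ (σ.take t)).1 s) at h2
  change (∀ e, e ∈ σ.take t ∨ e ∈ [] → e ∈ (S.run ω c₀ (σ.take t)).1) at h3
  have h4 := hσ.mono h1
  generalize S.run ω c₀ (σ.take t) = p at *
  obtain ⟨H, st⟩ := p
  cases st with
  | none => exact ⟨fun e he => hS.fallback_proper H h4 e (h3 e (.inl he)), hS.fallback_load H h4⟩
  | some s =>
    have h5 := h2 s rfl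
    exact ⟨fun e he => h5.proper e (h3 e (.inl he)), h5.withinCapacity⟩

end Strategy

end OnlineRecoloring

/-! ### Potentials for random recolorings -/

namespace OnlineRecoloring

open Finset

variable {V : Type} [Fintype V] [DecidableEq V] {k : ℕ}

lemma expect_pi_apply {ι X : Type*} [Fintype ι] [DecidableEq ι] [Fintype X] [Nonempty X] (i : ι)
    (f : X → ℝ) : 𝔼 ω : ι → X, f (ω i) = 𝔼 x, f x := by
  rw [expect_pi_update i]
  simp only [Function.update_self]
  exact Fintype.expect_const _

namespace EpochState

/-- A recolored vertex is threatened by `w` if a request of `w` will bring it in conflict with a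
vertex that was recolored earlier. -/
def Threatened (w : List (V × V)) (s : EpochState V k) (v : V) : Prop :=
  s.stamp v ≠ 0 ∧ ∃ x ∈ nbrs w v, s.c x = s.c v ∧ s.stamp x ≤ s.stamp v

open scoped Classical in
/-- The number of threatened vertices. -/
noncomputable def threat (w : List (V × V)) (s : EpochState V k) : ℕ :=
  #(univ.filter fun v => s.Threatened w v)

/-- The number of vertices of `D` that were not recolored. -/
def fresh (D : Finset V) (s : EpochState V k) : ℕ := #(D.filter fun v => s.stamp v = 0)

/-- The potential that bounds the expected number of recolorings. -/
noncomputable def opsPot (ε : ℝ) (w : List (V × V)) (s : EpochState V k) : ℝ :=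
  s.picks.length + s.threat w / ε

/-- The potential that bounds the number of picks of one color. -/
noncomputable def pickPot (p : ℝ) (i : Fin k) (s : EpochState V k) : ℝ :=
  2 ^ s.picks.count i / (1 + p) ^ s.picks.length

/-- Stamps are indices of recolorings. -/
def StampInv (s : EpochState V k) : Prop := ∀ v, s.stamp v ≤ s.picks.length

omit [Fintype V] in
lemma StampInv.recolorTo {s : EpochState V k} (hs : s.StampInv) (v : V) (i : Fin k) :
    (s.recolorTo v i).StampInv := by
  intro u
  simp only [EpochState.recolorTo, List.length_cons]
  by_cases hu : u = v
  · subst hu; simp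
  · rw [Function.update_of_ne hu]
    exact (hs u).trans (Nat.le_succ _)

lemma StampInv.recolorAll {s : EpochState V k} (hs : s.StampInv) (H : List (V × V)) (vs : List V)
    (ch : V → Chooser k) : (s.recolorAll H vs ch).StampInv := by
  induction vs generalizing s with
  | nil => exact hs
  | cons w vs ih => exact ih (hs.recolorTo _ _)

lemma threat_mono {w w' : List (V × V)} (h : ∀ e ∈ w, e ∈ w') (s : EpochState V k) :
    s.threat w ≤ s.threat w' := by
  refine card_le_card fun v hv => ?_
  simp only [mem_filter, mem_univ, true_and] at hv ⊢
  obtain ⟨h1, x, hx, h2⟩ := hv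
  exact ⟨h1, x, nbrs_mono h v hx, h2⟩

lemma opsPot_mono {ε : ℝ} (hε : 0 < ε) {w w' : List (V × V)} (h : ∀ e ∈ w, e ∈ w')
    (s : EpochState V k) : s.opsPot ε w ≤ s.opsPot ε w' := by
  unfold opsPot
  have : (s.threat w : ℝ) ≤ s.threat w' := Nat.cast_le.2 (threat_mono h s)
  gcongr

-- The recolored vertex carries the newest stamp, so it cannot be the earlier end of a threat to
-- another vertex. Only its own status may change for the worse. This is why the end recolored last
-- is the one to give way.
open scoped Classical in
lemma threat_recolorTo {s : EpochState V k} (hs : s.StampInv) {w : List (V × V)}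
    (hw : ∀ e ∈ w, e.1 ≠ e.2) (v : V) (i : Fin k) :
    (s.recolorTo v i).threat w + (if s.Threatened w v then 1 else 0) ≤
      s.threat w + if i ∈ (nbrs w v).image s.c then 1 else 0 := by
  have h1 : (univ.filter fun u => (s.recolorTo v i).Threatened w u) ⊆
      ((univ.filter fun u => s.Threatened w u).erase v) ∪
        if i ∈ (nbrs w v).image s.c then {v} else ∅ := by
    intro u hu
    obtain ⟨-, hu0, x, hx, hxc, hxs⟩ := mem_filter.1 hu
    simp only [recolorTo] at hu0 hxc hxs
    by_cases huv : u = v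
    · subst huv
      have hxu : x ≠ u := by
        rintro rfl
        rcases mem_nbrs.1 hx with h | h <;> exact hw _ h rfl
      rw [Function.update_self, Function.update_of_ne hxu] at hxc
      rw [if_pos (mem_image.2 ⟨x, hx, hxc⟩)]
      simp
    · rw [Function.update_of_ne huv] at hu0 hxs hxc
      have hxv : x ≠ v := by
        rintro rfl
        rw [Function.update_self] at hxs
        have := hs u
        omega
      rw [Function.update_of_ne hxv] at hxs hxc
      refine mem_union_left _ (mem_erase.2 ⟨huv, mem_filter.2 ⟨mem_univ _, hu0, x, hx, hxc, hxs⟩⟩)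
  have h2 : #((univ.filter fun u => s.Threatened w u).erase v) +
      (if s.Threatened w v then 1 else 0) = s.threat w := by
    split_ifs with h
    · exact card_erase_add_one (mem_filter.2 ⟨mem_univ _, h⟩)
    · rw [erase_eq_of_notMem (by simp [h])]; rfl
  have h3 := (card_le_card h1).trans (card_union_le _ _)
  have h4 : #(if i ∈ (nbrs w v).image s.c then ({v} : Finset V) else ∅) =
      if i ∈ (nbrs w v).image s.c then 1 else 0 := by split_ifs <;> simp
  rw [h4] at h3
  unfold threat at h2 ⊢
  omega

variable {ε : ℝ} {σ H w : List (V × V)}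

lemma card_avail_ge_mul (hσ : IsAdmissible ε k σ) (hH : ∀ e ∈ H, e ∈ σ) (c : V → Fin k) (v : V) :
    ε * k ≤ #(avail H c v) := by
  have h1 : (k : ℝ) ≤ #(avail H c v) + #(nbrs H v) := by exact_mod_cast card_avail_ge H c v
  have h2 := (hσ.mono hH).card_nbrs_le v
  linarith

lemma avail_nonempty_of_isAdmissible (hσ : IsAdmissible ε k σ) (hε : 0 < ε) (hk : 0 < k)
    (hH : ∀ e ∈ H, e ∈ σ) (c : V → Fin k) (v : V) : (avail H c v).Nonempty := by
  have h1 := card_avail_ge_mul hσ hH c v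
  have h2 : (0 : ℝ) < k := by exact_mod_cast hk
  have h3 : (0 : ℝ) < #(avail H c v) := lt_of_lt_of_le (by positivity) h1
  exact card_pos.1 (by exact_mod_cast h3)

/-- A random available color collides with a future neighbor with probability at most `1 - ε`. -/
lemma expect_collision_le (hσ : IsAdmissible ε k σ) (hε : 0 < ε) (hε1 : ε ≤ 1) (hk : 0 < k)
    (hH : ∀ e ∈ H, e ∈ σ) (hw : ∀ e ∈ w, e ∈ σ) (c : V → Fin k) (v : V) :
    𝔼 i ∈ avail H c v, (if i ∈ (nbrs w v).image c then (1 : ℝ) else 0) ≤ 1 - ε := by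
  have hpos : (0 : ℝ) < #(avail H c v) := by
    exact_mod_cast card_pos.2 (avail_nonempty_of_isAdmissible hσ hε hk hH c v)
  rw [expect_eq_sum_div_card, div_le_iff₀ hpos, ← sum_filter, sum_const, nsmul_eq_mul, mul_one]
  -- An available color held by a future neighbor belongs to a neighbor not yet known. With d known
  -- neighbors there are at most (1 - ε)k - d such colors among at least k - d, a fraction of at
  -- most 1 - ε.
  have h1 : #((avail H c v).filter fun i => i ∈ (nbrs w v).image c) ≤
      #(nbrs σ v \ nbrs H v) := by
    refine (card_le_card fun i hi => ?_).trans (card_image_le (f := c))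
    obtain ⟨hi, hi'⟩ := mem_filter.1 hi
    obtain ⟨x, hx, rfl⟩ := mem_image.1 hi'
    exact mem_image_of_mem _ (mem_sdiff.2 ⟨nbrs_mono hw v hx, fun h => mem_avail.1 hi x h rfl⟩)
  have h2 : (#(nbrs σ v \ nbrs H v) : ℝ) + #(nbrs H v) = #(nbrs σ v) := by
    exact_mod_cast card_sdiff_add_card_eq_card (nbrs_mono hH v)
  have h3 := hσ.card_nbrs_le v
  have h4 : (k : ℝ) ≤ #(avail H c v) + #(nbrs H v) := by exact_mod_cast card_avail_ge H c v
  have h5 : (#((avail H c v).filter fun i => i ∈ (nbrs w v).image c) : ℝ) ≤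
      #(nbrs σ v \ nbrs H v) := Nat.cast_le.2 h1
  have h6 : (0 : ℝ) ≤ #(nbrs H v) := Nat.cast_nonneg _
  nlinarith

-- A recoloring counts 1 and creates, with probability at most 1 - ε, a threat of value 1/ε, so it
-- costs at most 1 + (1 - ε)/ε = 1/ε. If `v` was threatened, the threat removed pays exactly for
-- this.
open scoped Classical in
lemma expect_opsPot_recolor (hσ : IsAdmissible ε k σ) (hε : 0 < ε) (hε1 : ε ≤ 1) (hk : 0 < k)
    (hH : ∀ e ∈ H, e ∈ σ) (hw : ∀ e ∈ w, e ∈ σ) {s : EpochState V k} (hs : s.StampInv) (v : V) :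
    𝔼 ch, (s.recolor H v ch).opsPot ε w ≤
      s.opsPot ε w + 1 / ε - (if s.Threatened w v then 1 / ε else 0) := by
  have hne := avail_nonempty_of_isAdmissible hσ hε hk hH s.c v
  have h1 : 𝔼 ch, (s.recolor H v ch).opsPot ε w =
      𝔼 i ∈ avail H s.c v, (s.recolorTo v i).opsPot ε w :=
    expect_pick hne (s.c v) fun i => (s.recolorTo v i).opsPot ε w
  rw [h1]
  have h2 : ∀ i ∈ avail H s.c v, (s.recolorTo v i).opsPot ε w ≤
      (s.opsPot ε w + 1 - (if s.Threatened w v then 1 / ε else 0)) +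
        (if i ∈ (nbrs w v).image s.c then (1 : ℝ) else 0) / ε := by
    intro i _
    have h3 := threat_recolorTo hs (fun e he => hσ.1 e (hw e he)) v i
    have h4 : ((s.recolorTo v i).threat w : ℝ) + (if s.Threatened w v then 1 else 0) ≤
        s.threat w + if i ∈ (nbrs w v).image s.c then 1 else 0 := by exact_mod_cast h3
    have h5 := div_le_div_of_nonneg_right h4 hε.le
    rw [add_div, add_div] at h5
    have h6 : (if s.Threatened w v then (1 : ℝ) else 0) / ε =
        if s.Threatened w v then 1 / ε else 0 := by split_ifs <;> simp
    rw [h6] at h5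
    have h7 : ((s.recolorTo v i).picks.length : ℝ) = s.picks.length + 1 := by
      simp [recolorTo]
    unfold opsPot
    rw [h7]
    linarith
  refine (expect_le_expect h2).trans ?_
  rw [expect_add_distrib, expect_const hne, ← expect_div]
  have h8 := div_le_div_of_nonneg_right
    (expect_collision_le hσ hε hε1 hk hH hw s.c v) hε.le
  have h9 : (1 - ε) / ε = 1 / ε - 1 := by field_simp
  rw [h9] at h8
  linarith

lemma expect_opsPot_recolorAll (hσ : IsAdmissible ε k σ) (hε : 0 < ε) (hε1 : ε ≤ 1) (hk : 0 < k)
    (hH : ∀ e ∈ H, e ∈ σ) (hw : ∀ e ∈ w, e ∈ σ) {s : EpochState V k} (hs : s.StampInv)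
    {vs : List V} (hvs : vs.Nodup) :
    𝔼 ch : V → Chooser k, (s.recolorAll H vs ch).opsPot ε w ≤ s.opsPot ε w + vs.length / ε := by
  have h := expect_foldl_le (fun v (ch : Chooser k) (s : EpochState V k) => s.recolor H v ch)
    (fun l s => s.opsPot ε w + (l.length : ℝ) / ε) (fun _ s => s.StampInv) (by
      intro v l s hs
      refine ⟨fun ch => hs.recolorTo _ _, ?_⟩
      rw [expect_add_distrib, Fintype.expect_const]
      have h1 := (expect_opsPot_recolor hσ hε hε1 hk hH hw hs v).trans
        (sub_le_self _ (by split_ifs <;> positivity))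
      rw [List.length_cons]
      push_cast
      rw [add_div]
      linarith) vs s hvs hs
  simpa [recolorAll] using h

/-- Color `i` is picked with probability at most p = 1/(εk), so the expected factor in the numerator
is at most 1 + p, the factor in the denominator. -/
lemma expect_pickPot_recolor (hσ : IsAdmissible ε k σ) (hε : 0 < ε) (hk : 0 < k)
    (hH : ∀ e ∈ H, e ∈ σ) (s : EpochState V k) (v : V) (i : Fin k) :
    𝔼 ch, (s.recolor H v ch).pickPot (1 / (ε * k)) i ≤ s.pickPot (1 / (ε * k)) i := by
  have hne := avail_nonempty_of_isAdmissible hσ hε hk hH s.c v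
  have hεk : (0 : ℝ) < ε * k := mul_pos hε (by exact_mod_cast hk)
  set p : ℝ := 1 / (ε * k) with hp
  have hp0 : 0 < p := by positivity
  have h1 : 𝔼 ch, (s.recolor H v ch).pickPot p i =
      𝔼 j ∈ avail H s.c v, (s.recolorTo v j).pickPot p i :=
    expect_pick hne (s.c v) fun j => (s.recolorTo v j).pickPot p i
  have h2 : ∀ j, (s.recolorTo v j).pickPot p i =
      (1 + if i = j then 1 else 0) * (s.pickPot p i / (1 + p)) := by
    intro j
    unfold pickPot
    simp only [recolorTo, List.length_cons, List.count_cons, pow_succ]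
    by_cases h : i = j
    · subst h; simp [pow_succ]; field_simp; norm_num
    · simp [h, Ne.symm h]; field_simp
  rw [h1, expect_congr rfl fun j _ => h2 j, ← expect_mul, expect_add_distrib, expect_const hne]
  have h3 : 𝔼 j ∈ avail H s.c v, (if i = j then (1 : ℝ) else 0) ≤ p := by
    have hpos : (0 : ℝ) < #(avail H s.c v) := by exact_mod_cast card_pos.2 hne
    rw [expect_eq_sum_div_card, hp]
    refine div_le_div₀ zero_le_one ?_ hεk (card_avail_ge_mul hσ hH s.c v)
    rw [sum_ite_eq]
    split_ifs <;> simp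
  have h4 : 0 ≤ s.pickPot p i / (1 + p) := by unfold pickPot; positivity
  calc (1 + 𝔼 j ∈ avail H s.c v, (if i = j then (1 : ℝ) else 0)) * (s.pickPot p i / (1 + p))
      ≤ (1 + p) * (s.pickPot p i / (1 + p)) := by gcongr
    _ = s.pickPot p i := by field_simp

lemma expect_pickPot_recolorAll (hσ : IsAdmissible ε k σ) (hε : 0 < ε) (hk : 0 < k)
    (hH : ∀ e ∈ H, e ∈ σ) (s : EpochState V k) {vs : List V} (hvs : vs.Nodup) (i : Fin k) :
    𝔼 ch : V → Chooser k, (s.recolorAll H vs ch).pickPot (1 / (ε * k)) i ≤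
      s.pickPot (1 / (ε * k)) i :=
  expect_foldl_le (fun v (ch : Chooser k) (s : EpochState V k) => s.recolor H v ch)
    (fun _ s => s.pickPot (1 / (ε * k)) i) (fun _ _ => True)
    (fun v _ s _ => ⟨fun _ => trivial, expect_pickPot_recolor hσ hε hk hH s v i⟩) vs s hvs trivial

/-- The set `D` meets every future request that is a conflict between vertices that were not
recolored. -/
def Cover (D : Finset V) (w : List (V × V)) (s : EpochState V k) : Prop :=
  ∀ e ∈ w, s.stamp e.1 = 0 → s.stamp e.2 = 0 → s.c e.1 = s.c e.2 → e.1 ∈ D ∨ e.2 ∈ D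

lemma Cover.recolorAll {D : Finset V} {s : EpochState V k} (h : s.Cover D w) (vs : List V)
    (ch : V → Chooser k) : (s.recolorAll H vs ch).Cover D w := by
  intro e he h1 h2 h3
  have key : ∀ v, (s.recolorAll H vs ch).stamp v = 0 → v ∉ vs := fun v hv hvs =>
    recolorAll_stamp_ne (.inl hvs) hv
  obtain ⟨h4, h5⟩ := recolorAll_of_notMem (H := H) (s := s) (ch := ch) (key _ h1)
  obtain ⟨h6, h7⟩ := recolorAll_of_notMem (H := H) (s := s) (ch := ch) (key _ h2)
  rw [h4, h6] at h3
  exact h e he (h5 ▸ h1) (h7 ▸ h2) h3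

lemma fresh_recolorAll_le (D : Finset V) (s : EpochState V k) (vs : List V) (ch : V → Chooser k) :
    (s.recolorAll H vs ch).fresh D ≤ s.fresh D := by
  refine card_le_card fun v hv => ?_
  obtain ⟨h1, h2⟩ := mem_filter.1 hv
  refine mem_filter.2 ⟨h1, ?_⟩
  by_contra h3
  exact recolorAll_stamp_ne (.inr h3) h2

lemma fresh_recolorAll_lt {D : Finset V} {s : EpochState V k} {vs : List V} {ch : V → Chooser k}
    {v : V} (hv : v ∈ vs) (hvD : v ∈ D) (hs : s.stamp v = 0) :
    (s.recolorAll H vs ch).fresh D < s.fresh D := by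
  refine card_lt_card ((ssubset_iff_of_subset fun u hu => ?_).2
    ⟨v, mem_filter.2 ⟨hvD, hs⟩, fun h => recolorAll_stamp_ne (.inl hv) (mem_filter.1 h).2⟩)
  obtain ⟨h1, h2⟩ := mem_filter.1 hu
  refine mem_filter.2 ⟨h1, ?_⟩
  by_contra h3
  exact recolorAll_stamp_ne (.inr h3) h2

/-- The potential that bounds the expected number of recolorings, including future first
recolorings. -/
noncomputable def costPot (ε : ℝ) (D : Finset V) (w : List (V × V)) (s : EpochState V k) : ℝ :=
  s.opsPot ε w + 2 / ε * s.fresh D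

omit [Fintype V] [DecidableEq V] in
lemma conflict_nodup {e : V × V} (he : e.1 ≠ e.2) (s : EpochState V k) : (s.conflict e).Nodup := by
  unfold conflict
  split_ifs <;> simp [he]

omit [Fintype V] [DecidableEq V] in
lemma conflict_length_le (e : V × V) (s : EpochState V k) : (s.conflict e).length ≤ 2 := by
  unfold conflict
  split_ifs <;> simp

/-- If neither end was recolored, the two recolorings cost 2/ε, paid by a vertex of `D` that ceases
to be fresh. Otherwise the recolored end was threatened by this very request, and its threat pays.
-/
lemma expect_costPot_conflict (hσ : IsAdmissible ε k σ) (hε : 0 < ε) (hε1 : ε ≤ 1) (hk : 0 < k)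
    (hH : ∀ e ∈ H, e ∈ σ) {e : V × V} (hw : ∀ a ∈ e :: w, a ∈ σ) {s : EpochState V k}
    (hs : s.StampInv) {D : Finset V} (hD : s.Cover D (e :: w)) :
    𝔼 ch : V → Chooser k, (s.recolorAll H (s.conflict e) ch).costPot ε D w ≤
      s.costPot ε D (e :: w) := by
  have hw' : ∀ a ∈ w, a ∈ σ := fun a ha => hw a (List.mem_cons_of_mem _ ha)
  have hloop : e.1 ≠ e.2 := hσ.1 e (hw e List.mem_cons_self)
  have hmono : s.opsPot ε w ≤ s.opsPot ε (e :: w) :=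
    opsPot_mono hε (fun a ha => List.mem_cons_of_mem _ ha) s
  unfold costPot
  have single : ∀ u, s.Threatened (e :: w) u → s.conflict e = [u] →
      𝔼 ch : V → Chooser k, ((s.recolorAll H (s.conflict e) ch).opsPot ε w +
        2 / ε * (s.recolorAll H (s.conflict e) ch).fresh D) ≤
      s.opsPot ε (e :: w) + 2 / ε * s.fresh D := by
    intro u hu hc
    rw [hc]
    have h1 := expect_opsPot_recolor hσ hε hε1 hk hH hw hs u
    rw [if_pos hu] at h1
    calc 𝔼 ch : V → Chooser k, ((s.recolorAll H [u] ch).opsPot ε w +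
          2 / ε * (s.recolorAll H [u] ch).fresh D)
        ≤ 𝔼 ch : V → Chooser k, ((s.recolor H u (ch u)).opsPot ε (e :: w) + 2 / ε * s.fresh D) := by
          refine expect_le_expect fun ch _ => add_le_add ?_ ?_
          · exact opsPot_mono hε (fun a ha => List.mem_cons_of_mem _ ha) _
          · have : ((s.recolorAll H [u] ch).fresh D : ℝ) ≤ s.fresh D :=
              Nat.cast_le.2 (fresh_recolorAll_le D s [u] ch)
            gcongr
      _ ≤ _ := by
          rw [expect_add_distrib, Fintype.expect_const,
            expect_pi_apply u fun ch => (s.recolor H u ch).opsPot ε (e :: w)]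
          linarith
  by_cases h1 : s.c e.1 = s.c e.2
  · by_cases h2 : s.stamp e.1 = 0 ∧ s.stamp e.2 = 0
    · have hc : s.conflict e = [e.1, e.2] := by simp [conflict, h1, h2]
      rw [hc]
      have h3 : ∀ ch, (((s.recolorAll H [e.1, e.2] ch).fresh D : ℕ) : ℝ) + 1 ≤ s.fresh D := by
        intro ch
        have : (s.recolorAll H [e.1, e.2] ch).fresh D < s.fresh D := by
          rcases hD e List.mem_cons_self h2.1 h2.2 h1 with h | h
          · exact fresh_recolorAll_lt (by simp) h h2.1
          · exact fresh_recolorAll_lt (by simp) h h2.2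
        exact_mod_cast this
      calc 𝔼 ch : V → Chooser k, ((s.recolorAll H [e.1, e.2] ch).opsPot ε w +
            2 / ε * (s.recolorAll H [e.1, e.2] ch).fresh D)
          ≤ 𝔼 ch : V → Chooser k, ((s.recolorAll H [e.1, e.2] ch).opsPot ε w +
            2 / ε * (s.fresh D - 1)) := by
            refine expect_le_expect fun ch _ => ?_
            have := h3 ch
            have h4 : ((s.recolorAll H [e.1, e.2] ch).fresh D : ℝ) ≤ s.fresh D - 1 := by linarith
            gcongr
        _ ≤ _ := by
            rw [expect_add_distrib, Fintype.expect_const]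
            have h4 := expect_opsPot_recolorAll hσ hε hε1 hk hH hw' hs (vs := [e.1, e.2])
              (by simp [hloop])
            have h6 : (([e.1, e.2] : List V).length : ℝ) = 2 := by simp
            rw [h6] at h4
            have h5 : 2 / ε * ((s.fresh D : ℝ) - 1) = 2 / ε * s.fresh D - 2 / ε := by ring
            rw [h5]
            linarith
    · by_cases h3 : s.stamp e.2 ≤ s.stamp e.1
      · refine single e.1 ⟨fun h => h2 ⟨h, ?_⟩, e.2, mem_nbrs.2 (.inl List.mem_cons_self), h1.symm, h3⟩
          (by simp only [conflict, h1]; simp only [h2, h3]; simp)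
        omega
      · refine single e.2 ⟨by omega, e.1, mem_nbrs.2 (.inr List.mem_cons_self), h1, by omega⟩
          (by simp only [conflict, h1]; simp only [h2, h3]; simp)
  · have hc : s.conflict e = [] := by simp [conflict, h1]
    rw [hc]
    simp only [recolorAll_nil]
    rw [Fintype.expect_const]
    linarith

end EpochState

end OnlineRecoloring

/-! ### The failure probability of an epoch -/

namespace OnlineRecoloring

open Finset

variable {V : Type} [Fintype V] [DecidableEq V] {k : ℕ}

lemma expect_snd {α β : Type*} [Fintype α] [Fintype β] [Nonempty α] (f : β → ℝ) :
    𝔼 x : α × β, f x.2 = 𝔼 y, f y := by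
  rw [← univ_product_univ, expect_product]
  exact Fintype.expect_const (ι := α) (𝔼 y, f y)

lemma EpochState.hammingDist_recolorAll_le (H : List (V × V)) (vs : List V) (ch : V → Chooser k)
    (s : EpochState V k) : hammingDist s.c (s.recolorAll H vs ch).c ≤ vs.length := by
  refine le_trans (card_le_card (t := vs.toFinset) fun v hv => ?_) vs.toFinset_card_le
  rw [List.mem_toFinset]
  by_contra hcon
  exact (mem_filter.1 hv).2 (recolorAll_of_notMem hcon).1.symm

namespace Strategy

open EpochState

variable (S : Strategy V k)

/-- The potential that bounds the probability that an epoch fails. -/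
noncomputable def deathPot (ε : ℝ) (D : Finset V) (w : List (V × V)) (s : EpochState V k) : ℝ :=
  s.costPot ε D w / (S.maxOps + 1) +
    (1 + 1 / (ε * k)) ^ (S.maxOps + 2) / 2 ^ (S.maxPicks + 1) * ∑ i, s.pickPot (1 / (ε * k)) i

/-- The probability that an epoch fails while the requests `w` are served. -/
noncomputable def failProb (H : List (V × V)) : List (V × V) → Option (EpochState V k) → ℝ
  | _, none => 1
  | [], some _ => 0
  | e :: w, some s => 𝔼 ch : V → Chooser k,
      failProb (e :: H) w (S.serve (e :: H) e ch { s with clock := s.clock - 1 })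

/-- The invariants used for the potentials. -/
structure EpochInv (D : Finset V) (w : List (V × V)) (s : EpochState V k) : Prop where
  stamp : s.StampInv
  cover : s.Cover D w
  length_le : s.picks.length ≤ S.maxOps

variable {S} {ε : ℝ} {σ H w : List (V × V)} {D : Finset V}

lemma failProb_none (H w : List (V × V)) : S.failProb H w none = 1 := by cases w <;> rfl

lemma failProb_nonneg (w : List (V × V)) : ∀ H st, 0 ≤ S.failProb H w st := by
  induction w with
  | nil =>
    rintro H (_ | s)
    · simp [failProb]
    · simp [failProb]
  | cons e w ih =>
    rintro H (_ | s)
    · simp [failProb]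
    · exact expect_nonneg fun ch _ => ih _ _

lemma costPot_nonneg (hε : 0 < ε) (s : EpochState V k) : 0 ≤ s.costPot ε D w := by
  unfold costPot opsPot
  positivity

omit [Fintype V] [DecidableEq V] in
lemma pickPot_nonneg (hε : 0 < ε) (s : EpochState V k) (i : Fin k) :
    0 ≤ s.pickPot (1 / (ε * k)) i := by
  unfold pickPot
  positivity

lemma deathPot_nonneg (hε : 0 < ε) (s : EpochState V k) : 0 ≤ S.deathPot ε D w s := by
  unfold deathPot
  have h1 := costPot_nonneg (D := D) (w := w) hε s
  have h2 := sum_nonneg fun i (_ : i ∈ (univ : Finset (Fin k))) => pickPot_nonneg hε s i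
  positivity

/-- Markov's inequality in potential form: too many recolorings make the first summand at least 1,
too many picks of one color the second. The slack 2 in the length is there because a conflict
recolors up to two vertices before the check. -/
lemma one_le_deathPot (hε : 0 < ε) {s : EpochState V k} (hs : S.check s = none)
    (hlen : s.picks.length ≤ S.maxOps + 2) : 1 ≤ S.deathPot ε D w s := by
  have h1 := costPot_nonneg (D := D) (w := w) hε s
  have h2 := sum_nonneg fun i (_ : i ∈ (univ : Finset (Fin k))) => pickPot_nonneg hε s i
  unfold deathPot
  rcases check_eq_none hs with h | ⟨i, hi⟩
  · have h3 : (S.maxOps : ℝ) + 1 ≤ s.costPot ε D w := by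
      have h4 : (S.maxOps : ℝ) + 1 ≤ s.picks.length := by exact_mod_cast h
      unfold costPot opsPot
      have : (0 : ℝ) ≤ s.threat w / ε := by positivity
      have : (0 : ℝ) ≤ 2 / ε * s.fresh D := by positivity
      linarith
    have h4 : 1 ≤ s.costPot ε D w / (S.maxOps + 1) := by
      rw [le_div_iff₀ (by positivity)]
      linarith
    have h5 : 0 ≤ (1 + 1 / (ε * k)) ^ (S.maxOps + 2) / 2 ^ (S.maxPicks + 1) *
        ∑ i, s.pickPot (1 / (ε * k)) i := by positivity
    linarith
  · have h3 : 0 ≤ s.costPot ε D w / (S.maxOps + 1) := by positivity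
    have hp : (1 : ℝ) ≤ 1 + 1 / (ε * k) := by
      have : 0 ≤ 1 / (ε * k) := by positivity
      linarith
    set a : ℝ := 1 + 1 / (ε * k) with ha
    have h4 : 1 ≤ a ^ (S.maxOps + 2) / 2 ^ (S.maxPicks + 1) * s.pickPot (1 / (ε * k)) i := by
      unfold pickPot
      rw [← ha, div_mul_div_comm, le_div_iff₀ (by positivity), one_mul, mul_comm]
      have h5 : (2 : ℝ) ^ (S.maxPicks + 1) ≤ 2 ^ s.picks.count i :=
        pow_le_pow_right₀ one_le_two hi
      have h6 : a ^ s.picks.length ≤ a ^ (S.maxOps + 2) := pow_le_pow_right₀ hp hlen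
      calc a ^ s.picks.length * 2 ^ (S.maxPicks + 1)
          ≤ a ^ (S.maxOps + 2) * 2 ^ s.picks.count i := by gcongr
        _ = _ := by ring
    have h5 : s.pickPot (1 / (ε * k)) i ≤ ∑ i, s.pickPot (1 / (ε * k)) i :=
      single_le_sum (fun j _ => pickPot_nonneg hε s j) (mem_univ i)
    have h6 : a ^ (S.maxOps + 2) / 2 ^ (S.maxPicks + 1) * s.pickPot (1 / (ε * k)) i ≤
        a ^ (S.maxOps + 2) / 2 ^ (S.maxPicks + 1) * ∑ i, s.pickPot (1 / (ε * k)) i := by gcongr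
    linarith

lemma EpochInv.serve {e : V × V} {s s' : EpochState V k} (h : S.EpochInv D (e :: w) s)
    {ch : V → Chooser k} (hs : S.serve H e ch s = some s') : S.EpochInv D w s' := by
  obtain ⟨rfl, h1, -⟩ := check_eq_some hs
  refine ⟨h.stamp.recolorAll _ _ _, Cover.recolorAll (fun a ha => ?_) _ _, h1⟩
  exact h.cover a (List.mem_cons_of_mem _ ha)

lemma serve_length_le {e : V × V} {s : EpochState V k} (h : s.picks.length ≤ S.maxOps)
    (H : List (V × V)) (ch : V → Chooser k) :
    (s.recolorAll H (s.conflict e) ch).picks.length ≤ S.maxOps + 2 := by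
  rw [recolorAll_length]
  have := conflict_length_le e s
  omega

section

variable (hσ : IsAdmissible ε k σ) (hε : 0 < ε) (hε1 : ε ≤ 1) (hk : 0 < k)
include hσ hε hε1 hk

lemma expect_deathPot_conflict (hH : ∀ e ∈ H, e ∈ σ) {e : V × V} (hw : ∀ a ∈ e :: w, a ∈ σ)
    {s : EpochState V k} (h : S.EpochInv D (e :: w) s) :
    𝔼 ch : V → Chooser k, S.deathPot ε D w (s.recolorAll H (s.conflict e) ch) ≤
      S.deathPot ε D (e :: w) s := by
  unfold deathPot
  rw [expect_add_distrib, ← expect_div, ← mul_expect, expect_sum_comm]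
  have h1 := expect_costPot_conflict hσ hε hε1 hk hH hw h.stamp h.cover
  have h2 := fun i => expect_pickPot_recolorAll hσ hε hk hH s
    (conflict_nodup (hσ.1 e (hw e List.mem_cons_self)) s) i
  gcongr with i _
  exact h2 i

lemma failProb_le_deathPot (w : List (V × V)) : ∀ (H : List (V × V)) (s : EpochState V k),
    (∀ e ∈ H, e ∈ σ) → (∀ e ∈ w, e ∈ σ) → S.EpochInv D w s →
      S.failProb H w (some s) ≤ S.deathPot ε D w s := by
  induction w with
  | nil => exact fun H s _ _ _ => deathPot_nonneg hε s
  | cons e w ih =>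
    intro H s hH hw hs
    have hH' : ∀ a ∈ e :: H, a ∈ σ := by
      intro a ha
      rcases List.mem_cons.1 ha with rfl | ha
      · exact hw _ List.mem_cons_self
      · exact hH a ha
    have hs' : S.EpochInv D (e :: w) { s with clock := s.clock - 1 } := ⟨hs.1, hs.2, hs.3⟩
    change _ ≤ S.deathPot ε D (e :: w) { s with clock := s.clock - 1 }
    refine le_trans (expect_le_expect fun ch _ => ?_)
      (expect_deathPot_conflict hσ hε hε1 hk hH' hw hs')
    cases hs1 : S.serve (e :: H) e ch { s with clock := s.clock - 1 } with
    | none =>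
      exact (failProb_none _ _).le.trans (one_le_deathPot hε hs1 (serve_length_le hs'.length_le _ _))
    | some s' =>
      have h1 := ih (e :: H) s' hH' (fun a ha => hw a (List.mem_cons_of_mem _ ha)) (hs'.serve hs1)
      obtain ⟨rfl, -⟩ := check_eq_some hs1
      exact h1

/-- The conflicts of a start coloring with the requests of `w`. -/
def conflicts (w : List (V × V)) (c : V → Fin k) (U : Finset V) : Finset (V × V) :=
  w.toFinset.filter fun e => e.1 ∉ U ∧ e.2 ∉ U ∧ c e.1 = c e.2

/-- The bound on the failure probability of an epoch with a given start coloring, apart from the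
picks of a single color. -/
noncomputable def startPot (M : ℕ) (ε : ℝ) (w : List (V × V)) :
    Option ((V → Fin k) × Finset V) → ℝ
  | none => 1
  | some p => ((#p.2 : ℝ) / ε + 2 / ε * #(conflicts w p.1 p.2)) / (M + 1)

lemma expect_failProb_restart (hH : ∀ e ∈ H, e ∈ σ) (hw : ∀ e ∈ w, e ∈ σ)
    (hU : ∀ ℓ c U, S.start H ℓ = some (c, U) → #U ≤ S.maxOps) :
    𝔼 x : S.Seed, S.failProb H w (S.restart H x) ≤
      𝔼 ℓ : S.Λ, startPot S.maxOps ε w (S.start H ℓ) +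
        (1 + 1 / (ε * k)) ^ (S.maxOps + 2) / 2 ^ (S.maxPicks + 1) * k := by
  have h0 : 0 ≤ (1 + 1 / (ε * k)) ^ (S.maxOps + 2) / 2 ^ (S.maxPicks + 1) * k := by positivity
  rw [← univ_product_univ, expect_product, ← Fintype.expect_const (ι := S.Λ)
    ((1 + 1 / (ε * k)) ^ (S.maxOps + 2) / 2 ^ (S.maxPicks + 1) * (k : ℝ)), ← expect_add_distrib]
  refine expect_le_expect fun ℓ _ => ?_
  cases hℓ : S.start H ℓ with
  | none =>
    have h1 : ∀ ch, S.restart H (ℓ, ch) = none := by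
      intro ch
      unfold Strategy.restart
      simp only [hℓ]
      rfl
    simp only [h1, failProb_none, startPot]
    rw [Fintype.expect_const]
    linarith
  | some p =>
    obtain ⟨c, U⟩ := p
    set s₀ : EpochState V k := ⟨c, fun _ => 0, [], S.window⟩ with hs₀
    have h1 : ∀ ch, S.restart H (ℓ, ch) = S.check (s₀.recolorAll H U.toList ch) := by
      intro ch
      unfold Strategy.restart
      simp only [hℓ]
      rfl
    -- One end of each future conflict of the start coloring suffices as a cover. Recoloring `U` at
    -- once costs `#U / ε` in expectation, and each pick potential starts at 1, which gives the
    -- summand with factor `k`.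
    set D : Finset V := (conflicts w c U).image Prod.fst with hD
    have hst : s₀.StampInv := fun v => Nat.zero_le _
    have h2 : ∀ ch, S.failProb H w (S.restart H (ℓ, ch)) ≤
        S.deathPot ε D w (s₀.recolorAll H U.toList ch) := by
      intro ch
      rw [h1]
      cases hc : S.check (s₀.recolorAll H U.toList ch) with
      | none =>
        rw [failProb_none]
        refine one_le_deathPot hε hc ?_
        rw [recolorAll_length, length_toList]
        have := hU ℓ c U hℓ
        simp only [hs₀, List.length_nil]
        omega
      | some s' =>
        obtain ⟨rfl, h3, -⟩ := check_eq_some hc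
        refine failProb_le_deathPot hσ hε hε1 hk w H _ hH hw ⟨hst.recolorAll _ _ _, ?_, h3⟩
        intro e he h4 h5 h6
        have h7 : e.1 ∉ U.toList := fun h => recolorAll_stamp_ne (.inl h) h4
        have h8 : e.2 ∉ U.toList := fun h => recolorAll_stamp_ne (.inl h) h5
        rw [(recolorAll_of_notMem h7).1, (recolorAll_of_notMem h8).1] at h6
        rw [mem_toList] at h7 h8
        left
        exact mem_image_of_mem _ (mem_filter.2 ⟨List.mem_toFinset.2 he, h7, h8, h6⟩)
    refine (expect_le_expect fun ch _ => h2 ch).trans ?_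
    unfold deathPot costPot
    rw [expect_add_distrib, ← expect_div, ← mul_expect, expect_sum_comm]
    have h3 : 𝔼 ch : V → Chooser k, ((s₀.recolorAll H U.toList ch).opsPot ε w +
        2 / ε * (s₀.recolorAll H U.toList ch).fresh D) ≤
        (#U : ℝ) / ε + 2 / ε * #(conflicts w c U) := by
      rw [expect_add_distrib]
      have h4 := expect_opsPot_recolorAll hσ hε hε1 hk hH hw hst U.nodup_toList
      have h5 : s₀.opsPot ε w = 0 := by
        unfold opsPot threat Threatened
        simp [hs₀]
      rw [h5, zero_add, length_toList] at h4
      refine add_le_add h4 (expect_le univ_nonempty fun ch _ => ?_)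
      have h6 : ((s₀.recolorAll H U.toList ch).fresh D : ℝ) ≤ #(conflicts w c U) :=
        Nat.cast_le.2 ((card_filter_le _ _).trans card_image_le)
      gcongr
    have h4 : ∑ i, 𝔼 ch : V → Chooser k,
        (s₀.recolorAll H U.toList ch).pickPot (1 / (ε * k)) i ≤ k := by
      calc _ ≤ ∑ i : Fin k, (1 : ℝ) := sum_le_sum fun i _ =>
            (expect_pickPot_recolorAll hσ hε hk hH s₀ U.nodup_toList i).trans
              (by simp [pickPot, hs₀])
        _ = k := by simp
    simp only [startPot]
    gcongr

end

end Strategy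

end OnlineRecoloring

/-! ### The total cost over all epochs -/

namespace OnlineRecoloring

open Finset

variable {V : Type} [Fintype V] [DecidableEq V] {k : ℕ}

namespace Strategy

open EpochState

variable {S : Strategy V k} {ε : ℝ} {σ H w : List (V × V)} {D : Finset V}

lemma restart_clock {x : S.Seed} {s : EpochState V k} (h : S.restart H x = some s) :
    s.clock = S.window ∧ s.picks.length ≤ S.maxOps := by
  unfold Strategy.restart at h
  obtain ⟨⟨c, U⟩, -, h2⟩ := Option.bind_eq_some_iff.1 h
  obtain ⟨rfl, h3, -⟩ := check_eq_some h2
  exact ⟨recolorAll_clock, h3⟩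

/-- An upper bound for the future cost after the first epoch. -/
noncomputable def restartBound (S : Strategy V k) (H ρ : List (V × V)) :
    Option (EpochState V k) → ℝ
  | none => 6 * (Fintype.card V : ℝ) * (ρ.length / S.window + 1)
  | some s => (2 * (Fintype.card V : ℝ) - s.picks.length) + 6 * (Fintype.card V : ℝ) *
      ((ρ.length + S.window - s.clock) / S.window + S.failProb H (ρ.take s.clock) (some s))

omit [DecidableEq V] in
lemma hammingDist_le_card (c c' : V → Fin k) : (hammingDist c c' : ℝ) ≤ Fintype.card V :=
  Nat.cast_le.2 hammingDist_le_card_fintype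

/-- An attempt costs at most 3n: n to install the start coloring, n for the recolorings before a
failure, n for the change to the fallback. With success probability at least 1/2, an epoch costs 6n.
In a live state the recolorings already made are subtracted, and the failure probability is charged
with a further 6n. -/
lemma futureCost_le_restartBound (hops : S.maxOps ≤ Fintype.card V) (hW : 0 < S.window)
    (hR : ∀ H w : List (V × V), (∀ e ∈ H, e ∈ σ) → (∀ e ∈ w, e ∈ σ) → w.Nodup →
      w.length ≤ S.window → 𝔼 x : S.Seed, S.failProb H w (S.restart H x) ≤ 1 / 2)
    (ρ : List (V × V)) : ∀ H st, (∀ e ∈ H, e ∈ σ) → (∀ e ∈ ρ, e ∈ σ) → ρ.Nodup →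
      (∀ s ∈ st, s.clock ≤ S.window ∧ s.picks.length ≤ S.maxOps) →
      S.futureCost H ρ st ≤ S.restartBound H ρ st := by
  set n : ℝ := (Fintype.card V : ℝ) with hn
  have hn0 : 0 ≤ n := Nat.cast_nonneg _
  have hops' : (S.maxOps : ℝ) ≤ n := Nat.cast_le.2 hops
  have hW' : (0 : ℝ) < S.window := Nat.cast_pos.2 hW
  have hlen : ∀ s : EpochState V k, s.picks.length ≤ S.maxOps → (s.picks.length : ℝ) ≤ n :=
    fun s hs => (Nat.cast_le.2 hs).trans hops'
  have hclk : ∀ (l : List (V × V)) (s : EpochState V k), s.clock ≤ S.window →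
      (l.length : ℝ) / S.window ≤ (l.length + S.window - s.clock) / S.window := by
    intro l s hs
    have : (s.clock : ℝ) ≤ S.window := Nat.cast_le.2 hs
    gcongr
    linarith
  induction ρ with
  | nil =>
    rintro H (_ | s) _ _ _ hst
    · simp only [futureCost, restartBound]
      positivity
    · obtain ⟨h1, h2⟩ := hst s rfl
      simp only [futureCost, restartBound]
      have h3 := hclk [] s h1
      have h4 := failProb_nonneg (S := S) ([].take s.clock) H (some s)
      have h5 := hlen s h2
      have h6 : (0 : ℝ) ≤ (([] : List (V × V)).length : ℝ) / S.window := by positivity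
      have h7 : 0 ≤ 6 * n * ((([] : List (V × V)).length + S.window - s.clock) / S.window +
          S.failProb H ([].take s.clock) (some s)) :=
        mul_nonneg (by positivity) (add_nonneg (h6.trans h3) h4)
      linarith
  | cons e ρ ih =>
    intro H st hH hρ hnd hst
    have hH' : ∀ a ∈ e :: H, a ∈ σ := by
      intro a ha
      rcases List.mem_cons.1 ha with rfl | ha
      · exact hρ _ List.mem_cons_self
      · exact hH a ha
    have hρ' : ∀ a ∈ ρ, a ∈ σ := fun a ha => hρ a (List.mem_cons_of_mem _ ha)
    rw [List.nodup_cons] at hnd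
    have hrho : (((e :: ρ).length : ℕ) : ℝ) = ρ.length + 1 := by simp
    have restart_bound : 𝔼 x : S.Seed, ((hammingDist (S.out H st)
        (S.out (e :: H) (S.restart (e :: H) x)) : ℝ) +
        S.futureCost (e :: H) ρ (S.restart (e :: H) x)) ≤ 6 * n * (ρ.length / S.window + 1) := by
      have h1 : ∀ x : S.Seed, ((hammingDist (S.out H st)
          (S.out (e :: H) (S.restart (e :: H) x)) : ℝ) +
          S.futureCost (e :: H) ρ (S.restart (e :: H) x)) ≤
          (3 * n + 6 * n * (ρ.length / S.window)) +
            6 * n * S.failProb (e :: H) (ρ.take S.window) (S.restart (e :: H) x) := by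
        intro x
        have h2 := hammingDist_le_card (S.out H st) (S.out (e :: H) (S.restart (e :: H) x))
        cases hx : S.restart (e :: H) x with
        | none =>
          have h3 := ih (e :: H) none hH' hρ' hnd.2 (by simp)
          rw [hx] at h2
          rw [failProb_none]
          simp only [restartBound] at h3
          linarith
        | some s =>
          obtain ⟨h3, h4⟩ := restart_clock hx
          have h5 := ih (e :: H) (some s) hH' hρ' hnd.2 (by
            rintro s' hs'
            obtain rfl := Option.some.inj hs'
            exact ⟨h3.le, h4⟩)
          rw [hx] at h2
          simp only [restartBound] at h5
          rw [h3, add_sub_cancel_right] at h5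
          have : (0 : ℝ) ≤ s.picks.length := Nat.cast_nonneg _
          linarith
      refine (expect_le_expect fun x _ => h1 x).trans ?_
      rw [expect_add_distrib, Fintype.expect_const, ← mul_expect]
      have h2 := hR (e :: H) (ρ.take S.window) hH' (fun a ha => hρ' a (List.mem_of_mem_take ha))
        (hnd.2.sublist (List.take_sublist _ _)) (by rw [List.length_take]; exact min_le_left _ _)
      -- This is 3n + 6n · (1/2) = 6n.
      nlinarith
    have hmono : 6 * n * (ρ.length / S.window + 1) ≤
        6 * n * (((e :: ρ).length : ℕ) / S.window + 1) := by
      rw [hrho]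
      gcongr
      linarith
    cases st with
    | none =>
      rw [futureCost]
      exact restart_bound.trans hmono
    | some s =>
      obtain ⟨hs1, hs2⟩ := hst s rfl
      have hN := hlen s hs2
      by_cases hclock : s.clock = 0
      · rw [futureCost]
        simp only [Strategy.step, hclock, if_true]
        refine restart_bound.trans ?_
        simp only [restartBound, hclock]
        have h4 := failProb_nonneg (S := S) ((e :: ρ).take 0) H (some s)
        have h5 : (((e :: ρ).length : ℕ) + (S.window : ℝ) - ((0 : ℕ) : ℝ)) / S.window =
            ((e :: ρ).length : ℕ) / S.window + 1 := by
          rw [Nat.cast_zero, sub_zero, add_div, div_self hW'.ne']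
        rw [h5]
        have h6 : 0 ≤ 6 * n * S.failProb H ((e :: ρ).take 0) (some s) := by positivity
        have h7 : 6 * n * (((e :: ρ).length : ℕ) / S.window + 1 +
            S.failProb H ((e :: ρ).take 0) (some s)) =
            6 * n * (((e :: ρ).length : ℕ) / S.window + 1) +
              6 * n * S.failProb H ((e :: ρ).take 0) (some s) := by ring
        rw [h7]
        linarith
      · obtain ⟨m, hm⟩ := Nat.exists_eq_succ_of_ne_zero hclock
        set s₀ : EpochState V k := { s with clock := s.clock - 1 } with hs₀
        have hs₀c : s₀.clock = m := by simp [hs₀, hm]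
        rw [futureCost]
        simp only [Strategy.step, hclock, if_false]
        have h1 : ∀ ch : V → Chooser k, ((hammingDist (S.out H (some s))
            (S.out (e :: H) (S.serve (e :: H) e ch s₀)) : ℝ) +
            S.futureCost (e :: H) ρ (S.serve (e :: H) e ch s₀)) ≤
            (2 * n - s.picks.length + 6 * n * ((ρ.length + S.window - m) / S.window)) +
              6 * n * S.failProb (e :: H) (ρ.take m) (S.serve (e :: H) e ch s₀) := by
          intro ch
          have h2 := hammingDist_le_card (S.out H (some s))
            (S.out (e :: H) (S.serve (e :: H) e ch s₀))
          cases hx : S.serve (e :: H) e ch s₀ with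
          | none =>
            have h3 := ih (e :: H) none hH' hρ' hnd.2 (by simp)
            rw [hx] at h2
            rw [failProb_none]
            simp only [restartBound] at h3
            have h4 := hclk ρ s₀ (by omega)
            rw [hs₀c] at h4
            have h5 := mul_le_mul_of_nonneg_left h4 (show 0 ≤ 6 * n by positivity)
            linarith
          | some s' =>
            obtain ⟨rfl, h3, -⟩ := check_eq_some hx
            have h6 : (recolorAll (e :: H) (conflict e s₀) ch s₀).clock = m := by
              rw [recolorAll_clock, hs₀c]
            have h5 := ih (e :: H) (some _) hH' hρ' hnd.2 (by
              rintro s' hs'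
              obtain rfl := Option.some.inj hs'
              exact ⟨by omega, h3⟩)
            simp only [restartBound] at h5
            rw [h6] at h5
            have h7 : (hammingDist s.c (recolorAll (e :: H) (conflict e s₀) ch s₀).c : ℝ) +
                s.picks.length ≤ (recolorAll (e :: H) (conflict e s₀) ch s₀).picks.length := by
              rw [recolorAll_length]
              have := hammingDist_recolorAll_le (e :: H) (conflict e s₀) ch s₀
              push_cast
              have h8 : (hammingDist s.c (recolorAll (e :: H) (conflict e s₀) ch s₀).c : ℝ) ≤
                (conflict e s₀).length := Nat.cast_le.2 this
              have h9 : s₀.picks.length = s.picks.length := rfl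
              rw [h9]
              linarith
            simp only [Strategy.out]
            linarith
        rw [expect_snd (α := S.Λ) fun ch => ((hammingDist (S.out H (some s))
            (S.out (e :: H) (S.serve (e :: H) e ch s₀)) : ℝ) +
            S.futureCost (e :: H) ρ (S.serve (e :: H) e ch s₀))]
        refine (expect_le_expect fun ch _ => h1 ch).trans (le_of_eq ?_)
        rw [expect_add_distrib, Fintype.expect_const, ← mul_expect]
        simp only [restartBound]
        rw [hm, List.take_succ_cons, failProb, hrho]
        push_cast
        have h8 : ((ρ.length : ℝ) + 1 + S.window - (m + 1)) = ρ.length + S.window - m := by ring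
        rw [h8, hn, hs₀]
        ring

/-- The bound for the expected future cost in the first epoch. -/
lemma futureCost_le_costPot (hσ : IsAdmissible ε k σ) (hε : 0 < ε) (hε1 : ε ≤ 1) (hk : 0 < k)
    (hops : S.maxOps ≤ Fintype.card V) (hW : 0 < S.window)
    (hR : ∀ H w : List (V × V), (∀ e ∈ H, e ∈ σ) → (∀ e ∈ w, e ∈ σ) → w.Nodup →
      w.length ≤ S.window → 𝔼 x : S.Seed, S.failProb H w (S.restart H x) ≤ 1 / 2) {L Γ : ℝ}
    (hΓ : (Fintype.card V : ℝ) + 6 * Fintype.card V * (L / S.window + 1) ≤ Γ)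
    (ρ : List (V × V)) : ∀ H s, (∀ e ∈ H, e ∈ σ) → (∀ e ∈ ρ, e ∈ σ) → ρ.Nodup →
      (ρ.length : ℝ) ≤ L → ρ.length ≤ s.clock → S.EpochInv D ρ s →
      S.futureCost H ρ (some s) ≤
        s.costPot ε D ρ - s.picks.length + Γ * S.deathPot ε D ρ s := by
  have hΓ0 : 0 ≤ L → 0 ≤ Γ := fun hL => le_trans (by positivity) hΓ
  have hpot : ∀ (ρ : List (V × V)) (s : EpochState V k),
      (s.picks.length : ℝ) ≤ s.costPot ε D ρ := by
    intro ρ s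
    unfold costPot opsPot
    have : 0 ≤ (s.threat ρ : ℝ) / ε := by positivity
    have : 0 ≤ 2 / ε * (s.fresh D : ℝ) := by positivity
    linarith
  induction ρ with
  | nil =>
    intro H s _ _ _ hL _ _
    have h1 := hpot [] s
    have h2 := mul_nonneg (hΓ0 (le_trans (by simp) hL)) (deathPot_nonneg (S := S) (D := D)
      (w := []) hε s)
    simp only [futureCost]
    linarith
  | cons e ρ ih =>
    intro H s hH hρ hnd hL hclock hs
    have hH' : ∀ a ∈ e :: H, a ∈ σ := by
      intro a ha
      rcases List.mem_cons.1 ha with rfl | ha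
      · exact hρ _ List.mem_cons_self
      · exact hH a ha
    have hρ' : ∀ a ∈ ρ, a ∈ σ := fun a ha => hρ a (List.mem_cons_of_mem _ ha)
    rw [List.nodup_cons] at hnd
    rw [List.length_cons] at hclock hL
    push_cast at hL
    have hL0 : 0 ≤ L := le_trans (by positivity) hL
    have hρL : (ρ.length : ℝ) ≤ L := by linarith
    have hc0 : s.clock ≠ 0 := by omega
    rw [futureCost]
    simp only [Strategy.step, hc0, if_false]
    rw [expect_snd (α := S.Λ) fun ch => ((hammingDist (S.out H (some s))
        (S.out (e :: H) (S.serve (e :: H) e ch { s with clock := s.clock - 1 })) : ℝ) +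
        S.futureCost (e :: H) ρ (S.serve (e :: H) e ch { s with clock := s.clock - 1 }))]
    set s₀ : EpochState V k := { s with clock := s.clock - 1 } with hs₀
    have hs' : S.EpochInv D (e :: ρ) s₀ := ⟨hs.1, hs.2, hs.3⟩
    have h1 : ∀ ch : V → Chooser k, ((hammingDist (S.out H (some s))
        (S.out (e :: H) (S.serve (e :: H) e ch s₀)) : ℝ) +
        S.futureCost (e :: H) ρ (S.serve (e :: H) e ch s₀)) ≤
        ((s₀.recolorAll (e :: H) (s₀.conflict e) ch).costPot ε D ρ +
          Γ * S.deathPot ε D ρ (s₀.recolorAll (e :: H) (s₀.conflict e) ch)) - s.picks.length := by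
      intro ch
      have h2 := hammingDist_le_card (S.out H (some s))
        (S.out (e :: H) (S.serve (e :: H) e ch s₀))
      cases hx : S.serve (e :: H) e ch s₀ with
      | none =>
        have h3 := futureCost_le_restartBound hops hW hR ρ (e :: H) none hH' hρ' hnd.2 (by simp)
        rw [hx] at h2
        simp only [restartBound] at h3
        -- On failure the death potential is at least 1, so the term with `Γ` covers the change to
        -- the fallback and all later costs.
        have h4 := one_le_deathPot (D := D) (w := ρ) hε hx (serve_length_le hs'.length_le _ _)
        have h5 := mul_le_mul_of_nonneg_left h4 (hΓ0 hL0)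
        have h6 := hpot ρ (s₀.recolorAll (e :: H) (s₀.conflict e) ch)
        rw [recolorAll_length] at h6
        push_cast at h6
        have h7 : (s₀.picks.length : ℝ) = s.picks.length := rfl
        have h8 : (0 : ℝ) ≤ (s₀.conflict e).length := Nat.cast_nonneg _
        have h9 : 6 * (Fintype.card V : ℝ) * (ρ.length / S.window + 1) ≤
            6 * Fintype.card V * (L / S.window + 1) := by gcongr
        linarith
      | some s' =>
        have h3 := hs'.serve hx
        obtain ⟨rfl, -, -⟩ := check_eq_some hx
        have h5 := ih (e :: H) _ hH' hρ' hnd.2 hρL (by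
          rw [recolorAll_clock]
          change ρ.length ≤ s.clock - 1
          omega) h3
        have h7 : (hammingDist s.c (recolorAll (e :: H) (conflict e s₀) ch s₀).c : ℝ) +
            s.picks.length ≤ (recolorAll (e :: H) (conflict e s₀) ch s₀).picks.length := by
          rw [recolorAll_length]
          have := hammingDist_recolorAll_le (e :: H) (conflict e s₀) ch s₀
          push_cast
          have h8 : (hammingDist s.c (recolorAll (e :: H) (conflict e s₀) ch s₀).c : ℝ) ≤
            (conflict e s₀).length := Nat.cast_le.2 this
          have h9 : s₀.picks.length = s.picks.length := rfl
          rw [h9]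
          linarith
        simp only [Strategy.out]
        linarith
    refine (expect_le_expect fun ch _ => h1 ch).trans ?_
    rw [expect_sub_distrib, expect_add_distrib, Fintype.expect_const, ← mul_expect]
    have h2 := expect_deathPot_conflict hσ hε hε1 hk hH' hρ hs'
    have h3 := expect_costPot_conflict hσ hε hε1 hk hH' hρ hs'.stamp hs'.cover
    have h4 := mul_le_mul_of_nonneg_left h2 (hΓ0 hL0)
    have h5 : s₀.costPot ε D (e :: ρ) = s.costPot ε D (e :: ρ) := rfl
    have h6 : S.deathPot ε D (e :: ρ) s₀ = S.deathPot ε D (e :: ρ) s := rfl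
    rw [h5] at h3
    rw [h6] at h4
    linarith

/-- The bound for the expected total cost. -/
theorem futureCost_init_le (hσ : IsAdmissible ε k σ) (hε : 0 < ε) (hε1 : ε ≤ 1) (hk : 0 < k)
    (hops : S.maxOps ≤ Fintype.card V) (hW : 0 < S.window)
    (hR : ∀ H w : List (V × V), (∀ e ∈ H, e ∈ σ) → (∀ e ∈ w, e ∈ σ) → w.Nodup →
      w.length ≤ S.window → 𝔼 x : S.Seed, S.failProb H w (S.restart H x) ≤ 1 / 2) {L Γ : ℝ}
    (hΓ : (Fintype.card V : ℝ) + 6 * Fintype.card V * (L / S.window + 1) ≤ Γ)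
    {ρ : List (V × V)} (hρ : ∀ e ∈ ρ, e ∈ σ) (hnd : ρ.Nodup) (hL : (ρ.length : ℝ) ≤ L)
    (hclock : ρ.length ≤ S.horizon) {c₀ : V → Fin k}
    (hD : ∀ e ∈ ρ, c₀ e.1 = c₀ e.2 → e.1 ∈ D ∨ e.2 ∈ D) :
    S.futureCost [] ρ (S.init c₀) ≤ 2 / ε * #D + Γ * (2 / ε * #D / (S.maxOps + 1) +
      (1 + 1 / (ε * k)) ^ (S.maxOps + 2) / 2 ^ (S.maxPicks + 1) * k) := by
  have h := futureCost_le_costPot (D := D) hσ hε hε1 hk hops hW hR hΓ ρ []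
    ⟨c₀, fun _ => 0, [], S.horizon⟩ (by simp) hρ hnd hL hclock
    ⟨fun v => Nat.zero_le _, fun e he _ _ h3 => hD e he h3, Nat.zero_le _⟩
  refine h.trans (le_of_eq ?_)
  unfold deathPot costPot opsPot threat fresh pickPot Threatened
  simp

lemma futureCost_le_card_mul (ρ : List (V × V)) : ∀ H st,
    S.futureCost H ρ st ≤ Fintype.card V * ρ.length := by
  induction ρ with
  | nil => intro H st; simp [futureCost]
  | cons e ρ ih =>
    intro H st
    rw [futureCost]
    refine expect_le univ_nonempty fun x _ => ?_
    have h1 := ih (e :: H) (S.step (e :: H) e x st)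
    have h2 := hammingDist_le_card (S.out H st) (S.out (e :: H) (S.step (e :: H) e x st))
    rw [List.length_cons]
    push_cast
    linarith

/-- Without conflicts there is no cost. -/
lemma futureCost_eq_zero (ρ : List (V × V)) : ∀ H s, (∀ e ∈ ρ, s.c e.1 ≠ s.c e.2) →
    ρ.length ≤ s.clock → S.check s = some s → S.futureCost H ρ (some s) = 0 := by
  induction ρ with
  | nil => intro H s _ _ _; simp [futureCost]
  | cons e ρ ih =>
    intro H s hρ hclock hs
    rw [List.length_cons] at hclock
    rw [futureCost]
    refine expect_eq_zero fun x _ => ?_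
    have h1 : s.clock ≠ 0 := by omega
    have h2 : S.step (e :: H) e x (some s) = some { s with clock := s.clock - 1 } := by
      simp only [Strategy.step, h1, if_false]
      have h3 : EpochState.conflict e { s with clock := s.clock - 1 } = [] := by
        simp [EpochState.conflict, hρ e List.mem_cons_self]
      unfold Strategy.serve
      rw [h3, recolorAll_nil]
      unfold check at hs ⊢
      split_ifs at hs with h4
      exact if_pos h4
    rw [h2, ih (e :: H) { s with clock := s.clock - 1 }
      (fun a ha => hρ a (List.mem_cons_of_mem _ ha)) (by change _ ≤ s.clock - 1; omega) ?_]
    · simp [Strategy.out]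
    · unfold check at hs ⊢
      split_ifs at hs with h4
      exact if_pos h4

end Strategy

end OnlineRecoloring

/-! ### Random palettes -/

namespace OnlineRecoloring

open Finset

variable {V : Type} [Fintype V] [DecidableEq V] {k : ℕ}

/-- Blocks of `B` consecutive colors; the fewer than `B` leftover colors join the last block. -/
lemma exists_palettes {B : ℕ} (hB : 0 < B) (hBk : B ≤ k) : ∃ pal : Fin k → ℕ, ∀ i,
    B ≤ #(univ.filter fun j => pal j = pal i) ∧ #(univ.filter fun j => pal j = pal i) ≤ 2 * B := by
  set m := k / B with hm
  have hm1 : 1 ≤ m := (Nat.one_le_div_iff hB).2 hBk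
  have hmk : m * B ≤ k := Nat.div_mul_le_self k B
  have hkm : k < (m + 1) * B := by
    rw [add_mul, one_mul, mul_comm]
    exact Nat.lt_mul_div_succ k hB |>.trans_eq (by rw [← hm]; ring)
  refine ⟨fun i => min (i / B) (m - 1), fun i => ?_⟩
  set a := min (i / B) (m - 1) with ha
  have ham : a + 1 ≤ m := by omega
  have haB : (a + 1) * B ≤ m * B := Nat.mul_le_mul_right _ ham
  rw [add_mul, one_mul] at haB
  constructor
  · calc B = #(univ : Finset (Fin B)) := by simp
      _ ≤ _ := by
        refine card_le_card_of_injOn (fun b => (⟨a * B + b, by omega⟩ : Fin k)) ?_ ?_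
        · intro b _
          rw [mem_coe, mem_filter]
          refine ⟨mem_univ _, ?_⟩
          have : (a * B + b) / B = a := by
            rw [mul_comm, Nat.mul_add_div hB, Nat.div_eq_of_lt b.2, add_zero]
          simp only [this]
          omega
        · intro b _ b' _ h
          simp only [Fin.mk.injEq] at h
          exact Fin.ext (by omega)
  · calc _ ≤ #(Ico (a * B) (a * B + 2 * B)) := by
          refine card_le_card_of_injOn (fun j : Fin k => (j : ℕ)) ?_ Fin.val_injective.injOn
          intro j hj
          rw [mem_coe, mem_filter] at hj
          have hj' : min ((j : ℕ) / B) (m - 1) = a := hj.2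
          rw [mem_coe, mem_Ico]
          have h1 : a ≤ j / B := by omega
          have h2 : a * B ≤ j := (Nat.mul_le_mul_right _ h1).trans (Nat.div_mul_le_self _ _)
          refine ⟨h2, ?_⟩
          by_cases h3 : (j : ℕ) / B = a
          · have := Nat.lt_mul_div_succ (j : ℕ) hB
            rw [h3] at this
            nlinarith
          · have h4 : a + 1 = m := by omega
            have h5 : (j : ℕ) < (m + 1) * B := j.2.trans hkm
            rw [← h4] at h5
            nlinarith
      _ = 2 * B := by simp

section Labels

/-- The number of vertices of `N` with a label in `A`. -/
def labelCount (N : Finset V) (A : Finset (Fin k)) (ℓ : V → Fin k) : ℕ :=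
  #(N.filter fun v => ℓ v ∈ A)

/-- The second moment of the number of random labels in a set. -/
lemma expect_labelCount_sq (hk : 0 < k) (A : Finset (Fin k)) (N : Finset V) :
    𝔼 ℓ : V → Fin k, ((labelCount N A ℓ : ℝ) - #N * (#A / k)) ^ 2 ≤ #N * (#A / k) := by
  have : Nonempty (Fin k) := ⟨⟨0, hk⟩⟩
  set p : ℝ := #A / k with hp
  have hp0 : 0 ≤ p := by positivity
  let y : Fin k → ℝ := fun i => (if i ∈ A then 1 else 0) - p
  have hy : 𝔼 i, y i = 0 := by
    rw [expect_sub_distrib, Fintype.expect_const, Fintype.expect_eq_sum_div_card, Fintype.card_fin]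
    simp [hp]
  have hy2 : 𝔼 i, y i ^ 2 ≤ p := by
    have h1 : ∀ i, y i ^ 2 = (y i * (1 - 2 * p)) + (p - p ^ 2) := by
      intro i
      simp only [y]
      split_ifs <;> ring
    rw [expect_congr rfl fun i _ => h1 i, expect_add_distrib, ← expect_mul, hy,
      Fintype.expect_const]
    nlinarith [sq_nonneg p]
  have key : ∀ N : Finset V, 𝔼 ℓ : V → Fin k, (∑ v ∈ N, y (ℓ v)) ^ 2 ≤ #N * p := by
    intro N
    induction N using Finset.induction_on with
    | empty => simp
    | insert v N hv ih =>
      have h1 : ∀ ℓ : V → Fin k, (∑ u ∈ insert v N, y (ℓ u)) ^ 2 =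
          y (ℓ v) ^ 2 + 2 * (y (ℓ v) * ∑ u ∈ N, y (ℓ u)) + (∑ u ∈ N, y (ℓ u)) ^ 2 := by
        intro ℓ
        rw [sum_insert hv]
        ring
      -- The cross term vanishes: `y` is centered and the label of `v` is independent of those in
      -- `N`.
      have h2 : 𝔼 ℓ : V → Fin k, y (ℓ v) * ∑ u ∈ N, y (ℓ u) = 0 := by
        rw [expect_pi_update v]
        refine expect_eq_zero fun ℓ _ => ?_
        have h3 : ∀ x : Fin k, y (Function.update ℓ v x v) * ∑ u ∈ N, y (Function.update ℓ v x u) =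
            y x * ∑ u ∈ N, y (ℓ u) := by
          intro x
          rw [Function.update_self]
          congr 1
          refine sum_congr rfl fun u hu => ?_
          rw [Function.update_of_ne]
          rintro rfl
          exact hv hu
        rw [expect_congr rfl fun x _ => h3 x, ← expect_mul, hy, zero_mul]
      rw [expect_congr rfl fun ℓ _ => h1 ℓ, expect_add_distrib, expect_add_distrib, ← mul_expect, h2,
        expect_pi_apply v fun i => y i ^ 2, card_insert_of_notMem hv]
      push_cast
      linarith
  refine le_trans (le_of_eq (expect_congr rfl fun ℓ _ => ?_)) (key N)
  simp only [y, labelCount]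
  rw [sum_sub_distrib, sum_const, nsmul_eq_mul, sum_boole]

/-- Chebyshev's inequality for the number of random labels in a set. -/
lemma expect_labelCount_ge (hk : 0 < k) (A : Finset (Fin k)) (N : Finset V) {a t : ℝ} (ht : 0 < t)
    (ha : #N * ((#A : ℝ) / k) + t ≤ a) :
    𝔼 ℓ : V → Fin k, (if a ≤ labelCount N A ℓ then (1 : ℝ) else 0) ≤
      #N * ((#A : ℝ) / k) / t ^ 2 := by
  rw [le_div_iff₀ (by positivity)]
  refine le_trans ?_ (expect_labelCount_sq hk A N)
  rw [expect_mul]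
  refine expect_le_expect fun ℓ _ => ?_
  split_ifs with h
  · rw [one_mul]
    refine pow_le_pow_left₀ ht.le ?_ 2
    linarith
  · rw [zero_mul]
    positivity

lemma expect_pal_eq_le {pal : Fin k → ℕ} {q : ℕ}
    (hq : ∀ i, #(univ.filter fun j => pal j = pal i) ≤ q) {u v : V} (huv : u ≠ v) :
    𝔼 ℓ : V → Fin k, (if pal (ℓ u) = pal (ℓ v) then (1 : ℝ) else 0) ≤ (q : ℝ) / k := by
  rcases Nat.eq_zero_or_pos k with rfl | hk
  · have : IsEmpty (V → Fin 0) := ⟨fun f => (f u).elim0⟩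
    simp
  have : Nonempty (Fin k) := ⟨⟨0, hk⟩⟩
  rw [expect_pi_update u]
  refine expect_le univ_nonempty fun ℓ _ => ?_
  simp only [Function.update_self, Function.update_of_ne huv.symm]
  rw [Fintype.expect_eq_sum_div_card, Fintype.card_fin, sum_boole]
  have := hq (ℓ v)
  gcongr

/-- The vertices with too many neighbors in their own palette. -/
def badVertices (pal : Fin k → ℕ) (H : List (V × V)) (ℓ : V → Fin k) : Finset V :=
  univ.filter fun v => #(univ.filter fun j => pal j = pal (ℓ v)) ≤
    labelCount (nbrs H v) (univ.filter fun j => pal j = pal (ℓ v)) ℓ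

/-- With the palette A of `v` fixed, at most (1 - ε)|A| neighbors are expected in it, so being bad
is a deviation of ε|A|. The variance is at most |A|, and Chebyshev gives 1/(ε²|A|). -/
lemma expect_card_badVertices_le {ε : ℝ} (hε : 0 < ε) (hk : 0 < k) {pal : Fin k → ℕ} {B : ℕ}
    (hB : 0 < B) (hpal : ∀ i, B ≤ #(univ.filter fun j => pal j = pal i)) {H : List (V × V)}
    (hH : ∀ v, (#(nbrs H v) : ℝ) ≤ (1 - ε) * k) (hloop : ∀ e ∈ H, e.1 ≠ e.2) :
    𝔼 ℓ : V → Fin k, (#(badVertices pal H ℓ) : ℝ) ≤ Fintype.card V * (1 / (ε ^ 2 * B)) := by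
  have : Nonempty (Fin k) := ⟨⟨0, hk⟩⟩
  have hk' : (0 : ℝ) < k := Nat.cast_pos.2 hk
  have hB' : (0 : ℝ) < B := Nat.cast_pos.2 hB
  have h1 : ∀ ℓ : V → Fin k, (#(badVertices pal H ℓ) : ℝ) =
      ∑ v, if #(univ.filter fun j => pal j = pal (ℓ v)) ≤
        labelCount (nbrs H v) (univ.filter fun j => pal j = pal (ℓ v)) ℓ then (1 : ℝ) else 0 := by
    intro ℓ
    rw [sum_boole]
    rfl
  rw [expect_congr rfl fun ℓ _ => h1 ℓ, expect_sum_comm, ← nsmul_eq_mul, ← Finset.card_univ]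
  refine sum_le_card_nsmul _ _ _ fun v _ => ?_
  have hv : v ∉ nbrs H v := by
    intro h
    rcases mem_nbrs.1 h with h | h <;> exact hloop _ h rfl
  rw [expect_pi_update v, expect_comm]
  refine expect_le univ_nonempty fun x _ => ?_
  set A : Finset (Fin k) := univ.filter fun j => pal j = pal x with hA
  have h2 : ∀ ℓ : V → Fin k, (if #(univ.filter fun j => pal j = pal (Function.update ℓ v x v)) ≤
      labelCount (nbrs H v) (univ.filter fun j => pal j = pal (Function.update ℓ v x v))
        (Function.update ℓ v x) then (1 : ℝ) else 0) =
      if (#A : ℝ) ≤ labelCount (nbrs H v) A ℓ then (1 : ℝ) else 0 := by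
    intro ℓ
    rw [Function.update_self, ← hA]
    have h3 : labelCount (nbrs H v) A (Function.update ℓ v x) = labelCount (nbrs H v) A ℓ := by
      unfold labelCount
      congr 1
      refine filter_congr fun w hw => ?_
      rw [Function.update_of_ne]
      rintro rfl
      exact hv hw
    rw [h3]
    simp only [Nat.cast_le]
  rw [expect_congr rfl fun ℓ _ => h2 ℓ]
  have hq : (B : ℝ) ≤ #A := Nat.cast_le.2 (hpal x)
  have hq0 : (0 : ℝ) < #A := hB'.trans_le hq
  have h4 : (#(nbrs H v) : ℝ) * (#A / k) ≤ (1 - ε) * #A := by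
    calc (#(nbrs H v) : ℝ) * (#A / k) ≤ ((1 - ε) * k) * (#A / k) := by
          have := hH v
          gcongr
      _ = _ := by field_simp
  refine (expect_labelCount_ge hk A (nbrs H v) (t := ε * #A) (by positivity)
    (by linarith)).trans ?_
  calc (#(nbrs H v) : ℝ) * (#A / k) / (ε * #A) ^ 2 ≤ #A / (ε * #A) ^ 2 := by
        have : (1 - ε) * (#A : ℝ) ≤ #A := by nlinarith
        gcongr
        linarith
    _ = 1 / (ε ^ 2 * #A) := by field_simp
    _ ≤ 1 / (ε ^ 2 * B) := by gcongr

lemma expect_group_le {ε : ℝ} (hε : 0 < ε) (hk : 0 < k) (hV : 0 < Fintype.card V)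
    {pal : Fin k → ℕ} {B : ℕ} (hB : 0 < B)
    (hpal : ∀ i, B ≤ #(univ.filter fun j => pal j = pal i)) (i : Fin k) :
    𝔼 ℓ : V → Fin k, (if (1 + ε / 8) * (Fintype.card V * ((#(univ.filter fun j => pal j = pal i) : ℝ)
      / k)) ≤ labelCount univ (univ.filter fun j => pal j = pal i) ℓ then (1 : ℝ) else 0) ≤
      64 * k / (ε ^ 2 * Fintype.card V * B) := by
  set A : Finset (Fin k) := univ.filter fun j => pal j = pal i with hA
  set n : ℝ := (Fintype.card V : ℝ) with hn
  have hn0 : 0 < n := Nat.cast_pos.2 hV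
  have hk' : (0 : ℝ) < k := Nat.cast_pos.2 hk
  have hB' : (0 : ℝ) < B := Nat.cast_pos.2 hB
  have hq : (B : ℝ) ≤ #A := Nat.cast_le.2 (hpal i)
  have hq0 : (0 : ℝ) < #A := hB'.trans_le hq
  refine (expect_labelCount_ge hk A univ (t := ε / 8 * (n * (#A / k))) (by positivity)
    (by rw [card_univ, ← hn]; linarith)).trans ?_
  rw [card_univ, ← hn]
  calc n * ((#A : ℝ) / k) / (ε / 8 * (n * (#A / k))) ^ 2 = 64 * k / (ε ^ 2 * n * #A) := by
        field_simp
        norm_num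
    _ ≤ _ := by gcongr

end Labels

end OnlineRecoloring

/-! ### The start coloring of an epoch -/

namespace OnlineRecoloring

open Finset

variable {V : Type} [Fintype V] [DecidableEq V] {k : ℕ}

/-- A good vertex has fewer neighbors in its palette than the palette has colors, so
Hajnal–Szemerédi applies inside each palette. Vertices in different palettes never share a color. -/
lemma exists_coloring_of_labels {pal : Fin k → ℕ} {H : List (V × V)} (hloop : ∀ e ∈ H, e.1 ≠ e.2)
    (ℓ : V → Fin k) {s : ℕ}
    (hs : ∀ i, labelCount univ (univ.filter fun j => pal j = pal i) ℓ ≤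
      s * #(univ.filter fun j => pal j = pal i)) :
    ∃ c : V → Fin k, (∀ e ∈ H, e.1 ∉ badVertices pal H ℓ → e.2 ∉ badVertices pal H ℓ →
        c e.1 ≠ c e.2) ∧
      (∀ i, #(univ.filter fun v => v ∉ badVertices pal H ℓ ∧ c v = i) ≤ s) ∧
      ∀ v, v ∉ badVertices pal H ℓ → pal (c v) = pal (ℓ v) := by
  classical
  set U := badVertices pal H ℓ with hU
  let P : ℕ → Finset (Fin k) := fun a => univ.filter fun j => pal j = a
  let X : ℕ → Finset V := fun a => univ.filter fun v => v ∉ U ∧ pal (ℓ v) = a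
  have hex : ∀ a, ∃ f : V → Fin k, (∀ v ∈ X a, f v ∈ P a) ∧
      EquitableColoring.ProperOn (requestGraph H) (X a) f ∧
      ∀ i ∈ P a, #(EquitableColoring.cls (X a) f i) ≤ s := by
    intro a
    by_cases ha : (P a).Nonempty
    · obtain ⟨i, hi⟩ := ha
      obtain rfl : pal i = a := (mem_filter.1 hi).2
      refine EquitableColoring.exists_coloring_card_le ⟨i, hi⟩ (requestGraph H) (X (pal i))
        (le_trans (card_le_card fun v hv => ?_) (hs i)) fun v hv => ?_
      · have := (mem_filter.1 hv).2.2
        simp [this]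
      · obtain ⟨hvU, hva⟩ := (mem_filter.1 hv).2
        have h1 : ¬ #(univ.filter fun j => pal j = pal (ℓ v)) ≤
            labelCount (nbrs H v) (univ.filter fun j => pal j = pal (ℓ v)) ℓ :=
          fun h => hvU (mem_filter.2 ⟨mem_univ _, h⟩)
        rw [hva] at h1
        refine lt_of_le_of_lt (card_le_card fun w hw => ?_) (not_le.1 h1)
        obtain ⟨hw, hadj⟩ := mem_filter.1 hw
        rw [requestGraph, SimpleGraph.fromRel_adj] at hadj
        have := (mem_filter.1 hw).2.2
        exact mem_filter.2 ⟨mem_nbrs.2 hadj.2, by simp [this]⟩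
    · rw [not_nonempty_iff_eq_empty] at ha
      have hX : X a = ∅ := by
        refine eq_empty_of_forall_notMem fun v hv => ?_
        have : ℓ v ∈ P a := by simp [P, (mem_filter.1 hv).2.2]
        rw [ha] at this
        exact absurd this (by simp)
      refine ⟨ℓ, ?_, ?_, ?_⟩
      · simp [hX]
      · simp [hX, EquitableColoring.ProperOn]
      · simp [ha]
  choose f hf1 hf2 hf3 using hex
  have hX : ∀ v, v ∉ U → v ∈ X (pal (ℓ v)) := fun v hv => by simp [X, hv]
  have hpal : ∀ v, v ∉ U → pal (f (pal (ℓ v)) v) = pal (ℓ v) := fun v hv =>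
    (mem_filter.1 (hf1 _ v (hX v hv))).2
  refine ⟨fun v => f (pal (ℓ v)) v, fun e he h1 h2 h3 => ?_, fun i => ?_, hpal⟩
  · simp only at h3
    have h4 : pal (ℓ e.1) = pal (ℓ e.2) := by
      rw [← hpal _ h1, ← hpal _ h2, h3]
    have h5 := hX _ h1
    rw [h4] at h3 h5
    refine hf2 _ _ h5 _ (hX _ h2) ?_ h3
    rw [requestGraph, SimpleGraph.fromRel_adj]
    exact ⟨hloop e he, .inl he⟩
  · refine le_trans (card_le_card fun v hv => ?_) (hf3 (pal i) i (by simp [P]))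
    obtain ⟨h1, h2⟩ := (mem_filter.1 hv).2
    have h3 : pal i = pal (ℓ v) := by rw [← h2, hpal v h1]
    rw [EquitableColoring.mem_cls, h3]
    exact ⟨hX v h1, h2⟩

/-- A random start coloring with few bad vertices, balanced classes, and few future conflicts. -/
theorem exists_start {ε : ℝ} (hε : 0 < ε) (hV : 0 < Fintype.card V) {B : ℕ}
    (hB : 0 < B) (hBk : B ≤ k) {H : List (V × V)} (hH : IsAdmissible ε k H) {s : ℕ}
    (hs : (1 + ε / 8) * ((Fintype.card V : ℝ) / k) ≤ s) (M : ℕ) :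
    ∃ F : (V → Fin k) → Option ((V → Fin k) × Finset V),
      (∀ ℓ c U, F ℓ = some (c, U) →
        (∀ e ∈ H, e.1 ∉ U → e.2 ∉ U → c e.1 ≠ c e.2) ∧
        (∀ i, #(univ.filter fun v => v ∉ U ∧ c v = i) ≤ s) ∧ #U ≤ M) ∧
      ∀ w : List (V × V), (∀ e ∈ w, e.1 ≠ e.2) → 𝔼 ℓ, Strategy.startPot M ε w (F ℓ) ≤
        64 * (k : ℝ) ^ 2 / (ε ^ 2 * Fintype.card V * B) +
          (Fintype.card V * (1 / (ε ^ 2 * B)) * (1 + 1 / ε) +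
            2 / ε * (w.length * (2 * B / k))) / (M + 1) := by
  classical
  have hk : 0 < k := hB.trans_le hBk
  have : Nonempty (Fin k) := ⟨⟨0, hk⟩⟩
  have hk' : (0 : ℝ) < k := Nat.cast_pos.2 hk
  set n : ℝ := (Fintype.card V : ℝ) with hn
  obtain ⟨pal, hpal⟩ := exists_palettes hB hBk
  let big : (V → Fin k) → Fin k → Prop := fun ℓ i => (1 + ε / 8) *
    (n * ((#(univ.filter fun j => pal j = pal i) : ℝ) / k)) ≤
      labelCount univ (univ.filter fun j => pal j = pal i) ℓ
  have hex : ∀ ℓ : V → Fin k, ∃ c : V → Fin k, (∀ i, ¬ big ℓ i) →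
      (∀ e ∈ H, e.1 ∉ badVertices pal H ℓ → e.2 ∉ badVertices pal H ℓ → c e.1 ≠ c e.2) ∧
      (∀ i, #(univ.filter fun v => v ∉ badVertices pal H ℓ ∧ c v = i) ≤ s) ∧
      ∀ v, v ∉ badVertices pal H ℓ → pal (c v) = pal (ℓ v) := by
    intro ℓ
    by_cases h : ∀ i, ¬ big ℓ i
    · obtain ⟨c, hc⟩ := exists_coloring_of_labels (pal := pal) hH.1 ℓ (s := s) (fun i => by
        have h1 := (not_le.1 (h i)).le
        have h2 : (1 + ε / 8) * (n * ((#(univ.filter fun j => pal j = pal i) : ℝ) / k)) =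
            ((1 + ε / 8) * (n / k)) * #(univ.filter fun j => pal j = pal i) := by ring
        rw [h2] at h1
        have h3 := h1.trans (mul_le_mul_of_nonneg_right hs (Nat.cast_nonneg _))
        exact_mod_cast h3)
      exact ⟨c, fun _ => hc⟩
    · exact ⟨ℓ, fun h' => absurd h' h⟩
  choose c hc using hex
  refine ⟨fun ℓ => if (∀ i, ¬ big ℓ i) ∧ #(badVertices pal H ℓ) ≤ M then
    some (c ℓ, badVertices pal H ℓ) else none, fun ℓ c' U h => ?_, fun w hw => ?_⟩
  · beta_reduce at h
    split_ifs at h with h1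
    obtain ⟨rfl, rfl⟩ := Prod.mk.inj (Option.some.inj h)
    exact ⟨(hc ℓ h1.1).1, (hc ℓ h1.1).2.1, h1.2⟩
  -- A union bound: an overfull palette; too many bad vertices, by Markov; and the cost of the bad
  -- vertices and of future conflicts, which require equal palettes. In the factor 1 + 1/ε the first
  -- term is for Markov, the second for the recolorings.
  · have hpoint : ∀ ℓ, Strategy.startPot M ε w (if (∀ i, ¬ big ℓ i) ∧ #(badVertices pal H ℓ) ≤ M then
        some (c ℓ, badVertices pal H ℓ) else none) ≤
        ∑ i, (if big ℓ i then (1 : ℝ) else 0) + ((#(badVertices pal H ℓ) : ℝ) * (1 + 1 / ε) +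
          2 / ε * ∑ e ∈ w.toFinset, if pal (ℓ e.1) = pal (ℓ e.2) then (1 : ℝ) else 0) / (M + 1) := by
      intro ℓ
      have h1 : 0 ≤ ∑ i, (if big ℓ i then (1 : ℝ) else 0) :=
        sum_nonneg fun i _ => by split_ifs <;> norm_num
      have h2 : 0 ≤ ∑ e ∈ w.toFinset, if pal (ℓ e.1) = pal (ℓ e.2) then (1 : ℝ) else 0 :=
        sum_nonneg fun i _ => by split_ifs <;> norm_num
      split_ifs with h
      · simp only [Strategy.startPot]
        have h3 : (#(Strategy.conflicts w (c ℓ) (badVertices pal H ℓ)) : ℝ) ≤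
            ∑ e ∈ w.toFinset, if pal (ℓ e.1) = pal (ℓ e.2) then (1 : ℝ) else 0 := by
          rw [sum_boole]
          refine Nat.cast_le.2 (card_le_card fun e he => ?_)
          obtain ⟨h4, h5, h6, h7⟩ := mem_filter.1 he
          refine mem_filter.2 ⟨h4, ?_⟩
          rw [← (hc ℓ h.1).2.2 _ h5, ← (hc ℓ h.1).2.2 _ h6, h7]
        refine le_trans ?_ (le_add_of_nonneg_left h1)
        gcongr
        rw [div_eq_mul_one_div]
        gcongr
        linarith
      · simp only [Strategy.startPot]
        rw [not_and_or] at h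
        rcases h with h | h
        · push Not at h
          obtain ⟨i, hi⟩ := h
          have h4 : (1 : ℝ) ≤ ∑ i, (if big ℓ i then (1 : ℝ) else 0) := by
            refine le_trans (by rw [if_pos hi]) (single_le_sum (f := fun i =>
              if big ℓ i then (1 : ℝ) else 0) (fun j _ => ?_) (mem_univ i))
            split_ifs <;> norm_num
          refine le_trans h4 (le_add_of_nonneg_right ?_)
          positivity
        · refine le_trans ?_ (le_add_of_nonneg_left h1)
          rw [le_div_iff₀ (by positivity), one_mul]
          have h4 : (M : ℝ) + 1 ≤ #(badVertices pal H ℓ) := by exact_mod_cast not_le.1 h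
          have h5 : 0 ≤ (#(badVertices pal H ℓ) : ℝ) * (1 / ε) := by positivity
          have h6 : 0 ≤ 2 / ε * ∑ e ∈ w.toFinset,
            if pal (ℓ e.1) = pal (ℓ e.2) then (1 : ℝ) else 0 := by positivity
          linarith
    refine (expect_le_expect fun ℓ _ => hpoint ℓ).trans ?_
    rw [expect_add_distrib, ← expect_div, expect_add_distrib, ← expect_mul, ← mul_expect,
      expect_sum_comm, expect_sum_comm]
    have h1 : ∑ i, 𝔼 ℓ : V → Fin k, (if big ℓ i then (1 : ℝ) else 0) ≤
        64 * (k : ℝ) ^ 2 / (ε ^ 2 * n * B) := by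
      refine (sum_le_card_nsmul _ _ _ fun i _ =>
        expect_group_le hε hk hV hB (fun i => (hpal i).1) i).trans (le_of_eq ?_)
      rw [card_univ, Fintype.card_fin, nsmul_eq_mul]
      ring
    have h2 := expect_card_badVertices_le hε hk hB (fun i => (hpal i).1) hH.card_nbrs_le hH.1
    have h3 : ∑ e ∈ w.toFinset, 𝔼 ℓ : V → Fin k,
        (if pal (ℓ e.1) = pal (ℓ e.2) then (1 : ℝ) else 0) ≤ w.length * (2 * B / k) := by
      refine (sum_le_card_nsmul _ _ _ fun e he => expect_pal_eq_le (fun i => (hpal i).2)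
        (hw e (List.mem_toFinset.1 he))).trans ?_
      rw [nsmul_eq_mul]
      push_cast
      have : (#w.toFinset : ℝ) ≤ w.length := Nat.cast_le.2 (List.toFinset_card_le w)
      gcongr
    gcongr

end OnlineRecoloring

/-! ### Choice of parameters and competitiveness -/

namespace OnlineRecoloring

open Finset

variable {V : Type} [Fintype V] [DecidableEq V] {k : ℕ}

lemma exists_balanced_coloring {ε : ℝ} (hε : 0 < ε) (hk : 0 < k) {s : ℕ}
    (hs : Fintype.card V = s * k) {H : List (V × V)} (hH : IsAdmissible ε k H) :
    ∃ g : V → Fin k, IsProper g H ∧ ∀ i, load g i ≤ s := by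
  classical
  obtain ⟨f, -, h2, h3⟩ := EquitableColoring.exists_coloring_card_le (P := (univ : Finset (Fin k)))
    (s := s) ⟨⟨0, hk⟩, mem_univ _⟩ (requestGraph H) univ (by simp [hs]) (fun v _ => by
      rw [card_univ, Fintype.card_fin]
      have h1 : (univ.filter ((requestGraph H).Adj v)) ⊆ nbrs H v := fun w hw => by
        have h := (mem_filter.1 hw).2
        rw [requestGraph, SimpleGraph.fromRel_adj] at h
        exact mem_nbrs.2 h.2
      refine lt_of_le_of_lt (card_le_card h1) ?_
      have h4 := hH.card_nbrs_le v
      have h5 : (0 : ℝ) < k := Nat.cast_pos.2 hk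
      have h6 : (1 - ε) * k < k := by nlinarith
      exact_mod_cast h4.trans_lt h6)
  refine ⟨f, fun e he h => ?_, fun i => ?_⟩
  · refine h2 _ (mem_univ _) _ (mem_univ _) ?_ h
    rw [requestGraph, SimpleGraph.fromRel_adj]
    exact ⟨hH.1 e he, .inl he⟩
  · refine le_trans (card_le_card fun v hv => ?_) (h3 i (mem_univ i))
    rw [EquitableColoring.mem_cls]
    exact ⟨mem_univ v, (mem_filter.1 hv).2⟩

/-- The start of an epoch for suitable parameters. -/
lemma exists_start_of_large {ε K : ℝ} (hε : 0 < ε) (hε1 : ε ≤ 1) (hk : 0 < k) {s : ℕ}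
    (hs : Fintype.card V = s * k) (hV : 0 < Fintype.card V)
    (hK : (k : ℝ) ^ 2 ≤ K * Fintype.card V) {B : ℕ} (hB : 0 < B) (hB1 : 256 / ε ^ 5 ≤ B)
    (hB2 : 512 * K / ε ^ 2 ≤ B) (hn : 8 * K / ε ^ 2 ≤ Fintype.card V) {M a W : ℕ}
    (hM : ε ^ 2 * Fintype.card V / 16 ≤ M + 1) (ha : (a : ℝ) ≤ ε * Fintype.card V / (2 * k))
    (hW : (W : ℝ) ≤ ε ^ 3 / (1024 * B) * (Fintype.card V * k)) {H : List (V × V)}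
    (hH : IsAdmissible ε k H) :
    ∃ F : (V → Fin k) → Option ((V → Fin k) × Finset V),
      (∀ ℓ c U, F ℓ = some (c, U) →
        (∀ e ∈ H, e.1 ∉ U → e.2 ∉ U → c e.1 ≠ c e.2) ∧
        (∀ i, (#(univ.filter fun v => v ∉ U ∧ c v = i) : ℝ) + a ≤
          (1 + ε) * ((Fintype.card V : ℝ) / k)) ∧ #U ≤ M) ∧
      ∀ w : List (V × V), (∀ e ∈ w, e.1 ≠ e.2) → w.length ≤ W →
        𝔼 ℓ, Strategy.startPot M ε w (F ℓ) ≤ 3 / 8 := by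
  have hk' : (0 : ℝ) < k := Nat.cast_pos.2 hk
  have : Nonempty (Fin k) := ⟨⟨0, hk⟩⟩
  have hB' : (0 : ℝ) < B := Nat.cast_pos.2 hB
  have hn0 : (0 : ℝ) < Fintype.card V := Nat.cast_pos.2 hV
  have hnk : (Fintype.card V : ℝ) = s * k := by rw [hs]; push_cast; ring
  set n : ℝ := (Fintype.card V : ℝ) with hndef
  have hM' : 1 / ((M : ℝ) + 1) ≤ 16 / (ε ^ 2 * n) := by
    rw [div_le_div_iff₀ (by positivity) (by positivity)]
    linarith
  rcases le_or_gt B k with hBk | hBk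
  -- The room for rounding up the class size: (1 + ε/8)n/k + 1 + (ε/2)n/k ≤ (1 + ε)n/k.
  · have hlarge : 1 ≤ 3 * ε / 8 * (n / k) := by
      have h1 : 8 * K ≤ n * ε ^ 2 := (div_le_iff₀ (by positivity)).1 hn
      have h2 : (8 * (k : ℝ)) ^ 2 ≤ (3 * ε * n) ^ 2 := by nlinarith [mul_le_mul_of_nonneg_right h1 hn0.le]
      have h3 := abs_le_of_sq_le_sq h2 (by positivity)
      rw [abs_of_pos (by positivity)] at h3
      have h4 : 3 * ε / 8 * (n / k) = 3 * ε * n / (8 * k) := by field_simp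
      rw [h4, le_div_iff₀ (by positivity)]
      linarith
    obtain ⟨F, h1, h2⟩ := exists_start hε hV hB hBk hH (Nat.le_ceil _) M
    refine ⟨F, fun ℓ c U h => ⟨(h1 ℓ c U h).1, fun i => ?_, (h1 ℓ c U h).2.2⟩, fun w hw hwl => ?_⟩
    · have h3 : (#(univ.filter fun v => v ∉ U ∧ c v = i) : ℝ) ≤
          (⌈(1 + ε / 8) * (n / k)⌉₊ : ℝ) := Nat.cast_le.2 ((h1 ℓ c U h).2.1 i)
      have h4 := (Nat.ceil_lt_add_one (show 0 ≤ (1 + ε / 8) * (n / k) by positivity)).le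
      have h5 : ε * n / (2 * k) = ε / 2 * (n / k) := by field_simp
      rw [h5] at ha
      linarith
    · refine (h2 w hw).trans ?_
      have hw' : (w.length : ℝ) ≤ ε ^ 3 / (1024 * B) * (n * k) :=
        (Nat.cast_le.2 hwl).trans hW
      -- The 3/8 consists of 1/8 for overfull palettes (`t1`), 1/8 for bad vertices (`t4`) and 1/16
      -- for conflicts (`t5`), with 1/16 to spare.
      have t1 : 64 * (k : ℝ) ^ 2 / (ε ^ 2 * n * B) ≤ 1 / 8 := by
        rw [div_le_div_iff₀ (by positivity) (by positivity)]
        have := (div_le_iff₀ (by positivity)).1 hB2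
        nlinarith [mul_le_mul_of_nonneg_right this hn0.le]
      have t2 : n * (1 / (ε ^ 2 * B)) * (1 + 1 / ε) ≤ n * (1 / (ε ^ 2 * B)) * (2 / ε) := by
        gcongr
        rw [le_div_iff₀ hε]
        field_simp
        linarith
      have t3 : 2 / ε * (w.length * (2 * B / k)) ≤
          2 / ε * (ε ^ 3 / (1024 * B) * (n * k) * (2 * B / k)) := by gcongr
      have t4 : n * (1 / (ε ^ 2 * B)) * (2 / ε) * (16 / (ε ^ 2 * n)) ≤ 1 / 8 := by
        have h6 := (div_le_iff₀ (by positivity)).1 hB1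
        have h7 : n * (1 / (ε ^ 2 * B)) * (2 / ε) * (16 / (ε ^ 2 * n)) = 32 / (B * ε ^ 5) := by
          field_simp
          norm_num
        rw [h7, div_le_div_iff₀ (by positivity) (by positivity)]
        linarith
      have t5 : 2 / ε * (ε ^ 3 / (1024 * B) * (n * k) * (2 * B / k)) * (16 / (ε ^ 2 * n)) =
          1 / 16 := by
        field_simp
        norm_num
      have t6 : (n * (1 / (ε ^ 2 * B)) * (1 + 1 / ε) + 2 / ε * (w.length * (2 * B / k))) / (M + 1) ≤
          (n * (1 / (ε ^ 2 * B)) * (2 / ε) +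
            2 / ε * (ε ^ 3 / (1024 * B) * (n * k) * (2 * B / k))) * (16 / (ε ^ 2 * n)) := by
        rw [div_eq_mul_one_div]
        exact mul_le_mul (add_le_add t2 t3) hM' (by positivity) (by positivity)
      rw [add_mul, t5] at t6
      linarith
  -- With fewer than `B` colors no randomness is needed: even if every request of the window is a
  -- conflict, there are at most `W`, a small multiple of n.
  · obtain ⟨g, h1, h2⟩ := exists_balanced_coloring hε hk hs hH
    refine ⟨fun _ => some (g, ∅), fun ℓ c U h => ?_, fun w hw hwl => ?_⟩
    · obtain ⟨rfl, rfl⟩ := Prod.mk.inj (Option.some.inj h)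
      refine ⟨fun e he _ _ => h1 e he, fun i => ?_, by simp⟩
      have h3 : (#(univ.filter fun v => v ∉ (∅ : Finset V) ∧ g v = i) : ℝ) ≤ s := by
        refine Nat.cast_le.2 (le_trans (card_le_card fun v hv => ?_) (h2 i))
        exact mem_filter.2 ⟨mem_univ _, (mem_filter.1 hv).2.2⟩
      have h4 : n / k = s := by rw [hnk]; field_simp
      have h5 : ε * n / (2 * k) = ε / 2 * s := by rw [← h4]; field_simp
      rw [h5] at ha
      rw [h4]
      have : 0 ≤ ε * s := by positivity
      linarith
    · rw [Fintype.expect_const]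
      have h3 : (#(Strategy.conflicts w g ∅) : ℝ) ≤ ε ^ 3 / (1024 * B) * (n * k) := by
        refine le_trans (Nat.cast_le.2 ?_) hW
        exact ((card_filter_le _ _).trans (List.toFinset_card_le w)).trans hwl
      have h4 : (k : ℝ) ≤ B := Nat.cast_le.2 hBk.le
      have h5 : (n * k : ℝ) ≤ n * B := by gcongr
      simp only [Strategy.startPot, card_empty, Nat.cast_zero, zero_div, zero_add]
      rw [div_eq_mul_one_div]
      refine (mul_le_mul (mul_le_mul_of_nonneg_left (h3.trans (mul_le_mul_of_nonneg_left h5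
        (by positivity))) (by positivity)) hM' (by positivity) (by positivity)).trans ?_
      have h6 : 2 / ε * (ε ^ 3 / (1024 * B) * (n * B)) * (16 / (ε ^ 2 * n)) = 1 / 32 := by
        field_simp
        norm_num
      rw [h6]
      norm_num

/-- Put x = εn/k. The numerator is at most exp(2/ε + x/16) and the power of 2 at least exp(x/4), so
exp(x/8) is gained. The term (x/8)⁴/24 of its series is enough; 98304 = 24 · 8⁴. -/
lemma pow_div_two_pow_le {ε n : ℝ} (hε : 0 < ε) (hn : 0 < n) (hk : 0 < k) {M a : ℕ}
    (hM : (M : ℝ) ≤ ε ^ 2 * n / 16) (ha : ε * n / (2 * k) ≤ a + 1) :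
    (1 + 1 / (ε * k)) ^ (M + 2) / 2 ^ (a + 1) * k ≤
      Real.exp (2 / ε) * 98304 / ε ^ 4 * ((k : ℝ) ^ 5 / n ^ 4) := by
  have hk' : (1 : ℝ) ≤ k := Nat.one_le_cast.2 hk
  have h1 : (1 + 1 / (ε * k)) ^ (M + 2) ≤ Real.exp (2 / ε + ε * n / (16 * k)) := by
    have h2 : 1 + 1 / (ε * k) ≤ Real.exp (1 / (ε * k)) := by
      linarith [Real.add_one_le_exp (1 / (ε * k))]
    refine (pow_le_pow_left₀ (by positivity) h2 _).trans ?_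
    rw [← Real.exp_nat_mul, Real.exp_le_exp]
    push_cast
    have h3 : ((M : ℝ) + 2) * (1 / (ε * k)) ≤ (ε ^ 2 * n / 16 + 2) * (1 / (ε * k)) := by gcongr
    refine h3.trans ?_
    have h4 : (ε ^ 2 * n / 16 + 2) * (1 / (ε * k)) = 2 / ε / k + ε * n / (16 * k) := by
      field_simp
      ring
    rw [h4]
    have : 2 / ε / k ≤ 2 / ε := div_le_self (by positivity) hk'
    linarith
  have h2 : Real.exp (ε * n / (4 * k)) ≤ 2 ^ (a + 1) := by
    have h3 : Real.exp (1 / 2) ≤ 2 := by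
      have := Real.log_two_gt_d9
      rw [← Real.le_log_iff_exp_le (by norm_num)]
      linarith
    refine le_trans ?_ (pow_le_pow_left₀ (Real.exp_pos _).le h3 _)
    rw [← Real.exp_nat_mul, Real.exp_le_exp]
    push_cast
    have h4 : ε * n / (4 * k) = ε * n / (2 * k) * (1 / 2) := by field_simp; norm_num
    rw [h4]
    gcongr
  have h3 : (ε * n / (8 * k)) ^ 4 / 24 ≤ Real.exp (ε * n / (8 * k)) := by
    have := Real.pow_div_factorial_le_exp (ε * n / (8 * k)) (by positivity) 4
    norm_num [Nat.factorial] at this ⊢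
    exact this
  have h4 : Real.exp (2 / ε + ε * n / (16 * k)) * Real.exp (ε * n / (8 * k)) ≤
      Real.exp (2 / ε) * Real.exp (ε * n / (4 * k)) := by
    rw [← Real.exp_add, ← Real.exp_add, Real.exp_le_exp]
    have h5 : ε * n / (16 * k) = ε * n / k / 16 := by field_simp
    have h6 : ε * n / (8 * k) = ε * n / k / 8 := by field_simp
    have h7 : ε * n / (4 * k) = ε * n / k / 4 := by field_simp
    have : 0 ≤ ε * n / k := by positivity
    rw [h5, h6, h7]
    linarith
  have h5 : (1 + 1 / (ε * k)) ^ (M + 2) / 2 ^ (a + 1) ≤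
      Real.exp (2 / ε) / ((ε * n / (8 * k)) ^ 4 / 24) := by
    rw [div_le_div_iff₀ (by positivity) (by positivity)]
    calc _ ≤ Real.exp (2 / ε + ε * n / (16 * k)) * Real.exp (ε * n / (8 * k)) := by gcongr
      _ ≤ _ := h4
      _ ≤ _ := by gcongr
  refine (mul_le_mul_of_nonneg_right h5 (by positivity)).trans (le_of_eq ?_)
  field_simp
  norm_num

lemma length_le_of_isAdmissible {ε : ℝ} (hε : 0 < ε) {σ ρ : List (V × V)} (hσ : IsAdmissible ε k σ)
    (hρ : ∀ e ∈ ρ, e ∈ σ) (hnd : ρ.Nodup) : ρ.length ≤ Fintype.card V * k := by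
  rw [← List.toFinset_card_of_nodup hnd]
  have h1 : ρ.toFinset ⊆ univ.biUnion fun v => (nbrs σ v).image fun w => (v, w) := by
    rintro ⟨v, w⟩ he
    simp only [mem_biUnion, mem_univ, true_and, mem_image]
    exact ⟨v, w, mem_nbrs.2 (.inl (hρ _ (List.mem_toFinset.1 he))), rfl⟩
  refine (card_le_card h1).trans (card_biUnion_le_card_mul _ _ _ fun v _ => ?_)
  refine card_image_le.trans ?_
  have h2 := hσ.card_nbrs_le v
  have h3 : (1 - ε) * k ≤ k := by
    have : 0 ≤ ε * k := by positivity
    linarith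
  exact_mod_cast h2.trans h3

lemma length_le_sq {ρ : List (V × V)} (hnd : ρ.Nodup) : ρ.length ≤ Fintype.card V ^ 2 := by
  rw [← List.toFinset_card_of_nodup hnd, sq, ← Fintype.card_prod]
  exact card_le_univ _

omit [DecidableEq V] in
lemma hammingDist_le_recoloringCost (s : ℕ → V → Fin k) (T : ℕ) :
    hammingDist (s 0) (s T) ≤ recoloringCost s T := by
  induction T with
  | zero => simp [recoloringCost]
  | succ T ih =>
    refine (hammingDist_triangle _ (s T) _).trans ?_
    unfold recoloringCost at ih ⊢
    rw [sum_range_succ]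
    exact Nat.add_le_add_right ih _

namespace Strategy

/-- A bound in terms of the vertices that every offline solution recolors gives competitiveness. -/
lemma isCompetitive_of_futureCost_le (S : Strategy V k) {ε : ℝ} {C : ℝ≥0} (hC : 0 < C)
    (hS : Fintype.card V ^ 2 ≤ S.horizon)
    (h : ∀ c₀ σ ρ, IsAdmissible ε k σ → (∀ e ∈ ρ, e ∈ σ) → ρ.Nodup → ∀ D : Finset V, D.Nonempty →
      (∀ e ∈ ρ, c₀ e.1 = c₀ e.2 → e.1 ∈ D ∨ e.2 ∈ D) → S.futureCost [] ρ (S.init c₀) ≤ C * #D) :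
    S.algorithm.IsCompetitive ε C := by
  intro c₀ _ σ hσ
  obtain ⟨ρ, h1, h2, h3⟩ := S.expectedCost_eq c₀ σ
  have hC' : (C : ℝ≥0∞) ≠ 0 := by exact_mod_cast hC.ne'
  rw [h3, offlineOpt, ENNReal.mul_iInf_of_ne hC' ENNReal.coe_ne_top]
  refine le_iInf fun s => ?_
  rw [ENNReal.mul_iInf_of_ne hC' ENNReal.coe_ne_top]
  refine le_iInf fun hs => ?_
  have hf := hs.2 σ.length le_rfl
  rw [List.take_length] at hf
  have hdist := hammingDist_le_recoloringCost s σ.length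
  rw [hs.1] at hdist
  set f := s σ.length
  -- A request monochromatic under `c₀` must have had an end recolored by the offline solution, and
  -- `#D` is at most the offline cost.
  set D : Finset V := univ.filter fun v => c₀ v ≠ f v with hD
  have hcover : ∀ e ∈ ρ, c₀ e.1 = c₀ e.2 → e.1 ∈ D ∨ e.2 ∈ D := by
    intro e he hc
    by_contra hcon
    simp only [hD, mem_filter, mem_univ, true_and, not_or, not_not] at hcon
    exact hf e (h2 e he) (by rw [← hcon.1, ← hcon.2, hc])
  rcases D.eq_empty_or_nonempty with hD0 | hD0
  -- No additive constant is allowed, so without conflicts the cost must vanish. The horizon n²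
  -- bounds the number of distinct requests, so the first epoch does not time out.
  · have h4 : S.futureCost [] ρ (S.init c₀) = 0 := by
      refine S.futureCost_eq_zero ρ [] _ (fun e he hc => ?_) ((length_le_sq h1).trans hS) ?_
      · have := hcover e he hc
        simp [hD0] at this
      · simp [check]
    rw [h4]
    simp
  · refine le_trans (ENNReal.ofReal_le_ofReal (h c₀ σ ρ hσ h2 h1 D hD0 hcover)) ?_
    rw [ENNReal.ofReal_mul (NNReal.coe_nonneg C), ENNReal.ofReal_coe_nnreal, ENNReal.ofReal_natCast]
    gcongr
    exact hdist

variable {ε : ℝ}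

lemma exists_of_small (hε : 0 < ε) (hk : 0 < k) {s : ℕ} (hs : Fintype.card V = s * k) {C : ℝ≥0}
    (hC : 0 < C) (hVC : (Fintype.card V : ℝ) ^ 3 ≤ C) :
    ∃ A : RandomizedAlgorithm V k, A.IsFeasible ε ∧ A.IsCompetitive ε C := by
  have : Nonempty (Fin k) := ⟨⟨0, hk⟩⟩
  have hk' : (0 : ℝ) < k := Nat.cast_pos.2 hk
  have hex : ∀ H : List (V × V), ∃ g : V → Fin k, IsAdmissible ε k H →
      IsProper g H ∧ ∀ i, load g i ≤ s := by
    intro H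
    by_cases hH : IsAdmissible ε k H
    · obtain ⟨g, hg⟩ := exists_balanced_coloring hε hk hs hH
      exact ⟨g, fun _ => hg⟩
    · exact ⟨fun _ => ⟨0, hk⟩, fun h => absurd h hH⟩
  choose g hg using hex
  have hnk : (Fintype.card V : ℝ) / k = s := by
    rw [hs]; push_cast; field_simp
  -- The first conflict makes the epoch fail, and every restart fails. From then on the fallback is
  -- held, at cost at most n for each of at most n² new requests, which `C` covers.
  let S : Strategy V k := ⟨Unit, fun _ _ => none, g, 0, 0, 1, Fintype.card V ^ 2⟩
  have hload : (s : ℝ) ≤ (1 + ε) * s := by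
    have : 0 ≤ ε * s := by positivity
    linarith
  refine ⟨S.algorithm, Valid.isFeasible ?_ hε hk, S.isCompetitive_of_futureCost_le hC le_rfl ?_⟩
  · refine ⟨fun H hH ℓ c U h => ?_, fun H hH ℓ c U h => ?_, fun H hH => (hg H hH).1,
      fun H hH i => ?_, ?_⟩
    · simp [S] at h
    · simp [S] at h
    · rw [hnk]
      exact (Nat.cast_le.2 ((hg H hH).2 i)).trans hload
    · rw [hnk]
      simpa [S] using hload
  · intro c₀ σ ρ _ _ hnd D hD _
    refine (S.futureCost_le_card_mul ρ [] _).trans ?_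
    have h1 : (ρ.length : ℝ) ≤ (Fintype.card V : ℝ) ^ 2 := by exact_mod_cast length_le_sq hnd
    have h2 : (1 : ℝ) ≤ #D := Nat.one_le_cast.2 hD.card_pos
    calc (Fintype.card V : ℝ) * ρ.length ≤ Fintype.card V * (Fintype.card V : ℝ) ^ 2 := by gcongr
      _ = (Fintype.card V : ℝ) ^ 3 := by ring
      _ ≤ C := hVC
      _ = C * 1 := (mul_one _).symm
      _ ≤ C * #D := by gcongr

lemma exists_of_large (hε : 0 < ε) (hε1 : ε ≤ 1) (hk : 0 < k) {s : ℕ}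
    (hs : Fintype.card V = s * k) (hV : 0 < Fintype.card V) {K : ℝ}
    (hK : (k : ℝ) ^ 2 ≤ K * Fintype.card V) {B : ℕ} (hB : 0 < B) (hB1 : 256 / ε ^ 5 ≤ B)
    (hB2 : 512 * K / ε ^ 2 ≤ B) (hn1 : 8 * K / ε ^ 2 ≤ Fintype.card V) {δ P : ℝ}
    (hδ : δ = ε ^ 3 / (1024 * B)) (hP : P = Real.exp (2 / ε) * 98304 / ε ^ 4 * K ^ 3)
    (hn2 : 1 / δ ≤ Fintype.card V) (hn3 : 8 * P ≤ Fintype.card V) {C : ℝ≥0} (hC : 0 < C)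
    (hC1 : 2 / ε + (7 + 12 / δ) * (32 / ε ^ 3 + P) ≤ C) :
    ∃ A : RandomizedAlgorithm V k, A.IsFeasible ε ∧ A.IsCompetitive ε C := by
  have : Nonempty (Fin k) := ⟨⟨0, hk⟩⟩
  have hk' : (0 : ℝ) < k := Nat.cast_pos.2 hk
  have hk1 : (1 : ℝ) ≤ k := Nat.one_le_cast.2 hk
  have hB' : (0 : ℝ) < B := Nat.cast_pos.2 hB
  have hn0 : (0 : ℝ) < Fintype.card V := Nat.cast_pos.2 hV
  have hδ0 : 0 < δ := by rw [hδ]; positivity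
  have hnk : (Fintype.card V : ℝ) / k = s := by
    rw [hs]; push_cast; field_simp
  set n : ℝ := (Fintype.card V : ℝ) with hndef
  have hM := Nat.floor_le (show 0 ≤ ε ^ 2 * n / 16 by positivity)
  have hM' := (Nat.lt_floor_add_one (ε ^ 2 * n / 16)).le
  have ha := Nat.floor_le (show 0 ≤ ε * n / (2 * k) by positivity)
  have ha' := (Nat.lt_floor_add_one (ε * n / (2 * k))).le
  have hW := Nat.floor_le (show 0 ≤ δ * (n * k) by positivity)
  have hW1 : 1 ≤ δ * (n * k) := by
    have h1 := (div_le_iff₀ hδ0).1 hn2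
    have h2 : n * δ * 1 ≤ n * δ * k := by gcongr
    linarith
  have hW2 : 1 ≤ ⌊δ * (n * k)⌋₊ := Nat.le_floor (by exact_mod_cast hW1)
  -- The floor loses at most a factor 2 because it is at least 1. Hence 2/δ windows suffice, and `Γ`
  -- below is n + 6n(2/δ + 1) = n(7 + 12/δ).
  have hW' : δ * (n * k) / 2 ≤ ⌊δ * (n * k)⌋₊ := by
    have h1 := Nat.lt_floor_add_one (δ * (n * k))
    have h2 : (1 : ℝ) ≤ (⌊δ * (n * k)⌋₊ : ℝ) := Nat.one_le_cast.2 hW2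
    linarith
  set M := ⌊ε ^ 2 * n / 16⌋₊
  set a := ⌊ε * n / (2 * k)⌋₊
  set W := ⌊δ * (n * k)⌋₊
  have hex : ∀ H : List (V × V), ∃ F : (V → Fin k) → Option ((V → Fin k) × Finset V),
      ∃ g : V → Fin k, IsAdmissible ε k H → ((∀ ℓ c U, F ℓ = some (c, U) →
        (∀ e ∈ H, e.1 ∉ U → e.2 ∉ U → c e.1 ≠ c e.2) ∧
        (∀ i, (#(univ.filter fun v => v ∉ U ∧ c v = i) : ℝ) + a ≤ (1 + ε) * (n / k)) ∧ #U ≤ M) ∧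
      ∀ w : List (V × V), (∀ e ∈ w, e.1 ≠ e.2) → w.length ≤ W →
        𝔼 ℓ, Strategy.startPot M ε w (F ℓ) ≤ 3 / 8) ∧ IsProper g H ∧ ∀ i, load g i ≤ s := by
    intro H
    by_cases hH : IsAdmissible ε k H
    · obtain ⟨g, hg⟩ := exists_balanced_coloring hε hk hs hH
      rw [hδ] at hW
      obtain ⟨F, hF⟩ := exists_start_of_large hε hε1 hk hs hV hK hB hB1 hB2 hn1 hM' ha hW hH
      exact ⟨F, g, fun _ => ⟨hF, hg⟩⟩
    · exact ⟨fun _ => none, fun _ => ⟨0, hk⟩, fun h => absurd h hH⟩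
  choose F g hFg using hex
  let S : Strategy V k := ⟨V → Fin k, F, g, M, a, W, Fintype.card V ^ 2⟩
  have hK0 : 0 < K := pos_of_mul_pos_left (lt_of_lt_of_le (by positivity) hK) hn0.le
  have hpick : (1 + 1 / (ε * k)) ^ (M + 2) / 2 ^ (a + 1) * k ≤ P / n := by
    refine (pow_div_two_pow_le hε hn0 hk hM ha').trans ?_
    rw [hP, mul_div_assoc _ _ n]
    refine mul_le_mul_of_nonneg_left ?_ (by positivity)
    -- From k² ≤ Kn one gets k⁵ ≤ k⁶ ≤ K³n³, which leaves K³/n.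
    rw [div_le_div_iff₀ (by positivity) hn0]
    have h1 : (k : ℝ) ^ 5 ≤ k ^ 6 := pow_le_pow_right₀ hk1 (by norm_num)
    have h2 : ((k : ℝ) ^ 2) ^ 3 ≤ (K * n) ^ 3 := by gcongr
    calc (k : ℝ) ^ 5 * n ≤ (K * n) ^ 3 * n := by
          gcongr
          exact h1.trans (le_trans (le_of_eq (by ring)) h2)
      _ = K ^ 3 * n ^ 4 := by ring
  have hP0 : 0 ≤ P := by rw [hP]; positivity
  refine ⟨S.algorithm, Valid.isFeasible ?_ hε hk, S.isCompetitive_of_futureCost_le hC le_rfl ?_⟩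
  · refine ⟨fun H hH ℓ c U h => ((hFg H hH).1.1 ℓ c U h).1,
      fun H hH ℓ c U h => ((hFg H hH).1.1 ℓ c U h).2.1, fun H hH => (hFg H hH).2.1,
      fun H hH i => ?_, ?_⟩
    · change _ ≤ (1 + ε) * (n / k)
      rw [hnk]
      have h1 : (load (g H) i : ℝ) ≤ s := Nat.cast_le.2 ((hFg H hH).2.2 i)
      have : 0 ≤ ε * s := by positivity
      change (load (g H) i : ℝ) ≤ _
      linarith
    · change n / k + (a : ℝ) ≤ (1 + ε) * (n / k)
      have h1 : ε * n / (2 * k) = ε * (n / k) / 2 := by field_simp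
      have : 0 ≤ ε * (n / k) := by positivity
      linarith
  · intro c₀ σ ρ hσ hρ hnd D hD hcover
    have hops : M ≤ Fintype.card V := by
      have h1 : ε ^ 2 * n / 16 ≤ n := by
        have : ε ^ 2 * n ≤ 1 * n := by gcongr; exact pow_le_one₀ hε.le hε1
        linarith
      exact Nat.cast_le.1 (hM.trans h1)
    have hPn : P / n ≤ 1 / 8 := by
      rw [div_le_div_iff₀ hn0 (by norm_num)]
      linarith
    have h2 := S.futureCost_init_le (L := n * k) (Γ := n * (7 + 12 / δ)) (D := D) (c₀ := c₀)
      hσ hε hε1 hk hops hW2 (fun H w hH hw hwnd hwl => by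
        refine (S.expect_failProb_restart hσ hε hε1 hk hH hw fun ℓ c U h =>
          ((hFg H (hσ.mono hH)).1.1 ℓ c U h).2.2).trans ?_
        have h3 := (hFg H (hσ.mono hH)).1.2 w (fun e he => hσ.1 e (hw e he)) hwl
        change 𝔼 ℓ, Strategy.startPot M ε w (F H ℓ) +
          (1 + 1 / (ε * k)) ^ (M + 2) / 2 ^ (a + 1) * k ≤ 1 / 2
        linarith) (by
        change n + 6 * n * (n * k / W + 1) ≤ n * (7 + 12 / δ)
        have h4 : n * k / W ≤ 2 / δ := by
          rw [div_le_div_iff₀ (by positivity) hδ0]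
          linarith
        have h5 : 6 * n * (n * k / W + 1) ≤ 6 * n * (2 / δ + 1) := by gcongr
        refine (add_le_add_right h5 n).trans (le_of_eq ?_)
        ring) hρ hnd (by
        rw [hndef]; exact_mod_cast length_le_of_isAdmissible hε hσ hρ hnd) (length_le_sq hnd)
        hcover
    refine h2.trans ?_
    change 2 / ε * (#D : ℝ) + n * (7 + 12 / δ) * (2 / ε * #D / (M + 1) +
      (1 + 1 / (ε * k)) ^ (M + 2) / 2 ^ (a + 1) * k) ≤ _
    have hD1 : (1 : ℝ) ≤ #D := Nat.one_le_cast.2 hD.card_pos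
    have h6 : 2 / ε * (#D : ℝ) / (M + 1) ≤ 32 / ε ^ 3 * #D / n := by
      rw [div_le_div_iff₀ (by positivity) hn0]
      calc 2 / ε * (#D : ℝ) * n = 32 / ε ^ 3 * #D * (ε ^ 2 * n / 16) := by field_simp; norm_num
        _ ≤ _ := by gcongr
    have h7 : P / n ≤ P * #D / n := by
      gcongr
      exact le_mul_of_one_le_right hP0 hD1
    calc _ ≤ 2 / ε * (#D : ℝ) + n * (7 + 12 / δ) * (32 / ε ^ 3 * #D / n + P * #D / n) := by
          gcongr
          exact hpick.trans h7
      _ = (2 / ε + (7 + 12 / δ) * (32 / ε ^ 3 + P)) * #D := by field_simp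
      _ ≤ C * #D := by gcongr

end Strategy

omit [Fintype V] [DecidableEq V] in
lemma IsAdmissible.anti {ε ε' : ℝ} (h : ε' ≤ ε) {σ : List (V × V)} (hσ : IsAdmissible ε k σ) :
    IsAdmissible ε' k σ :=
  ⟨hσ.1, fun v => (hσ.2 v).trans (by gcongr)⟩

/-- Without a balanced coloring there is nothing to do. -/
lemma exists_of_not_isBalanced (hk : 0 < k) (h : ∀ c : V → Fin k, ¬ IsBalanced c) (ε : ℝ)
    (C : ℝ≥0) : ∃ A : RandomizedAlgorithm V k, A.IsFeasible ε ∧ A.IsCompetitive ε C :=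
  have : Nonempty (Fin k) := ⟨⟨0, hk⟩⟩
  let S : Strategy V k := ⟨Unit, fun _ _ => none, fun _ _ => ⟨0, hk⟩, 0, 0, 1, 0⟩
  ⟨S.algorithm, fun c hc => absurd hc (h c), fun c hc => absurd hc (h c)⟩

end OnlineRecoloring

theorem theorem7 (ε : ℝ) (hε : 0 < ε) (K : ℝ) :
    ∃ C : ℝ≥0, ∀ n Δ : ℕ, 2 ≤ n → 1 ≤ Δ →
      (Δ : ℝ) ≤ K * Real.sqrt ((n : ℝ) / Real.log n) →
      ∃ A : OnlineRecoloring.RandomizedAlgorithm (Fin n) Δ,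
        A.IsFeasible ε ∧ A.IsCompetitive ε C := by
  open OnlineRecoloring in
  -- Passing to min(ε, 1) is harmless: it admits more request sequences and allows less capacity.
  obtain ⟨η, hη0, hη1, hηε⟩ : ∃ η : ℝ, 0 < η ∧ η ≤ 1 ∧ η ≤ ε :=
    ⟨min ε 1, lt_min hε one_pos, min_le_right _ _, min_le_left _ _⟩
  -- Since log n ≥ log 2, the hypothesis gives Δ² ≤ K'n, and this is all that is used.
  set K' : ℝ := K ^ 2 / Real.log 2 with hK'
  have hlog2 : 0 < Real.log 2 := Real.log_pos (by norm_num)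
  obtain ⟨B, hB⟩ := exists_nat_ge (max 1 (max (256 / η ^ 5) (512 * K' / η ^ 2)))
  simp only [max_le_iff] at hB
  obtain ⟨hB0, hB1, hB2⟩ := hB
  have hB0 : 0 < B := by exact_mod_cast hB0
  obtain ⟨δ, hδ⟩ : ∃ δ, δ = η ^ 3 / (1024 * (B : ℝ)) := ⟨_, rfl⟩
  obtain ⟨P, hP⟩ : ∃ P, P = Real.exp (2 / η) * 98304 / η ^ 4 * K' ^ 3 := ⟨_, rfl⟩
  obtain ⟨N, hN⟩ := exists_nat_ge (max (8 * K' / η ^ 2) (max (1 / δ) (8 * P)))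
  simp only [max_le_iff] at hN
  obtain ⟨hN1, hN2, hN3⟩ := hN
  obtain ⟨C, hC⟩ := exists_nat_ge
    (max 1 (max ((N : ℝ) ^ 3) (2 / η + (7 + 12 / δ) * (32 / η ^ 3 + P))))
  simp only [max_le_iff] at hC
  obtain ⟨hC0, hC1, hC2⟩ := hC
  have hC0 : (0 : ℝ≥0) < (C : ℝ≥0) := by
    have : 1 ≤ C := by exact_mod_cast hC0
    exact_mod_cast this
  refine ⟨C, fun n Δ hn hΔ hnΔ => ?_⟩
  suffices h : ∃ A : RandomizedAlgorithm (Fin n) Δ, A.IsFeasible η ∧ A.IsCompetitive η C by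
    obtain ⟨A, hA1, hA2⟩ := h
    refine ⟨A, fun c₀ hc₀ σ hσ ω t ht => ?_, fun c₀ hc₀ σ hσ => hA2 c₀ hc₀ σ (hσ.anti hηε)⟩
    obtain ⟨h1, h2⟩ := hA1 c₀ hc₀ σ (hσ.anti hηε) ω t ht
    exact ⟨h1, fun i => (h2 i).trans (by gcongr)⟩
  by_cases hbal : ∃ c : Fin n → Fin Δ, IsBalanced c
  · obtain ⟨c, hc⟩ := hbal
    have hs : Fintype.card (Fin n) = load c ⟨0, hΔ⟩ * Δ := by
      have h1 := hc ⟨0, hΔ⟩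
      have h2 : (0 : ℝ) < Δ := Nat.cast_pos.2 hΔ
      rw [eq_div_iff h2.ne'] at h1
      exact_mod_cast h1.symm
    rcases le_or_gt N n with hNn | hNn
    · have hN' : (N : ℝ) ≤ Fintype.card (Fin n) := by
        rw [Fintype.card_fin]; exact Nat.cast_le.2 hNn
      refine Strategy.exists_of_large hη0 hη1 hΔ hs (by rw [Fintype.card_fin]; omega) (K := K') ?_
        hB0 hB1 hB2 (hN1.trans hN') hδ hP (hN2.trans hN') (hN3.trans hN') hC0
        (by exact_mod_cast hC2)
      rw [Fintype.card_fin]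
      have h1 : (Δ : ℝ) ^ 2 ≤ (K * Real.sqrt ((n : ℝ) / Real.log n)) ^ 2 := by gcongr
      have h2 : Real.log 2 ≤ Real.log n :=
        Real.log_le_log (by norm_num) (by exact_mod_cast hn)
      have h3 : 0 < Real.log n := hlog2.trans_le h2
      rw [mul_pow, Real.sq_sqrt (by positivity)] at h1
      refine h1.trans ?_
      rw [hK', div_mul_eq_mul_div, mul_div_assoc]
      gcongr
    · refine Strategy.exists_of_small hη0 hΔ hs hC0 (le_trans ?_ hC1)
      rw [Fintype.card_fin]
      gcongr
  · exact exists_of_not_isBalanced hΔ (not_exists.1 hbal) _ _
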